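/- Let $g\ge 0$ and $n>0$ be integers, let $\mu,\nu$ be partitions of $n$ of lengths $\ell(\mu),\ell(\nu)$, and put $b=g-1+\ell(\mu)+\ell(\nu)$. **Twisted double Hurwitz numbers.** Let $\tau=(1\;\,n{+}1)(2\;\,n{+}2)\cdots(n\;\,2n)\in\mathbb S_{2n}$. Let $B^\sim_n$ be the set of $\sigma\in\mathbb S_{2n}$ with $\tau\sigma\tau=\sigma^{-1}$ such that no cycle $c$ of $\sigma$ satisfies $\tau c\tau=c^{-1}$. For a partition $\lambda$ of $n$, let $2\lambda$ be the partition of $2n$ in which every part of $\lambda$ is taken twice, and let $B^\sim_\lambda\subset B^\sim_n$ be the subset of permutations of cycle type $2\lambda$. Let $C_g(\mu,\nu)$ be the set of tuples $(\sigma_1,\eta_1,\dots,\eta_b,\sigma_2)$ in $\mathbb S_{2n}$ such that $\sigma_1\in B^\sim_\mu$; $\sigma_2$ has cycle type $2\nu$; every $\eta_i$ is a transposition with $\eta_i\ne\tau\eta_i\tau$; $\eta_b\cdots\eta_1\,\sigma_1\,(\tau\eta_1\tau)\cdots(\tau\eta_b\tau)=\sigma_2$; and the subgroup generated by $\sigma_1,\sigma_2$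 and all $\eta_i,\tau\eta_i\tau$ acts transitively on $\{1,\dots,2n\}$. Put $\tilde h_g(\mu,\nu)=\frac{1}{(2n)!!}|C_g(\mu,\nu)|$. **Twisted monodromy graphs.** A *twisted monodromy graph of type $(g,\mu,\nu)$ without a fixed vertex ordering* is a finite connected directed graph $\Gamma$ (parallel edges are allowed) of first Betti number $g$, with a positive integer weight $\omega(e)$ on every edge and an involution $\iota$ that respects incidence, directions and weights, such that, apart from the $1$-valent vertices (leaves), whose adjacent edges are called ends (all other edges are called internal and all other vertices inner): 1. every inner vertex is $3$-valent or $4$-valent and is neither a source nor a sink, and there is no directed cycle; 2. the inner vertices fixed by $\iota$ are exactly the $4$-valent ones, and $\iota$ fixes no edge; 3. there are $2\ell(\mu)$ inward ends, two of weight $\mu_i$ for each $i$, and $2\ell(\nu)$ outward ends, two of weight $\nu_j$ for each $j$; ends exchanged by $\iota$ have the same weight; 4. at every inner vertex, the sum of the weights of the incoming edges equals the sum of the weights of the outgoing edges; 5. the four edges adjacent to a $4$-valent vertex $V$ all have the same weight, denoted $\omega_V$. Such a graph has $b$ orbits of inner vertices under $\iota$ (single $4$-valent vertices and pairs of $3$-valent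 vertices). A *compatible vertex ordering* is a total ordering of these $b$ orbits along which every internal edge is directed strictly upwards. A *twisted monodromy graph of type $(g,\mu,\nu)$* is such a graph together with a compatible vertex ordering. Isomorphisms and automorphisms act on the vertices and on the edges, and respect incidence, directions, weights and the involution; for twisted monodromy graphs (with ordering) they respect the ordering too. In particular, exchanging parallel edges, or ends at the same vertex, of the same weight can give a nontrivial automorphism. **Claim.** (a) There are only finitely many isomorphism classes of twisted monodromy graphs $\Gamma$ of type $(g,\mu,\nu)$, and $$\tilde h_g(\mu,\nu)=\sum_{\Gamma}2^b\cdot\prod_V(\omega_V-1)\cdot\prod_e\omega(e)\cdot\frac1{|\mathrm{Aut}(\Gamma)|},$$ where the sum runs over these isomorphism classes, the first product over all $4$-valent vertices $V$ of $\Gamma$, the second product over all pairs $\{e,\iota(e)\}$ of internal edges of $\Gamma$, and $\mathrm{Aut}(\Gamma)$ is the group of automorphisms that respect the vertex ordering. (b) There are only finitely many isomorphism classes of twisted monodromy graphs $\Gamma$ of type $(g,\mu,\nu)$ without a fixed vertex ordering, and $$\tilde h_g(\mu,\nu)=\sum_{\Gamma}o(\Gamma)\cdot2^b\cdot\prod_V(\omega_V-1)\cdot\prod_e\omega(e)\cdot\frac1{|\mathrm{Aut}(\Gamma)|},$$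 where now the sum runs over these isomorphism classes, $o(\Gamma)$ is the number of compatible vertex orderings of $\Gamma$, and $\mathrm{Aut}(\Gamma)$ is the group of all automorphisms of the graph without vertex ordering. -/

import Mathlib

noncomputable section

namespace TwistedHurwitz

/-! ### Twisted double Hurwitz numbers -/

/-- The set `{1, …, 2n}`; the number `i ≤ n` is `Sum.inl i`, and `n + i` is `Sum.inr i`. -/
abbrev Letters (n : ℕ) : Type := Fin n ⊕ Fin n

/-- The fixed point free involution `τ = (1 n+1)(2 n+2) ⋯ (n 2n)`. -/
def tau (n : ℕ) : Equiv.Perm (Letters n) := Equiv.sumComm (Fin n) (Fin n)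

/-- `C^∼(τ)`, the permutations with `τ σ τ⁻¹ = σ⁻¹`. -/
def CTilde (n : ℕ) : Set (Equiv.Perm (Letters n)) :=
  {σ | tau n * σ * (tau n)⁻¹ = σ⁻¹}

/-- `B_n^∼`, the permutations in `C^∼(τ)` without self-symmetric cycles. (A cycle of length one
is never self-symmetric, since `τ` has no fixed point.) -/
def BTilde (n : ℕ) : Set (Equiv.Perm (Letters n)) :=
  {σ | σ ∈ CTilde n ∧ ∀ c ∈ σ.cycleFactorsFinset, tau n * c * (tau n)⁻¹ ≠ c⁻¹}

/-- `σ` has cycle type `2λ`: cycles of length one are recorded too, every part of `λ` is taken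
twice. -/
def HasDoubledCycleType {n : ℕ} (σ : Equiv.Perm (Letters n)) (lam : n.Partition) : Prop :=
  σ.partition.parts = lam.parts + lam.parts

/-- `B_λ^∼`, the permutations in `B_n^∼` with two cycles of length `λ_i` for every `i`. -/
def BTildeOf {n : ℕ} (lam : n.Partition) : Set (Equiv.Perm (Letters n)) :=
  {σ | σ ∈ BTilde n ∧ HasDoubledCycleType σ lam}

/-- The number `b = (2g - 2 + 2ℓ(μ) + 2ℓ(ν)) / 2` of branch points. (For `n > 0` both partitions
have a part, so `b ≥ 1` and nothing is truncated.) -/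
def numBranch (g : ℕ) {n : ℕ} (μ ν : n.Partition) : ℕ :=
  g + μ.parts.card + ν.parts.card - 1

/-- `(σ₁, η₁, …, η_b, σ₂)` is a twisted factorisation of type `(g, μ, ν)`. -/
structure IsFactorization (g : ℕ) {n : ℕ} (μ ν : n.Partition) (σ₁ : Equiv.Perm (Letters n))
    (η : Fin (numBranch g μ ν) → Equiv.Perm (Letters n)) (σ₂ : Equiv.Perm (Letters n)) :
    Prop where
  b_pos : 0 < numBranch g μ ν
  type_left : HasDoubledCycleType σ₁ μ
  type_right : HasDoubledCycleType σ₂ ν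
  isSwap : ∀ i, (η i).IsSwap
  ne_conj : ∀ i, η i ≠ tau n * η i * tau n
  mem_left : σ₁ ∈ BTildeOf μ
  /-- `η_b ⋯ η_1 σ₁ (τ η_1 τ) ⋯ (τ η_b τ) = σ₂` -/
  prod_eq : (List.ofFn η).reverse.prod * σ₁ * (List.ofFn fun i => tau n * η i * tau n).prod = σ₂
  transitive : MulAction.IsPretransitive
    (Subgroup.closure
      ({σ₁, σ₂} ∪ Set.range η ∪ Set.range fun i => tau n * η i * tau n)) (Letters n)

/-- `C_g(μ, ν)`. -/
def factorizations (g : ℕ) {n : ℕ} (μ ν : n.Partition) :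
    Set (Equiv.Perm (Letters n) × (Fin (numBranch g μ ν) → Equiv.Perm (Letters n)) ×
      Equiv.Perm (Letters n)) :=
  {t | IsFactorization g μ ν t.1 t.2.1 t.2.2}

/-- The twisted double Hurwitz number `h̃_g(μ, ν) = |C_g(μ, ν)| / (2n)!!`. -/
def twistedHurwitz (g : ℕ) {n : ℕ} (μ ν : n.Partition) : ℚ :=
  ((factorizations g μ ν).ncard : ℚ) / (Nat.doubleFactorial (2 * n) : ℚ)

/-! ### Weighted directed graphs with an involution -/

/-- A finite directed multigraph with ends, edge weights and two self-maps, one of the vertices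
and one of the edges. `V` is the set of inner vertices. The leaves are not listed:
an edge with `src e = none` comes in from a leaf (an inward end), an edge with `tgt e = none`
goes out to a leaf (an outward end). Parallel edges are allowed. -/
structure WGraph where
  V : Type
  E : Type
  [fintypeV : Fintype V]
  [fintypeE : Fintype E]
  src : E → Option V
  tgt : E → Option V
  weight : E → ℕ
  invV : V → V
  invE : E → E

attribute [instance] WGraph.fintypeV WGraph.fintypeE

namespace WGraph

/-- A bounded (internal) edge: it joins two inner vertices. -/
def IsInternal (Γ : WGraph) (e : Γ.E) : Prop := Γ.src e ≠ none ∧ Γ.tgt e ≠ none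

/-- The edge `e` is adjacent to the vertex `v`. -/
def Incident (Γ : WGraph) (e : Γ.E) (v : Γ.V) : Prop := Γ.src e = some v ∨ Γ.tgt e = some v

/-- There is an edge directed from `u` to `v`. -/
def Arrow (Γ : WGraph) (u v : Γ.V) : Prop := ∃ e, Γ.src e = some u ∧ Γ.tgt e = some v

open Classical in
def internalEdges (Γ : WGraph) : Finset Γ.E := Finset.univ.filter Γ.IsInternal

open Classical in
def inEdges (Γ : WGraph) (v : Γ.V) : Finset Γ.E := Finset.univ.filter fun e => Γ.tgt e = some v

open Classical in
def outEdges (Γ : WGraph) (v : Γ.V) : Finset Γ.E := Finset.univ.filter fun e => Γ.src e = some v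

/-- The valence of an inner vertex (a loop counts twice). -/
def valence (Γ : WGraph) (v : Γ.V) : ℕ := (Γ.inEdges v).card + (Γ.outEdges v).card

open Classical in
def inwardEnds (Γ : WGraph) : Finset Γ.E := Finset.univ.filter fun e => Γ.src e = none

open Classical in
def outwardEnds (Γ : WGraph) : Finset Γ.E := Finset.univ.filter fun e => Γ.tgt e = none

/-- `Γ` is a twisted monodromy graph of type `(g, μ, ν)`, without a fixed vertex ordering. -/
structure IsTwistedMonodromy (Γ : WGraph) (g : ℕ) {n : ℕ} (μ ν : n.Partition) : Prop where
  /-- `Γ` is connected: it has an inner vertex, any two inner vertices are joined by a path, and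
  no component is a single edge between two leaves. -/
  nonempty : Nonempty Γ.V
  connected : ∀ u v, Relation.EqvGen Γ.Arrow u v
  attached : ∀ e, Γ.src e ≠ none ∨ Γ.tgt e ≠ none
  /-- The first Betti number is `g` (an end and its leaf cancel in the Euler characteristic). -/
  genus : Γ.internalEdges.card + 1 = Fintype.card Γ.V + g
  valence_eq : ∀ v, Γ.valence v = 3 ∨ Γ.valence v = 4
  /-- The involution is an automorphism of the weighted directed graph of order two. -/
  invV_invV : ∀ v, Γ.invV (Γ.invV v) = v
  invE_invE : ∀ e, Γ.invE (Γ.invE e) = e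
  src_inv : ∀ e, Γ.src (Γ.invE e) = (Γ.src e).map Γ.invV
  tgt_inv : ∀ e, Γ.tgt (Γ.invE e) = (Γ.tgt e).map Γ.invV
  weight_inv : ∀ e, Γ.weight (Γ.invE e) = Γ.weight e
  /-- Its fixed points are exactly the 4-valent vertices; in particular it fixes no edge. -/
  invV_eq_iff : ∀ v, Γ.invV v = v ↔ Γ.valence v = 4
  invE_ne : ∀ e, Γ.invE e ≠ e
  /-- There are `2ℓ(μ)` inward ends, two of weight `μ_i` for every `i`, and likewise
  for the outward ends and `ν`. -/
  inward : Γ.inwardEnds.val.map Γ.weight = μ.parts + μ.parts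
  outward : Γ.outwardEnds.val.map Γ.weight = ν.parts + ν.parts
  /-- No inner vertex is a source or a sink. -/
  no_source : ∀ v, (Γ.inEdges v).Nonempty
  no_sink : ∀ v, (Γ.outEdges v).Nonempty
  /-- The edge directions induce a partial order: there is no directed cycle. -/
  acyclic : ∀ v, ¬ Relation.TransGen Γ.Arrow v v
  weight_pos : ∀ e, 0 < Γ.weight e
  balanced : ∀ v, ∑ e ∈ Γ.inEdges v, Γ.weight e = ∑ e ∈ Γ.outEdges v, Γ.weight e
  weight_four : ∀ v, Γ.valence v = 4 → ∀ e e', Γ.Incident e v → Γ.Incident e' v →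
    Γ.weight e = Γ.weight e'

/-- A vertex ordering compatible with the edge directions: the orbits of the involution on the
vertices (the 4-valent vertices, and the pairs of 3-valent vertices that are exchanged) are put in
a total order, by numbering them, such that every edge goes from a smaller to a larger number. -/
structure IsVertexOrder (Γ : WGraph) {b : ℕ} (pos : Γ.V → Fin b) : Prop where
  surjective : Function.Surjective pos
  eq_iff : ∀ u v, pos u = pos v ↔ v = u ∨ v = Γ.invV u
  lt_of_arrow : ∀ u v, Γ.Arrow u v → pos u < pos v

/-- The number `o(Γ)` of compatible vertex orderings, for `b` orbits of vertices. -/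
def numOrders (Γ : WGraph) (b : ℕ) : ℕ := {pos : Γ.V → Fin b | Γ.IsVertexOrder pos}.ncard

open Classical in
def incidentEdges (Γ : WGraph) (v : Γ.V) : Finset Γ.E :=
  Finset.univ.filter fun e => Γ.Incident e v

/-- The weight `ω_v` of the edges adjacent to `v`, for a vertex all of whose adjacent edges have
the same weight (written as their maximum). -/
def vertexWeight (Γ : WGraph) (v : Γ.V) : ℕ := (Γ.incidentEdges v).sup Γ.weight

open Classical in
def fourValent (Γ : WGraph) : Finset Γ.V := Finset.univ.filter fun v => Γ.valence v = 4

open Classical in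
/-- The pairs `{e, ι(e)}` of internal edges. -/
def internalPairs (Γ : WGraph) : Finset (Finset Γ.E) :=
  Γ.internalEdges.image fun e => {e, Γ.invE e}

/-- The product `2^b ∏_V (ω_V - 1) ∏_e ω(e)`, over the 4-valent vertices and over the pairs of
internal edges (both edges of a pair have the same weight, written as their maximum). -/
def weightProd (Γ : WGraph) (b : ℕ) : ℚ :=
  2 ^ b * (∏ v ∈ Γ.fourValent, ((Γ.vertexWeight v : ℚ) - 1)) *
    ∏ P ∈ Γ.internalPairs, ((P.sup Γ.weight : ℕ) : ℚ)

/-- Isomorphisms: they respect the incidence and direction of the edges, the weights and the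
involutions. -/
@[ext]
structure Iso (Γ Δ : WGraph) where
  onV : Γ.V ≃ Δ.V
  onE : Γ.E ≃ Δ.E
  src_map : ∀ e, Δ.src (onE e) = (Γ.src e).map onV
  tgt_map : ∀ e, Δ.tgt (onE e) = (Γ.tgt e).map onV
  weight_map : ∀ e, Δ.weight (onE e) = Γ.weight e
  invV_map : ∀ v, Δ.invV (onV v) = onV (Γ.invV v)
  invE_map : ∀ e, Δ.invE (onE e) = onE (Γ.invE e)

namespace Iso

variable {Γ Δ Θ : WGraph}

def refl (Γ : WGraph) : Iso Γ Γ where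
  onV := Equiv.refl _
  onE := Equiv.refl _
  src_map := by simp
  tgt_map := by simp
  weight_map := by simp
  invV_map := by simp
  invE_map := by simp

def symm (φ : Iso Γ Δ) : Iso Δ Γ where
  onV := φ.onV.symm
  onE := φ.onE.symm
  src_map e := by
    have h := φ.src_map (φ.onE.symm e)
    rw [Equiv.apply_symm_apply] at h
    rw [h]; simp
  tgt_map e := by
    have h := φ.tgt_map (φ.onE.symm e)
    rw [Equiv.apply_symm_apply] at h
    rw [h]; simp
  weight_map e := by
    have h := φ.weight_map (φ.onE.symm e)
    rw [Equiv.apply_symm_apply] at h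
    exact h.symm
  invV_map v := by
    have h := φ.invV_map (φ.onV.symm v)
    rw [Equiv.apply_symm_apply] at h
    rw [h]; simp
  invE_map e := by
    have h := φ.invE_map (φ.onE.symm e)
    rw [Equiv.apply_symm_apply] at h
    rw [h]; simp

def trans (φ : Iso Γ Δ) (ψ : Iso Δ Θ) : Iso Γ Θ where
  onV := φ.onV.trans ψ.onV
  onE := φ.onE.trans ψ.onE
  src_map e := by simp [ψ.src_map, φ.src_map, Function.comp_def]
  tgt_map e := by simp [ψ.tgt_map, φ.tgt_map, Function.comp_def]
  weight_map e := by simp [ψ.weight_map, φ.weight_map]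
  invV_map v := by simp [ψ.invV_map, φ.invV_map]
  invE_map e := by simp [ψ.invE_map, φ.invE_map]

theorem src_eq_some (φ : Iso Γ Δ) (e : Γ.E) (v : Γ.V) :
    Δ.src (φ.onE e) = some (φ.onV v) ↔ Γ.src e = some v := by
  rw [φ.src_map]; cases Γ.src e <;> simp

theorem tgt_eq_some (φ : Iso Γ Δ) (e : Γ.E) (v : Γ.V) :
    Δ.tgt (φ.onE e) = some (φ.onV v) ↔ Γ.tgt e = some v := by
  rw [φ.tgt_map]; cases Γ.tgt e <;> simp

theorem isInternal (φ : Iso Γ Δ) (e : Γ.E) : Δ.IsInternal (φ.onE e) ↔ Γ.IsInternal e := by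
  simp [IsInternal, φ.src_map, φ.tgt_map]

theorem valence_eq (φ : Iso Γ Δ) (v : Γ.V) : Δ.valence (φ.onV v) = Γ.valence v := by
  classical
  unfold valence
  congr 1
  · refine (Finset.card_equiv φ.onE fun e => ?_).symm
    simp [inEdges, φ.tgt_eq_some]
  · refine (Finset.card_equiv φ.onE fun e => ?_).symm
    simp [outEdges, φ.src_eq_some]

theorem vertexWeight_eq (φ : Iso Γ Δ) (v : Γ.V) :
    Δ.vertexWeight (φ.onV v) = Γ.vertexWeight v := by
  classical
  have h : Δ.incidentEdges (φ.onV v) = (Γ.incidentEdges v).map φ.onE.toEmbedding := by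
    ext e
    obtain ⟨e, rfl⟩ := φ.onE.surjective e
    simp only [incidentEdges, Finset.mem_filter, Finset.mem_univ, true_and, Finset.mem_map_equiv,
      Equiv.symm_apply_apply]
    simp [Incident, φ.src_eq_some, φ.tgt_eq_some]
  unfold vertexWeight
  rw [h, Finset.sup_map]
  exact Finset.sup_congr rfl fun e _ => φ.weight_map e

theorem weightProd_eq (φ : Iso Γ Δ) (b : ℕ) : Δ.weightProd b = Γ.weightProd b := by
  classical
  unfold weightProd
  congr 1
  · congr 1
    refine (Finset.prod_equiv φ.onV (fun v => ?_) fun v _ => ?_).symm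
    · simp [fourValent, φ.valence_eq]
    · rw [φ.vertexWeight_eq]
  · refine (Finset.prod_equiv (Equiv.finsetCongr φ.onE) (fun P => ?_) fun P _ => ?_).symm
    · simp only [internalPairs, Finset.mem_image, internalEdges, Finset.mem_filter,
        Finset.mem_univ, true_and, Equiv.finsetCongr_apply]
      constructor
      · rintro ⟨e, he, rfl⟩
        exact ⟨φ.onE e, (φ.isInternal e).2 he, by simp [φ.invE_map, Finset.map_insert]⟩
      · rintro ⟨e, he, h⟩
        obtain ⟨e, rfl⟩ := φ.onE.surjective e
        refine ⟨e, (φ.isInternal e).1 he, ?_⟩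
        apply Finset.map_injective φ.onE.toEmbedding
        rw [← h]
        simp [φ.invE_map, Finset.map_insert]
    · simp only [Equiv.finsetCongr_apply, Finset.sup_map]
      congr 1
      exact Finset.sup_congr rfl fun e _ => (φ.weight_map e).symm

theorem arrow_iff (φ : Iso Γ Δ) (u v : Γ.V) : Δ.Arrow (φ.onV u) (φ.onV v) ↔ Γ.Arrow u v := by
  constructor
  · rintro ⟨e, h₁, h₂⟩
    obtain ⟨e, rfl⟩ := φ.onE.surjective e
    exact ⟨e, (φ.src_eq_some e u).1 h₁, (φ.tgt_eq_some e v).1 h₂⟩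
  · rintro ⟨e, h₁, h₂⟩
    exact ⟨φ.onE e, (φ.src_eq_some e u).2 h₁, (φ.tgt_eq_some e v).2 h₂⟩

theorem isVertexOrder_comp (φ : Iso Γ Δ) {b : ℕ} {pos : Δ.V → Fin b}
    (h : Δ.IsVertexOrder pos) : Γ.IsVertexOrder (pos ∘ φ.onV) where
  surjective := h.surjective.comp φ.onV.surjective
  eq_iff u v := by simp [h.eq_iff, φ.invV_map]
  lt_of_arrow u v huv := h.lt_of_arrow _ _ ((φ.arrow_iff u v).2 huv)

theorem numOrders_le (φ : Iso Γ Δ) (b : ℕ) : Δ.numOrders b ≤ Γ.numOrders b := by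
  refine Set.ncard_le_ncard_of_injOn (fun pos => pos ∘ φ.onV)
    (fun pos h => φ.isVertexOrder_comp h) (fun p _ q _ h => ?_) (Set.toFinite _)
  exact φ.onV.surjective.injective_comp_right h

theorem numOrders_eq (φ : Iso Γ Δ) (b : ℕ) : Δ.numOrders b = Γ.numOrders b :=
  le_antisymm (φ.numOrders_le b) (φ.symm.numOrders_le b)

theorem symm_trans_self_onV (φ : Iso Γ Δ) (v : Δ.V) : φ.onV (φ.symm.onV v) = v :=
  φ.onV.apply_symm_apply v

end Iso

/-- Conjugation by an isomorphism identifies the automorphisms. -/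
def autEquiv {Γ Δ : WGraph} (φ : Iso Γ Δ) : Iso Γ Γ ≃ Iso Δ Δ where
  toFun ψ := φ.symm.trans (ψ.trans φ)
  invFun ψ := φ.trans (ψ.trans φ.symm)
  left_inv ψ := by ext x <;> simp [Iso.trans, Iso.symm]
  right_inv ψ := by ext x <;> simp [Iso.trans, Iso.symm]

end WGraph

/-! ### Twisted monodromy graphs and their isomorphism classes -/

/-- Twisted monodromy graphs of type `(g, μ, ν)` without a fixed vertex ordering. -/
def UnorderedGraph (g : ℕ) {n : ℕ} (μ ν : n.Partition) : Type 1 :=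
  {Γ : WGraph // Γ.IsTwistedMonodromy g μ ν}

/-- Twisted monodromy graphs of type `(g, μ, ν)`; a compatible vertex ordering is part of the
data. -/
structure MonodromyGraph (g : ℕ) {n : ℕ} (μ ν : n.Partition) : Type 1 where
  graph : WGraph
  isTwisted : graph.IsTwistedMonodromy g μ ν
  pos : graph.V → Fin (numBranch g μ ν)
  isOrder : graph.IsVertexOrder pos

variable {g n : ℕ} {μ ν : n.Partition}

/-- Isomorphisms of twisted monodromy graphs also respect the vertex ordering. -/
def MonodromyGraph.Iso (Γ Δ : MonodromyGraph g μ ν) : Type :=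
  {φ : WGraph.Iso Γ.graph Δ.graph // ∀ v, Δ.pos (φ.onV v) = Γ.pos v}

instance unorderedSetoid (g : ℕ) {n : ℕ} (μ ν : n.Partition) :
    Setoid (UnorderedGraph g μ ν) where
  r Γ Δ := Nonempty (WGraph.Iso Γ.1 Δ.1)
  iseqv := ⟨fun Γ => ⟨WGraph.Iso.refl Γ.1⟩, fun ⟨φ⟩ => ⟨φ.symm⟩, fun ⟨φ⟩ ⟨ψ⟩ => ⟨φ.trans ψ⟩⟩

def MonodromyGraph.Iso.symm {Γ Δ : MonodromyGraph g μ ν} (φ : Γ.Iso Δ) : Δ.Iso Γ :=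
  ⟨φ.1.symm, fun v => by
    have h := φ.2 (φ.1.symm.onV v)
    rw [φ.1.symm_trans_self_onV] at h
    exact h.symm⟩

def MonodromyGraph.Iso.trans {Γ Δ Θ : MonodromyGraph g μ ν} (φ : Γ.Iso Δ) (ψ : Δ.Iso Θ) :
    Γ.Iso Θ :=
  ⟨φ.1.trans ψ.1, fun v => (ψ.2 _).trans (φ.2 v)⟩

instance monodromySetoid (g : ℕ) {n : ℕ} (μ ν : n.Partition) :
    Setoid (MonodromyGraph g μ ν) where
  r Γ Δ := Nonempty (Γ.Iso Δ)
  iseqv := ⟨fun Γ => ⟨⟨WGraph.Iso.refl Γ.graph, fun _ => rfl⟩⟩,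
    fun ⟨φ⟩ => ⟨φ.symm⟩, fun ⟨φ⟩ ⟨ψ⟩ => ⟨φ.trans ψ⟩⟩

/-- Isomorphism classes of twisted monodromy graphs without a fixed vertex ordering. -/
abbrev UnorderedClass (g : ℕ) {n : ℕ} (μ ν : n.Partition) : Type 1 :=
  Quotient (unorderedSetoid g μ ν)

/-- Isomorphism classes of twisted monodromy graphs. -/
abbrev MonodromyClass (g : ℕ) {n : ℕ} (μ ν : n.Partition) : Type 1 :=
  Quotient (monodromySetoid g μ ν)

/-- `2^b ∏_V (ω_V - 1) ∏_e ω(e) / |Aut|`, with the automorphisms that respect the involution and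
the vertex ordering. -/
def MonodromyGraph.mult (Γ : MonodromyGraph g μ ν) : ℚ :=
  Γ.graph.weightProd (numBranch g μ ν) * (1 / (Nat.card (Γ.Iso Γ) : ℚ))

/-- `o(Γ) 2^b ∏_V (ω_V - 1) ∏_e ω(e) / |Aut(Γ)|`, with the automorphisms of the graph (without a
vertex ordering) that respect the involution. -/
def UnorderedGraph.mult (Γ : UnorderedGraph g μ ν) : ℚ :=
  (Γ.1.numOrders (numBranch g μ ν) : ℚ) * Γ.1.weightProd (numBranch g μ ν) *
    (1 / (Nat.card (WGraph.Iso Γ.1 Γ.1) : ℚ))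

theorem MonodromyGraph.mult_eq {Γ Δ : MonodromyGraph g μ ν} (φ : Γ.Iso Δ) :
    Γ.mult = Δ.mult := by
  have h : Nat.card (Γ.Iso Γ) = Nat.card (Δ.Iso Δ) := by
    refine Nat.card_congr
      { toFun := fun ψ => φ.symm.trans (ψ.trans φ)
        invFun := fun ψ => φ.trans (ψ.trans φ.symm)
        left_inv := fun ψ => Subtype.ext ((WGraph.autEquiv φ.1).left_inv ψ.1)
        right_inv := fun ψ => Subtype.ext ((WGraph.autEquiv φ.1).right_inv ψ.1) }
  unfold MonodromyGraph.mult
  rw [h, φ.1.weightProd_eq]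

theorem UnorderedGraph.mult_eq {Γ Δ : UnorderedGraph g μ ν} (φ : WGraph.Iso Γ.1 Δ.1) :
    Γ.mult = Δ.mult := by
  unfold UnorderedGraph.mult
  rw [Nat.card_congr (WGraph.autEquiv φ), φ.weightProd_eq, φ.numOrders_eq]

/-- The multiplicity of an isomorphism class of twisted monodromy graphs. -/
def MonodromyClass.mult : MonodromyClass g μ ν → ℚ :=
  Quotient.lift MonodromyGraph.mult fun _ _ ⟨φ⟩ => MonodromyGraph.mult_eq φ

/-- The multiplicity, including the factor `o(Γ)`, of an isomorphism class of twisted monodromy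
graphs without a fixed vertex ordering. -/
def UnorderedClass.mult : UnorderedClass g μ ν → ℚ :=
  Quotient.lift UnorderedGraph.mult fun _ _ ⟨φ⟩ => UnorderedGraph.mult_eq φ

end TwistedHurwitz

end

/-!
A factorisation is a sequence `σ 0, …, σ b` of permutations without self-symmetric cycles in which
`σ (k + 1) = twist a b (σ k)` arises from `σ k` by multiplying with a transposition `η = (a b)`
from the left and with its mirror image `τ η τ` from the right. The theorem holds because the
graphs record how the cycles of `σ k` evolve: edges are cycles, for as long as they are not
affected by a step, weights are lengths, vertices are the places where cycles meet, and the
involution is induced by `τ`.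

*Single steps.* A permutation is called `IsSym` if `τ σ τ = σ⁻¹` and no cycle is self-symmetric;
the latter amounts to `σ (τ x) ≠ x` for all `x`, and is preserved by `twist`. If `b` lies on the
cycle of `a`, the step cuts this cycle and its mirror image; if `b` lies on neither of the two, it
joins the cycles of `a` and `b`, and likewise their mirror images. In both cases it is a pair of
3-valent vertices. If `b` lies on the mirror image of the cycle of `a`, the step replaces the two
cycles by two others of the same length, which is a 4-valent vertex (`sameCycle_twist_*`,
`card_cyc_twist_*`).

*Labellings.* A state of a graph at level `k` is a permutation whose cycles are labelled
equivariantly by the edges that cross this level (`WGraph.IsState`), and a factorisation is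
labelled by the graph if its steps match the vertices (`WGraph.IsStepAt`, `WGraph.IsChain`). Every
factorisation is labelled by some graph, the one made from its own cycles (`Trace.traceGraph`,
`exists_labelling_of_mem_factorizations`), and this graph is unique up to unique isomorphism
compatible with the labels (`WGraph.IsLabelling.exists_iso`, `WGraph.IsLabelling.iso_unique`).
Hence the set of factorisations is the disjoint union, over the isomorphism classes of graphs `Γ`,
of those that `Γ` can label, and each of these has exactly `|Aut(Γ)|` labellings
(`MonodromyGraph.card_labellings`). Conversely, every sequence of labelled states and steps is a
factorisation (`MonodromyGraph.mem_factorizations_of_isChain`): connectedness of the graph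
translates into transitivity of the group, and the genus is an Euler characteristic.

*The count.* It remains to see that `Γ` has `(2n)!!` times its weight as number of labelled
factorisations (`MonodromyGraph.card_chain`). The number of initial states is `(2n)!!` divided by
the product of the `μ_i` (`card_isCycleLabelling`): a labelled permutation together with a base
point on one cycle of each mirror pair is an equivariant bijection between the letters and a
standard model. From any state, the number of steps at the next vertex is `2 ω_V (ω_V - 1)` at a
4-valent one, and at a pair of 3-valent ones twice the product of the incoming weights at one of
the two (`WGraph.card_isStep`). In the product over all levels, each pair of edges with a target
contributes its weight once, and the incoming ends cancel the `μ_i`. Pairs `{e, ι(e)}` are seen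
twice in any product over edges, so the comparison is made between squares, which avoids choosing
representatives.

*Finiteness.* Graphs with different classes label disjoint sets of factorisations, but this set is
empty if some `ω_V` is one. Doubling all weights (and `μ`, `ν`, `n`) keeps classes apart and makes
all these sets nonempty (`finite_monodromyClass`).

*Graphs without ordering.* The automorphisms of such a graph act on its compatible orderings. The
orbits are the classes of ordered graphs over it, the stabilisers their automorphism groups
(`card_order_mul`), so that the summands of the first formula add up to those of the second
(`sum_mult_fiber`). Every graph has an ordering, a linear extension of the partial order on the
orbits of vertices (`exists_isVertexOrder`), so finiteness is inherited as well.
-/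

noncomputable section

namespace TwistedHurwitz

open Equiv Equiv.Perm

/-! ### Cycles of permutations -/

section

section Cycles
variable {X : Type*} [Fintype X]

open Classical in
/-- The cycle of `x` under `σ`, as a set of points (a singleton for a fixed point). -/
noncomputable def cyc (σ : Perm X) (x : X) : Finset X := Finset.univ.filter fun y => σ.SameCycle x y

theorem mem_cyc {σ : Perm X} {x y : X} : y ∈ cyc σ x ↔ σ.SameCycle x y := by
  simp [cyc]

theorem self_mem_cyc (σ : Perm X) (x : X) : x ∈ cyc σ x := mem_cyc.2 (SameCycle.refl _ _)

theorem cyc_eq_iff {σ : Perm X} {x y : X} : cyc σ x = cyc σ y ↔ σ.SameCycle x y := by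
  constructor
  · intro h
    exact mem_cyc.1 (h ▸ self_mem_cyc σ y)
  · intro h
    ext z
    rw [mem_cyc, mem_cyc]
    exact ⟨fun h' => h.symm.trans h', fun h' => h.trans h'⟩

theorem card_cyc_pos (σ : Perm X) (x : X) : 0 < (cyc σ x).card :=
  Finset.card_pos.2 ⟨x, self_mem_cyc σ x⟩

theorem card_cyc (σ : Perm X) (x : X) : (cyc σ x).card = Function.minimalPeriod σ x := by
  classical
  have hp : 0 < Function.minimalPeriod σ x :=
    Function.minimalPeriod_pos_of_mem_periodicPts (σ.injective.mem_periodicPts x)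
  have h : cyc σ x = (Finset.range (Function.minimalPeriod σ x)).image fun j => (σ ^ j) x := by
    ext y
    simp only [mem_cyc, Finset.mem_image, Finset.mem_range]
    constructor
    · intro h
      obtain ⟨j, rfl⟩ := h.exists_nat_pow_eq
      refine ⟨j % Function.minimalPeriod σ x, Nat.mod_lt _ hp, ?_⟩
      rw [← iterate_eq_pow, ← iterate_eq_pow, Function.iterate_mod_minimalPeriod_eq]
    · rintro ⟨j, _, rfl⟩
      exact sameCycle_pow_right.2 (SameCycle.refl _ _)
  rw [h, Finset.card_image_of_injOn, Finset.card_range]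
  intro i hi j hj hij
  simp only [← iterate_eq_pow] at hij
  exact Function.iterate_injOn_Iio_minimalPeriod (by simpa using hi) (by simpa using hj) hij

theorem pow_card_cyc_apply (σ : Perm X) (x : X) : (σ ^ (cyc σ x).card) x = x := by
  rw [card_cyc, ← iterate_eq_pow]
  exact Function.iterate_minimalPeriod

theorem pow_apply_ne_self {σ : Perm X} {x : X} {j : ℕ} (h0 : 0 < j) (h : j < (cyc σ x).card) :
    (σ ^ j) x ≠ x := by
  intro hj
  rw [card_cyc] at h
  rw [← iterate_eq_pow] at hj
  exact absurd (Function.IsPeriodicPt.minimalPeriod_le h0 hj) (by omega)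

theorem exists_pow_of_sameCycle {σ : Perm X} {x y : X} (h : σ.SameCycle x y) :
    ∃ j < (cyc σ x).card, (σ ^ j) x = y := by
  obtain ⟨j, rfl⟩ := h.exists_nat_pow_eq
  refine ⟨j % (cyc σ x).card, Nat.mod_lt _ (card_cyc_pos σ x), ?_⟩
  rw [card_cyc, ← iterate_eq_pow, ← iterate_eq_pow, Function.iterate_mod_minimalPeriod_eq]

theorem pow_apply_injOn {σ : Perm X} {x : X} {i j : ℕ} (hi : i < (cyc σ x).card)
    (hj : j < (cyc σ x).card) (h : (σ ^ i) x = (σ ^ j) x) : i = j := by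
  rw [card_cyc] at hi hj
  simp only [← iterate_eq_pow] at h
  exact Function.iterate_injOn_Iio_minimalPeriod hi hj h

theorem card_cyc_eq_of_pow {σ : Perm X} {x : X} {k : ℕ} (hk : 0 < k) (h : (σ ^ k) x = x)
    (h' : ∀ j, 0 < j → j < k → (σ ^ j) x ≠ x) : (cyc σ x).card = k := by
  have h1 : (cyc σ x).card ≤ k := by
    rw [card_cyc]
    exact Function.IsPeriodicPt.minimalPeriod_le hk (by rw [← iterate_eq_pow] at h; exact h)
  rcases h1.lt_or_eq with h2 | h2
  · exact absurd (pow_card_cyc_apply σ x) (h' _ (card_cyc_pos σ x) h2)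
  · exact h2

theorem pow_apply_eq_of_agree {Y : Type*} {σ σ' : Perm Y} {x : Y}
    (h : ∀ z, σ.SameCycle x z → σ' z = σ z) (j : ℕ) : (σ' ^ j) x = (σ ^ j) x := by
  induction j with
  | zero => rfl
  | succ j ih =>
    rw [pow_succ', pow_succ', mul_apply, mul_apply, ih]
    exact h _ (sameCycle_pow_right.2 (SameCycle.refl _ _))

theorem sameCycle_iff_of_agree {σ σ' : Perm X} {x : X}
    (h : ∀ z, σ.SameCycle x z → σ' z = σ z) (y : X) : σ'.SameCycle x y ↔ σ.SameCycle x y := by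
  constructor
  · intro hy
    obtain ⟨j, rfl⟩ := hy.exists_nat_pow_eq
    rw [pow_apply_eq_of_agree h]
    exact sameCycle_pow_right.2 (SameCycle.refl _ _)
  · intro hy
    obtain ⟨j, rfl⟩ := hy.exists_nat_pow_eq
    rw [← pow_apply_eq_of_agree h]
    exact sameCycle_pow_right.2 (SameCycle.refl _ _)

theorem sameCycle_mem_of_invariant {σ : Perm X} {p : X → Prop} (h : ∀ x, p x → p (σ x)) {x y : X}
    (hx : p x) (hxy : σ.SameCycle x y) : p y := by
  obtain ⟨j, rfl⟩ := hxy.exists_nat_pow_eq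
  clear hxy
  induction j with
  | zero => exact hx
  | succ j ih => rw [pow_succ', mul_apply]; exact h _ ih

end Cycles

/-! ### Symmetric permutations without self-symmetric cycles -/

variable {n : ℕ}

@[simp] theorem tau_tau (x : Letters n) : tau n (tau n x) = x := by cases x <;> rfl

theorem tau_ne (x : Letters n) : tau n x ≠ x := by cases x <;> simp [tau]

theorem tau_mul_tau : tau n * tau n = 1 := by ext x; simp

theorem tau_inv : (tau n)⁻¹ = tau n := inv_eq_of_mul_eq_one_left tau_mul_tau

/-- `σ` is inverted by conjugation with `τ`, and no point lies in the cycle of its mirror image: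
this is membership in `BTilde n`, expressed by points. -/
structure IsSym (σ : Perm (Letters n)) : Prop where
  tau_apply : ∀ x, tau n (σ x) = σ⁻¹ (tau n x)
  not_sameCycle : ∀ x, ¬ σ.SameCycle x (tau n x)

theorem tau_apply_iff_conj {σ : Perm (Letters n)} :
    (∀ x, tau n (σ x) = σ⁻¹ (tau n x)) ↔ tau n * σ * (tau n)⁻¹ = σ⁻¹ := by
  constructor
  · intro h
    ext x : 1
    rw [mul_apply, mul_apply, h, tau_inv, tau_tau]
  · intro h x
    rw [← h]; simp

/-- The composition `σ τ` is an involution, and the absence of self-symmetric cycles means that it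
has no fixed point. -/
theorem isSym_iff_fixedPointFree {σ : Perm (Letters n)} :
    IsSym σ ↔ (∀ x, tau n (σ x) = σ⁻¹ (tau n x)) ∧ ∀ x, σ (tau n x) ≠ x := by
  constructor
  · intro h
    refine ⟨h.tau_apply, fun x hx => h.not_sameCycle x ?_⟩
    have : σ.SameCycle (σ (tau n x)) (tau n x) := sameCycle_apply_left.2 (SameCycle.refl _ _)
    rwa [hx] at this
  · rintro ⟨h1, h2⟩
    refine ⟨h1, fun x hx => ?_⟩
    have key : ∀ l : ℕ, tau n ((σ ^ l) x) = (σ ^ l)⁻¹ (tau n x) := by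
      intro l
      induction l with
      | zero => rfl
      | succ l ih =>
        rw [pow_succ', mul_apply, h1, ih, mul_inv_rev, ← mul_apply]
        congr 1
        rw [← inv_pow, ← pow_succ', ← pow_succ]
    obtain ⟨m, hm⟩ := hx.exists_nat_pow_eq
    -- Halving the distance from `x` to `τ x` gives a fixed point of `τ` or of `σ τ`.
    rcases Nat.even_or_odd' m with ⟨l, rfl | rfl⟩
    · apply tau_ne ((σ ^ l) x)
      rw [key, ← hm, two_mul, pow_add, mul_apply]
      simp
    · apply h2 (σ ((σ ^ l) x))
      have h3 : tau n ((σ ^ l) x) = σ ((σ ^ l) x) := by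
        rw [key, ← hm, Perm.inv_eq_iff_eq, ← mul_apply σ, ← pow_succ', ← mul_apply, ← pow_add]
        congr 2
        omega
      rw [← h3, tau_tau, h3]

theorem mem_BTilde_iff {σ : Perm (Letters n)} : σ ∈ BTilde n ↔ IsSym σ := by
  constructor
  · rintro ⟨h1, h2⟩
    have h1' : tau n * σ * (tau n)⁻¹ = σ⁻¹ := h1
    refine ⟨tau_apply_iff_conj.2 h1', fun x hx => ?_⟩
    have hfix : σ x ≠ x := fun h => tau_ne x (hx.eq_of_left h).symm
    refine h2 (σ.cycleOf x) (cycleOf_mem_cycleFactorsFinset_iff.2 (mem_support.2 hfix)) ?_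
    rw [cycleOf_inv, hx.cycleOf_eq]
    ext y : 1
    rw [mul_apply, mul_apply, tau_inv]
    by_cases hy : σ.SameCycle (tau n x) (tau n y)
    · have hy' : σ⁻¹.SameCycle x y := by
        have h3 := hy.conj (g := tau n)
        rwa [h1', tau_tau, tau_tau] at h3
      rw [hy.cycleOf_apply, hy'.cycleOf_apply, tau_apply_iff_conj.2 h1', tau_tau]
    · have hy' : ¬ σ⁻¹.SameCycle x y := by
        intro h3
        apply hy
        have h4 := (sameCycle_inv.1 h3).conj (g := tau n)
        rw [h1'] at h4
        exact sameCycle_inv.1 h4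
      rw [cycleOf_apply_of_not_sameCycle hy, cycleOf_apply_of_not_sameCycle hy', tau_tau]
  · intro h
    refine ⟨tau_apply_iff_conj.1 h.tau_apply, fun c hc hcc => ?_⟩
    obtain ⟨hcyc, _⟩ := mem_cycleFactorsFinset_iff.1 hc
    obtain ⟨x, hx⟩ := hcyc.nonempty_support
    have hx' : tau n x ∈ c.support := by
      rw [← support_inv c, ← hcc, mem_support, mul_apply, mul_apply, tau_inv, tau_tau]
      exact fun h => mem_support.1 hx ((tau n).injective h)
    have h1 := cycle_is_cycleOf hx hc
    rw [h1] at hx'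
    exact h.not_sameCycle x (mem_support_cycleOf_iff.1 hx').1

namespace IsSym

variable {σ : Perm (Letters n)}

theorem sameCycle_tau (h : IsSym σ) {x y : Letters n} :
    σ.SameCycle (tau n x) (tau n y) ↔ σ.SameCycle x y := by
  have key : ∀ {x y : Letters n}, σ.SameCycle x y → σ.SameCycle (tau n x) (tau n y) := by
    intro x y hxy
    have h3 := hxy.conj (g := tau n)
    rw [tau_apply_iff_conj.1 h.tau_apply] at h3
    exact sameCycle_inv.1 h3
  refine ⟨fun hxy => ?_, key⟩
  simpa using key hxy

theorem sameCycle_tau_left (h : IsSym σ) {x y : Letters n} :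
    σ.SameCycle (tau n x) y ↔ σ.SameCycle x (tau n y) := by
  rw [← h.sameCycle_tau, tau_tau]

theorem not_sameCycle' (h : IsSym σ) (x : Letters n) : ¬ σ.SameCycle (tau n x) x :=
  fun hx => h.not_sameCycle x hx.symm

theorem cyc_tau (h : IsSym σ) (x : Letters n) :
    cyc σ (tau n x) = (cyc σ x).map (tau n).toEmbedding := by
  ext y
  rw [mem_cyc, Finset.mem_map_equiv, mem_cyc, h.sameCycle_tau_left]
  rfl

theorem card_cyc_tau (h : IsSym σ) (x : Letters n) :
    (cyc σ (tau n x)).card = (cyc σ x).card := by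
  rw [h.cyc_tau, Finset.card_map]

end IsSym

/-! ### Cut, join and crossing -/

/-- One step `σ ↦ η σ (τ η τ)` of a twisted factorisation, for the transposition `η = (a b)`. -/
def twist (a b : Letters n) (σ : Perm (Letters n)) : Perm (Letters n) :=
  swap a b * σ * swap (tau n a) (tau n b)

theorem tau_swap_tau (a b : Letters n) :
    tau n * swap a b * tau n = swap (tau n a) (tau n b) := by
  have h := mul_swap_eq_swap_mul (tau n) a b
  rw [h, mul_assoc, tau_mul_tau, mul_one]

theorem twist_comm (a b : Letters n) (σ : Perm (Letters n)) : twist a b σ = twist b a σ := by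
  rw [twist, twist, swap_comm a b, swap_comm (tau n a)]

theorem twist_twist (a b : Letters n) (σ : Perm (Letters n)) :
    twist a b (twist a b σ) = σ := by
  simp only [twist, mul_assoc, swap_mul_self, mul_one]
  rw [← mul_assoc, swap_mul_self, one_mul]

theorem twist_apply (a b : Letters n) (σ : Perm (Letters n)) (x : Letters n) :
    twist a b σ x = swap a b (σ (swap (tau n a) (tau n b) x)) := rfl

theorem IsSym.twist {σ : Perm (Letters n)} (h : IsSym σ) (a b : Letters n) :
    IsSym (twist a b σ) := by
  rw [isSym_iff_fixedPointFree] at h ⊢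
  have hs : ∀ x, swap (tau n a) (tau n b) (tau n x) = tau n (swap a b x) := by
    intro x
    rw [← tau_swap_tau]; simp
  have hs' : ∀ x, tau n (swap (tau n a) (tau n b) x) = swap a b (tau n x) := by
    intro x
    rw [← tau_swap_tau]; simp
  refine ⟨fun x => ?_, fun x hx => h.2 (swap a b x) ?_⟩
  · rw [Perm.eq_inv_iff_eq, twist_apply, twist_apply, hs, swap_apply_self, h.1, hs']
    simp
  · rwa [twist_apply, hs, swap_apply_eq_iff] at hx

/-- `x` lies on one of the cycles of `σ` that a step with the transposition `(a b)` affects. -/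
def Touched (σ : Perm (Letters n)) (a b x : Letters n) : Prop :=
  σ.SameCycle x a ∨ σ.SameCycle x b ∨ σ.SameCycle x (tau n a) ∨ σ.SameCycle x (tau n b)

theorem Touched.of_sameCycle {σ : Perm (Letters n)} {a b x y : Letters n}
    (h : Touched σ a b x) (hxy : σ.SameCycle y x) : Touched σ a b y :=
  h.imp hxy.trans (Or.imp hxy.trans (Or.imp hxy.trans hxy.trans))

theorem touched_comm {σ : Perm (Letters n)} {a b x : Letters n} :
    Touched σ a b x ↔ Touched σ b a x := by
  unfold Touched; tauto

theorem IsSym.touched_tau {σ : Perm (Letters n)} (h : IsSym σ) {a b x : Letters n} :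
    Touched σ a b (tau n x) ↔ Touched σ a b x := by
  unfold Touched
  rw [h.sameCycle_tau_left, h.sameCycle_tau_left, h.sameCycle_tau, h.sameCycle_tau]
  tauto

theorem apply_eq_of_not_touched_twist {σ : Perm (Letters n)} {a b x : Letters n}
    (hx : ¬ Touched (twist a b σ) a b x) (z : Letters n) (hz : (twist a b σ).SameCycle x z) :
    σ z = twist a b σ z := by
  have hz' : ¬ Touched (twist a b σ) a b z := fun h => hx (h.of_sameCycle hz)
  have hz'' : ¬ Touched (twist a b σ) a b (twist a b σ z) := fun h => hx
    (h.of_sameCycle (sameCycle_apply_right.2 hz))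
  have ne : ∀ {w c}, ¬ Touched (twist a b σ) a b w → c = a ∨ c = b ∨ c = tau n a ∨ c = tau n b →
      w ≠ c := by
    rintro w c hw hc rfl
    exact hw (hc.imp (·.sameCycle _)
      (Or.imp (·.sameCycle _) (Or.imp (·.sameCycle _) (·.sameCycle _))))
  have e1 : swap (tau n a) (tau n b) z = z :=
    swap_apply_of_ne_of_ne (ne hz' (by simp)) (ne hz' (by simp))
  have e2 : swap a b (twist a b σ z) = twist a b σ z :=
    swap_apply_of_ne_of_ne (ne hz'' (by simp)) (ne hz'' (by simp))
  rw [← e2, twist_apply, e1]; simp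

theorem sameCycle_twist_of_not_touched' {σ : Perm (Letters n)} {a b x y : Letters n}
    (hx : ¬ Touched (twist a b σ) a b x) :
    (twist a b σ).SameCycle x y ↔ σ.SameCycle x y :=
  (sameCycle_iff_of_agree (apply_eq_of_not_touched_twist hx) y).symm

theorem touched_twist {σ : Perm (Letters n)} {a b x : Letters n} :
    Touched (twist a b σ) a b x ↔ Touched σ a b x := by
  have key : ∀ σ : Perm (Letters n), Touched σ a b x → Touched (twist a b σ) a b x := by
    intro σ h
    by_contra h'
    apply h'
    unfold Touched at h ⊢
    simpa only [sameCycle_twist_of_not_touched' h'] using h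
  refine ⟨fun h => ?_, key σ⟩
  have := key _ h
  rwa [twist_twist] at this

theorem sameCycle_twist_of_not_touched {σ : Perm (Letters n)} {a b x y : Letters n}
    (hx : ¬ Touched σ a b x) : (twist a b σ).SameCycle x y ↔ σ.SameCycle x y :=
  sameCycle_twist_of_not_touched' (mt touched_twist.1 hx)

section Trichotomy

variable {σ : Perm (Letters n)} {a b : Letters n}

/-- Away from the mirror images of `a` and `b`, a step multiplies by `(a b)` on the left. -/
theorem twist_apply_of_ne {x : Letters n} (h1 : x ≠ tau n a) (h2 : x ≠ tau n b) :
    twist a b σ x = swap a b (σ x) := by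
  rw [twist_apply, swap_apply_of_ne_of_ne h1 h2]

theorem twist_mem_of_invariant {p : Letters n → Prop} (hp : ∀ x, p x → p (σ x)) (ha : p a)
    (hb : p b) (ha' : ¬ p (tau n a)) (hb' : ¬ p (tau n b)) (x : Letters n) (hx : p x) :
    p (twist a b σ x) := by
  rw [twist_apply_of_ne (fun h => ha' (h ▸ hx)) (fun h => hb' (h ▸ hx)), swap_apply_def]
  split_ifs
  · exact hb
  · exact ha
  · exact hp x hx

/-- Up to its first passage through `b`, the cycle of `a` is unaffected by the step. -/
theorem twist_pow_apply (h : IsSym σ) {k : ℕ} (hab : ¬ σ.SameCycle a (tau n b))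
    (hk : ∀ j, 0 < j → j < k → (σ ^ j) a ≠ a ∧ (σ ^ j) a ≠ b) :
    ∀ j < k, ((twist a b σ) ^ j) a = (σ ^ j) a := by
  intro j hj
  induction j with
  | zero => rfl
  | succ j ih =>
    rw [pow_succ', mul_apply, ih (by omega), twist_apply_of_ne, ← mul_apply σ, ← pow_succ',
      swap_apply_of_ne_of_ne (hk _ (by omega) hj).1 (hk _ (by omega) hj).2]
    · intro h'
      exact h.not_sameCycle a ⟨j, by simpa using h'⟩
    · intro h'
      exact hab ⟨j, by simpa using h'⟩

theorem twist_pow_succ_apply (h : IsSym σ) {k : ℕ} (hab : ¬ σ.SameCycle a (tau n b))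
    (hk : ∀ j, 0 < j → j < k + 1 → (σ ^ j) a ≠ a ∧ (σ ^ j) a ≠ b) :
    ((twist a b σ) ^ (k + 1)) a = swap a b ((σ ^ (k + 1)) a) := by
  rw [pow_succ', mul_apply, twist_pow_apply h hab hk k (by omega), twist_apply_of_ne,
    ← mul_apply σ, ← pow_succ']
  · intro h'
    exact h.not_sameCycle a ⟨k, by simpa using h'⟩
  · intro h'
    exact hab ⟨k, by simpa using h'⟩

/-- Cutting: the cycle of `a` becomes the arc from `a` to the point before `b`. -/
theorem card_cyc_twist_of_pow (h : IsSym σ) {k : ℕ} (h0 : 0 < k) (hk : k < (cyc σ a).card)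
    (hb : (σ ^ k) a = b) :
    (cyc (twist a b σ) a).card = k ∧ ¬ (twist a b σ).SameCycle a b := by
  have hab : ¬ σ.SameCycle a (tau n b) := by
    intro h'
    have : σ.SameCycle a b := ⟨k, by simpa using hb⟩
    exact h.not_sameCycle b (this.symm.trans h')
  have hlt : ∀ j, 0 < j → j < k → (σ ^ j) a ≠ a ∧ (σ ^ j) a ≠ b := by
    intro j hj hjk
    refine ⟨pow_apply_ne_self hj (by omega), fun h' => ?_⟩
    have := pow_apply_injOn (by omega) hk (h'.trans hb.symm)
    omega
  obtain ⟨l, rfl⟩ : ∃ l, k = l + 1 := ⟨k - 1, by omega⟩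
  have hcard : (cyc (twist a b σ) a).card = l + 1 := by
    apply card_cyc_eq_of_pow h0
    · rw [twist_pow_succ_apply h hab hlt, hb, swap_apply_right]
    · intro j hj hjk
      rw [twist_pow_apply h hab hlt j hjk]
      exact (hlt j hj hjk).1
  refine ⟨hcard, fun hs => ?_⟩
  obtain ⟨j, hj, hjb⟩ := exists_pow_of_sameCycle hs
  rw [hcard] at hj
  rw [twist_pow_apply h hab hlt j hj] at hjb
  have := pow_apply_injOn (by omega) hk (hjb.trans hb.symm)
  omega

theorem not_sameCycle_twist_of_sameCycle (h : IsSym σ) (hne : a ≠ b) (hab : σ.SameCycle a b) :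
    ¬ (twist a b σ).SameCycle a b := by
  obtain ⟨j, hj, hjb⟩ := exists_pow_of_sameCycle hab
  refine (card_cyc_twist_of_pow h (Nat.pos_of_ne_zero ?_) hj hjb).2
  rintro rfl
  exact hne hjb

/-- Joining: if `a` and `b` lie on cycles that are neither equal nor mirror images of each other,
the two cycles become one. -/
theorem sameCycle_twist_join (h : IsSym σ) (h1 : ¬ σ.SameCycle a b)
    (h2 : ¬ σ.SameCycle a (tau n b)) (x : Letters n) :
    (twist a b σ).SameCycle a x ↔ σ.SameCycle a x ∨ σ.SameCycle b x := by
  -- one half of the claim, without loss of generality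
  have key : ∀ {a b : Letters n}, ¬ σ.SameCycle a b → ¬ σ.SameCycle a (tau n b) →
      (twist a b σ).SameCycle a b ∧ ∀ x, σ.SameCycle a x → (twist a b σ).SameCycle a x := by
    intro a b h1 h2
    have hlt : ∀ j, 0 < j → j < (cyc σ a).card → (σ ^ j) a ≠ a ∧ (σ ^ j) a ≠ b := fun j h0 hj =>
      ⟨pow_apply_ne_self h0 hj, fun h' => h1 ⟨j, by simpa using h'⟩⟩
    constructor
    · obtain ⟨l, hl⟩ : ∃ l, (cyc σ a).card = l + 1 :=
        ⟨(cyc σ a).card - 1, by have := card_cyc_pos σ a; omega⟩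
      have h3 := pow_card_cyc_apply σ a
      rw [hl] at hlt h3
      have := twist_pow_succ_apply h h2 hlt
      rw [h3, swap_apply_left] at this
      exact ⟨(l + 1 : ℕ), by rw [zpow_natCast]; exact this⟩
    · intro x hx
      obtain ⟨j, hj, rfl⟩ := exists_pow_of_sameCycle hx
      rw [← twist_pow_apply h h2 hlt j hj]
      exact sameCycle_pow_right.2 (SameCycle.refl _ _)
  have h2' : ¬ σ.SameCycle b (tau n a) := fun h' => h2 (h.sameCycle_tau_left.1 h'.symm)
  constructor
  · intro hx
    refine sameCycle_mem_of_invariant (p := fun x => σ.SameCycle a x ∨ σ.SameCycle b x)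
      (twist_mem_of_invariant (fun y hy => ?_) (Or.inl (SameCycle.refl _ _))
        (Or.inr (SameCycle.refl _ _)) ?_ ?_) (Or.inl (SameCycle.refl _ _)) hx
    · exact hy.imp sameCycle_apply_right.2 sameCycle_apply_right.2
    · exact fun hy => hy.elim (h.not_sameCycle a) h2'
    · exact fun hy => hy.elim h2 (h.not_sameCycle b)
  · rintro (hx | hx)
    · exact (key h1 h2).2 x hx
    · have h3 := (key (fun h' => h1 h'.symm) h2').2 x hx
      rw [twist_comm] at h3
      exact (key h1 h2).1.trans h3

theorem sameCycle_twist_join' (h : IsSym σ) (h1 : ¬ σ.SameCycle a b)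
    (h2 : ¬ σ.SameCycle a (tau n b)) : (twist a b σ).SameCycle a b :=
  (sameCycle_twist_join h h1 h2 b).2 (Or.inr (SameCycle.refl _ _))

/-- Crossing: if `b` lies on the mirror image of the cycle of `a`, the same holds, with
`a` and `τ b` on one cycle, after the step. -/
theorem sameCycle_tau_twist (h : IsSym σ) (hab : σ.SameCycle a (tau n b)) :
    (twist a b σ).SameCycle a (tau n b) := by
  have h' := h.twist a b
  by_contra h2
  by_cases h1 : (twist a b σ).SameCycle a b
  · -- otherwise the reverse step cuts the cycle that contains `a` and `b`
    apply h2
    refine sameCycle_mem_of_invariant (p := fun x => (twist a b σ).SameCycle a x)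
      (fun y hy => ?_) (SameCycle.refl _ _) hab
    have h3 := twist_mem_of_invariant (σ := twist a b σ)
      (p := fun x => (twist a b σ).SameCycle a x) (fun x => sameCycle_apply_right.2)
      (SameCycle.refl _ _) h1 (h'.not_sameCycle a) h2 y hy
    rwa [twist_twist] at h3
  · have h3 := sameCycle_twist_join' h' h1 h2
    rw [twist_twist] at h3
    exact h.not_sameCycle b (h3.symm.trans hab)

theorem sameCycle_tau_twist_iff (h : IsSym σ) :
    (twist a b σ).SameCycle a (tau n b) ↔ σ.SameCycle a (tau n b) := by
  refine ⟨fun h' => ?_, sameCycle_tau_twist h⟩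
  have := sameCycle_tau_twist (h.twist a b) h'
  rwa [twist_twist] at this

theorem sameCycle_twist_iff_not (h : IsSym σ) (hne : a ≠ b) (hx : ¬ σ.SameCycle a (tau n b)) :
    (twist a b σ).SameCycle a b ↔ ¬ σ.SameCycle a b :=
  ⟨fun h1 h2 => not_sameCycle_twist_of_sameCycle h hne h2 h1,
    fun h1 => sameCycle_twist_join' h h1 hx⟩

/-- Unless the step is a crossing, the union of the cycles through `a` and `b` is the same before
and after the step. -/
theorem sameCycle_or_twist (h : IsSym σ) (hne : a ≠ b) (hx : ¬ σ.SameCycle a (tau n b))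
    (x : Letters n) : ((twist a b σ).SameCycle x a ∨ (twist a b σ).SameCycle x b) ↔
      (σ.SameCycle x a ∨ σ.SameCycle x b) := by
  have key : ∀ {σ : Perm (Letters n)}, IsSym σ → ¬ σ.SameCycle a (tau n b) → ¬ σ.SameCycle a b →
      (((twist a b σ).SameCycle x a ∨ (twist a b σ).SameCycle x b) ↔
      (σ.SameCycle x a ∨ σ.SameCycle x b)) := by
    intro σ h h1 h2
    have h3 := sameCycle_twist_join h h2 h1 x
    have h4 := sameCycle_twist_join' h h2 h1
    rw [sameCycle_comm (x := x) (y := a), sameCycle_comm (x := x) (y := b),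
      sameCycle_comm (x := x) (y := a), sameCycle_comm (x := x) (y := b), ← h3]
    exact ⟨fun h => h.elim id h4.trans, Or.inl⟩
  by_cases hab : σ.SameCycle a b
  · have := key (h.twist a b) (by rwa [sameCycle_tau_twist_iff h])
      (not_sameCycle_twist_of_sameCycle h hne hab)
    rw [twist_twist] at this
    exact this.symm
  · exact key h hx hab

theorem card_cyc_twist_join (h : IsSym σ) (h1 : ¬ σ.SameCycle a b)
    (h2 : ¬ σ.SameCycle a (tau n b)) :
    (cyc (twist a b σ) a).card = (cyc σ a).card + (cyc σ b).card := by
  classical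
  rw [← Finset.card_union_of_disjoint]
  · congr 1
    ext x
    rw [Finset.mem_union, mem_cyc, mem_cyc, mem_cyc, sameCycle_twist_join h h1 h2]
  · rw [Finset.disjoint_left]
    intro x hx hx'
    exact h1 ((mem_cyc.1 hx).trans (mem_cyc.1 hx').symm)

theorem card_cyc_twist_cut (h : IsSym σ) (hne : a ≠ b) (h1 : σ.SameCycle a b) :
    (cyc σ a).card = (cyc (twist a b σ) a).card + (cyc (twist a b σ) b).card := by
  have := card_cyc_twist_join (h.twist a b) (not_sameCycle_twist_of_sameCycle h hne h1)
    (fun h2 => h.not_sameCycle b (h1.symm.trans ((sameCycle_tau_twist_iff h).1 h2)))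
  rwa [twist_twist] at this

theorem touched_iff_of_crossing (h : IsSym σ) (hx : σ.SameCycle a (tau n b)) (x : Letters n) :
    Touched σ a b x ↔ (σ.SameCycle x a ∨ σ.SameCycle x (tau n a)) := by
  have h1 : σ.SameCycle (tau n a) b := h.sameCycle_tau_left.2 hx
  unfold Touched
  constructor
  · rintro (h2 | h2 | h2 | h2)
    · exact Or.inl h2
    · exact Or.inr (h2.trans h1.symm)
    · exact Or.inr h2
    · exact Or.inl (h2.trans hx.symm)
  · rintro (h2 | h2)
    · exact Or.inl h2
    · exact Or.inr (Or.inr (Or.inl h2))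

theorem card_cyc_twist_crossing (h : IsSym σ) (hx : σ.SameCycle a (tau n b)) :
    (cyc (twist a b σ) a).card = (cyc σ a).card := by
  classical
  have key : ∀ {σ : Perm (Letters n)}, IsSym σ → σ.SameCycle a (tau n b) →
      (Finset.univ.filter fun x => Touched σ a b x).card = 2 * (cyc σ a).card := by
    intro σ h hx
    rw [two_mul]
    nth_rewrite 2 [← h.card_cyc_tau]
    rw [← Finset.card_union_of_disjoint]
    · congr 1
      ext x
      rw [Finset.mem_filter, touched_iff_of_crossing h hx, Finset.mem_union, mem_cyc, mem_cyc,
        sameCycle_comm (x := x), sameCycle_comm (x := x)]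
      simp
    · rw [Finset.disjoint_left]
      intro x hx hx'
      exact h.not_sameCycle a ((mem_cyc.1 hx).trans (mem_cyc.1 hx').symm)
  have h1 := key h hx
  have h2 := key (h.twist a b) ((sameCycle_tau_twist_iff h).2 hx)
  simp only [touched_twist] at h2
  omega

end Trichotomy

end

/-! ### Labellings of the cycles by the edges of a graph -/

section

variable {n m : ℕ}

namespace WGraph

/-- The compatibilities of a vertex numbering with edge directions and involution. -/
structure IsGraded (Γ : WGraph) (pos : Γ.V → Fin m) : Prop where
  invV_invV : ∀ v, Γ.invV (Γ.invV v) = v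
  invE_invE : ∀ e, Γ.invE (Γ.invE e) = e
  src_inv : ∀ e, Γ.src (Γ.invE e) = (Γ.src e).map Γ.invV
  tgt_inv : ∀ e, Γ.tgt (Γ.invE e) = (Γ.tgt e).map Γ.invV
  eq_iff : ∀ u v, pos u = pos v ↔ v = u ∨ v = Γ.invV u
  lt_of_arrow : ∀ u v, Γ.Arrow u v → pos u < pos v

theorem IsTwistedMonodromy.isGraded {Γ : WGraph} {g : ℕ} {μ ν : n.Partition}
    (h : Γ.IsTwistedMonodromy g μ ν) {pos : Γ.V → Fin m} (hp : Γ.IsVertexOrder pos) :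
    Γ.IsGraded pos :=
  ⟨h.invV_invV, h.invE_invE, h.src_inv, h.tgt_inv, hp.eq_iff, hp.lt_of_arrow⟩

/-- The edge `e` crosses the level between the vertices numbered below `k` and those from `k` on:
`k` ranges over `0, …, b`, and ends extend to the outside. -/
def Alive (Γ : WGraph) (pos : Γ.V → Fin m) (k : ℕ) (e : Γ.E) : Prop :=
  (∀ v, Γ.src e = some v → (pos v : ℕ) < k) ∧ ∀ v, Γ.tgt e = some v → k ≤ pos v

/-- A level-`k` state: a symmetric permutation `σ` together with a bijection from its cycles to the
edges of `Γ` alive at level `k`, given as the map `f` from points to edges. It is equivariant, and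
the weight of an edge is the length of its cycle. -/
structure IsState (Γ : WGraph) (pos : Γ.V → Fin m) (k : ℕ) (σ : Perm (Letters n))
    (f : Letters n → Γ.E) : Prop where
  sym : IsSym σ
  eq_iff : ∀ x y, f x = f y ↔ σ.SameCycle x y
  map_tau : ∀ x, f (tau n x) = Γ.invE (f x)
  weight_eq : ∀ x, Γ.weight (f x) = (cyc σ x).card
  alive_iff : ∀ e, (∃ x, f x = e) ↔ Γ.Alive pos k e

/-- The labels `f` and `f'` before and after the step with transposition `(a b)` match at the
vertex `v` numbered `k`: the affected cycles pass through `v` or its mirror image,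
and the others keep their labels. -/
structure IsStepAt (Γ : WGraph) (pos : Γ.V → Fin m) (k : ℕ) (σ : Perm (Letters n))
    (a b : Letters n) (f f' : Letters n → Γ.E) (v : Γ.V) : Prop where
  ne : a ≠ b
  ne_tau : b ≠ tau n a
  pos_eq : (pos v : ℕ) = k
  tgt_left : Γ.tgt (f a) = some v
  tgt_right : Γ.tgt (f b) = some v
  inv_iff : Γ.invV v = v ↔ f a = Γ.invE (f b)
  src_eq : ∀ x, Touched σ a b x → Γ.src (f' x) = Γ.tgt (f x)
  untouched : ∀ x, ¬ Touched σ a b x → f' x = f x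

variable {Γ : WGraph} {pos : Γ.V → Fin m} {k : ℕ} {σ σ' : Perm (Letters n)} {a b : Letters n}
  {f f' : Letters n → Γ.E} {v : Γ.V}

theorem mem_inEdges {e : Γ.E} : e ∈ Γ.inEdges v ↔ Γ.tgt e = some v := by
  simp [inEdges]

theorem mem_outEdges {e : Γ.E} : e ∈ Γ.outEdges v ↔ Γ.src e = some v := by
  simp [outEdges]

theorem IsStepAt.symm (hG : Γ.IsGraded pos) (h : Γ.IsStepAt pos k σ a b f f' v) :
    Γ.IsStepAt pos k σ b a f f' v where
  ne := h.ne.symm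
  ne_tau := fun h' => h.ne_tau (by rw [h', tau_tau])
  pos_eq := h.pos_eq
  tgt_left := h.tgt_right
  tgt_right := h.tgt_left
  inv_iff := by
    rw [h.inv_iff]
    constructor <;> intro h' <;> rw [h', hG.invE_invE]
  src_eq x hx := h.src_eq x (touched_comm.1 hx)
  untouched x hx := h.untouched x (mt touched_comm.1 hx)

theorem touched_left (σ : Perm (Letters n)) (a b : Letters n) : Touched σ a b a :=
  Or.inl (SameCycle.refl _ _)

theorem touched_right (σ : Perm (Letters n)) (a b : Letters n) : Touched σ a b b :=
  Or.inr (Or.inl (SameCycle.refl _ _))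

theorem IsStepAt.src_left (h : Γ.IsStepAt pos k σ a b f f' v) : Γ.src (f' a) = some v := by
  rw [h.src_eq a (touched_left σ a b), h.tgt_left]

theorem IsStepAt.src_right (h : Γ.IsStepAt pos k σ a b f f' v) : Γ.src (f' b) = some v := by
  rw [h.src_eq b (touched_right σ a b), h.tgt_right]

/-- The affected points are those whose label changes from an edge ending at `v` or its mirror
image to one starting there. -/
theorem IsState.touched_iff (hs : Γ.IsState pos k σ f) {x : Letters n} :
    Touched σ a b x ↔
      f x = f a ∨ f x = f b ∨ f x = Γ.invE (f a) ∨ f x = Γ.invE (f b) := by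
  unfold Touched
  rw [← hs.map_tau, ← hs.map_tau, hs.eq_iff, hs.eq_iff, hs.eq_iff, hs.eq_iff]

theorem IsStepAt.crossing_iff (hs : Γ.IsState pos k σ f)
    (h : Γ.IsStepAt pos k σ a b f f' v) : Γ.invV v = v ↔ σ.SameCycle a (tau n b) := by
  rw [h.inv_iff, ← hs.map_tau, hs.eq_iff]

theorem IsStepAt.inEdges_eq [DecidableEq Γ.E] (hG : Γ.IsGraded pos) (hs : Γ.IsState pos k σ f)
    (hs' : Γ.IsState pos (k + 1) σ' f')
    (h : Γ.IsStepAt pos k σ a b f f' v) : Γ.inEdges v = {f a, f b} := by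
  ext e
  rw [mem_inEdges, Finset.mem_insert, Finset.mem_singleton]
  constructor
  · intro he
    obtain ⟨x, rfl⟩ := (hs.alive_iff e).2 ⟨fun u hu => by
      rw [← h.pos_eq]; exact hG.lt_of_arrow u v ⟨e, hu, he⟩, fun w hw => by
      rw [he] at hw; cases hw; exact h.pos_eq.ge⟩
    have ht : Touched σ a b x := by
      by_contra hx
      have h1 := ((hs'.alive_iff (f x)).1 ⟨x, h.untouched x hx⟩).2 v he
      have := h.pos_eq
      omega
    rcases (hs.touched_iff).1 ht with h1 | h1 | h1 | h1
    · exact Or.inl h1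
    · exact Or.inr h1
    · have h2 : Γ.invV v = v := by
        rw [h1, hG.tgt_inv, h.tgt_left] at he
        simpa using he
      rw [h.inv_iff] at h2
      rw [h1, h2, hG.invE_invE]; simp
    · have h2 : Γ.invV v = v := by
        rw [h1, hG.tgt_inv, h.tgt_right] at he
        simpa using he
      rw [h.inv_iff] at h2
      rw [h1, h2]; simp
  · rintro (rfl | rfl)
    exacts [h.tgt_left, h.tgt_right]

theorem IsStepAt.inv_eq_iff' (hs : Γ.IsState pos k σ f)
    (hs' : Γ.IsState pos (k + 1) (twist a b σ) f')
    (h : Γ.IsStepAt pos k σ a b f f' v) : Γ.invV v = v ↔ f' a = Γ.invE (f' b) := by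
  rw [h.crossing_iff hs, ← hs'.map_tau, hs'.eq_iff, sameCycle_tau_twist_iff hs.sym]

theorem IsStepAt.outEdges_eq [DecidableEq Γ.E] (hG : Γ.IsGraded pos) (hs : Γ.IsState pos k σ f)
    (hs' : Γ.IsState pos (k + 1) (twist a b σ) f')
    (h : Γ.IsStepAt pos k σ a b f f' v) : Γ.outEdges v = {f' a, f' b} := by
  ext e
  rw [mem_outEdges, Finset.mem_insert, Finset.mem_singleton]
  constructor
  · intro he
    obtain ⟨x, rfl⟩ := (hs'.alive_iff e).2 ⟨fun u hu => by
      rw [he] at hu; cases hu; have := h.pos_eq; omega, fun w hw => by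
      have := h.pos_eq
      have : pos v < pos w := hG.lt_of_arrow v w ⟨e, he, hw⟩
      have : (pos v : ℕ) < pos w := this
      omega⟩
    have ht : Touched σ a b x := by
      by_contra hx
      have h1 := ((hs.alive_iff (f' x)).1 ⟨x, (h.untouched x hx).symm⟩).1 v he
      have := h.pos_eq
      omega
    rcases (hs'.touched_iff).1 (touched_twist.2 ht) with h1 | h1 | h1 | h1
    · exact Or.inl h1
    · exact Or.inr h1
    · have h2 : Γ.invV v = v := by
        rw [h1, hG.src_inv, h.src_left] at he
        simpa using he
      rw [h.inv_eq_iff' hs hs'] at h2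
      rw [h1, h2, hG.invE_invE]; simp
    · have h2 : Γ.invV v = v := by
        rw [h1, hG.src_inv, h.src_right] at he
        simpa using he
      rw [h.inv_eq_iff' hs hs'] at h2
      rw [h1, h2]; simp
  · rintro (rfl | rfl)
    exacts [h.src_left, h.src_right]

/-- Local structure at a vertex: a join and a cut give a 3-valent vertex. -/
theorem IsStepAt.valence_of_ne (hG : Γ.IsGraded pos) (hs : Γ.IsState pos k σ f)
    (hs' : Γ.IsState pos (k + 1) (twist a b σ) f')
    (h : Γ.IsStepAt pos k σ a b f f' v) (hv : Γ.invV v ≠ v) : Γ.valence v = 3 := by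
  classical
  have h1 := mt (h.crossing_iff hs).2 hv
  have h2 := sameCycle_twist_iff_not hs.sym h.ne h1
  rw [← hs.eq_iff, ← hs'.eq_iff] at h2
  rw [valence, h.inEdges_eq hG hs hs', h.outEdges_eq hG hs hs']
  by_cases h3 : f a = f b
  · rw [Finset.card_pair (fun h4 => h2.1 h4 h3), h3]; simp
  · rw [Finset.card_pair h3, h2.2 h3]; simp

/-- Local structure at a vertex: a crossing gives a 4-valent vertex. -/
theorem IsStepAt.valence_of_eq (hG : Γ.IsGraded pos) (hs : Γ.IsState pos k σ f)
    (hs' : Γ.IsState pos (k + 1) (twist a b σ) f')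
    (h : Γ.IsStepAt pos k σ a b f f' v) (hv : Γ.invV v = v) : Γ.valence v = 4 := by
  classical
  have h1 := (h.crossing_iff hs).1 hv
  have h2 := (sameCycle_tau_twist_iff hs.sym).2 h1
  rw [valence, h.inEdges_eq hG hs hs', h.outEdges_eq hG hs hs', Finset.card_pair,
    Finset.card_pair]
  · rw [Ne, hs'.eq_iff]
    exact fun h3 => hs'.sym.not_sameCycle b (h3.symm.trans h2)
  · rw [Ne, hs.eq_iff]
    exact fun h3 => hs.sym.not_sameCycle b (h3.symm.trans h1)

theorem IsStepAt.balanced (hG : Γ.IsGraded pos) (hs : Γ.IsState pos k σ f)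
    (hs' : Γ.IsState pos (k + 1) (twist a b σ) f')
    (h : Γ.IsStepAt pos k σ a b f f' v) :
    ∑ e ∈ Γ.inEdges v, Γ.weight e = ∑ e ∈ Γ.outEdges v, Γ.weight e := by
  classical
  rw [h.inEdges_eq hG hs hs', h.outEdges_eq hG hs hs']
  by_cases hab : σ.SameCycle a b
  · have h2 := not_sameCycle_twist_of_sameCycle hs.sym h.ne hab
    rw [← hs'.eq_iff] at h2
    rw [Finset.sum_pair h2, (hs.eq_iff a b).2 hab, Finset.pair_eq_singleton,
      Finset.sum_singleton, ← (hs.eq_iff a b).2 hab, hs.weight_eq, hs'.weight_eq, hs'.weight_eq,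
      card_cyc_twist_cut hs.sym h.ne hab]
  · have h3 : f a ≠ f b := mt (hs.eq_iff a b).1 hab
    by_cases hc : σ.SameCycle a (tau n b)
    · have h4 := (sameCycle_tau_twist_iff hs.sym).2 hc
      have h5 : f' a ≠ f' b := by
        rw [Ne, hs'.eq_iff]
        exact fun h3 => hs'.sym.not_sameCycle b (h3.symm.trans h4)
      have hc' : σ.SameCycle b (tau n a) := (hs.sym.sameCycle_tau_left.1 hc.symm)
      rw [Finset.sum_pair h3, Finset.sum_pair h5, hs.weight_eq, hs.weight_eq, hs'.weight_eq,
        hs'.weight_eq, card_cyc_twist_crossing hs.sym hc, twist_comm,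
        card_cyc_twist_crossing hs.sym hc']
    · have h4 := sameCycle_twist_join' hs.sym hab hc
      rw [← hs'.eq_iff] at h4
      rw [Finset.sum_pair h3, ← h4, Finset.pair_eq_singleton, Finset.sum_singleton, hs.weight_eq,
        hs.weight_eq, hs'.weight_eq, card_cyc_twist_join hs.sym hab hc]

theorem IsStepAt.weight_crossing (hG : Γ.IsGraded pos) (hs : Γ.IsState pos k σ f)
    (hs' : Γ.IsState pos (k + 1) (twist a b σ) f')
    (h : Γ.IsStepAt pos k σ a b f f' v) (hv : Γ.invV v = v) {e : Γ.E} (he : Γ.Incident e v) :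
    Γ.weight e = (cyc σ a).card := by
  classical
  have hc := (h.crossing_iff hs).1 hv
  have hb : (cyc σ b).card = (cyc σ a).card := by
    rw [cyc_eq_iff.2 hc, hs.sym.card_cyc_tau]
  have hc' : σ.SameCycle b (tau n a) := (hs.sym.sameCycle_tau_left.1 hc.symm)
  rcases he with he | he
  · rw [← mem_outEdges, h.outEdges_eq hG hs hs', Finset.mem_insert, Finset.mem_singleton] at he
    rcases he with rfl | rfl
    · rw [hs'.weight_eq, card_cyc_twist_crossing hs.sym hc]
    · rw [hs'.weight_eq, twist_comm, card_cyc_twist_crossing hs.sym hc', hb]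
  · rw [← mem_inEdges, h.inEdges_eq hG hs hs', Finset.mem_insert, Finset.mem_singleton] at he
    rcases he with rfl | rfl
    · rw [hs.weight_eq]
    · rw [hs.weight_eq, hb]

end WGraph

end

section

variable {n m : ℕ}

namespace WGraph

/-- A labelling of the sequence `σ 0, …, σ m` of permutations, in which consecutive ones differ by
the step with transposition `(a k, b k)`, by a graph with vertices on `m` levels. -/
structure IsLabelling (Γ : WGraph) (pos : Γ.V → Fin m) (σ : ℕ → Perm (Letters n))
    (a b : ℕ → Letters n) (f : ℕ → Letters n → Γ.E) : Prop where
  state : ∀ k ≤ m, Γ.IsState pos k (σ k) (f k)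
  twist_eq : ∀ k < m, σ (k + 1) = twist (a k) (b k) (σ k)
  step : ∀ k < m, ∃ v, Γ.IsStepAt pos k (σ k) (a k) (b k) (f k) (f (k + 1)) v

variable {Γ : WGraph} {pos : Γ.V → Fin m} {σ : ℕ → Perm (Letters n)} {a b : ℕ → Letters n}
  {f : ℕ → Letters n → Γ.E}

theorem IsStepAt.tgt_cases {k : ℕ} {σ : Perm (Letters n)} {a b : Letters n}
    {f f' : Letters n → Γ.E} {v : Γ.V} (hG : Γ.IsGraded pos) (hs : Γ.IsState pos k σ f)
    (h : Γ.IsStepAt pos k σ a b f f' v) {x : Letters n} (hx : Touched σ a b x) :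
    (Γ.tgt (f x) = some v ∧ (σ.SameCycle x a ∨ σ.SameCycle x b)) ∨
      (Γ.tgt (f x) = some (Γ.invV v) ∧
        (σ.SameCycle (tau n x) a ∨ σ.SameCycle (tau n x) b)) := by
  rcases hx with hx | hx | hx | hx
  · exact Or.inl ⟨by rw [(hs.eq_iff x a).2 hx, h.tgt_left], Or.inl hx⟩
  · exact Or.inl ⟨by rw [(hs.eq_iff x b).2 hx, h.tgt_right], Or.inr hx⟩
  · refine Or.inr ⟨?_, Or.inl (hs.sym.sameCycle_tau_left.2 hx)⟩
    rw [(hs.eq_iff _ _).2 hx, hs.map_tau, hG.tgt_inv, h.tgt_left]; rfl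
  · refine Or.inr ⟨?_, Or.inr (hs.sym.sameCycle_tau_left.2 hx)⟩
    rw [(hs.eq_iff _ _).2 hx, hs.map_tau, hG.tgt_inv, h.tgt_right]; rfl

theorem IsGraded.pos_inv (hG : Γ.IsGraded pos) (v : Γ.V) : pos (Γ.invV v) = pos v :=
  ((hG.eq_iff v (Γ.invV v)).2 (Or.inr rfl)).symm

/-- Whether two affected points pass through the same vertex depends on the permutations only. -/
theorem IsStepAt.tgt_eq_iff {k : ℕ} {σ : Perm (Letters n)} {a b : Letters n}
    {f f' : Letters n → Γ.E} {v : Γ.V} (hG : Γ.IsGraded pos) (hs : Γ.IsState pos k σ f)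
    (h : Γ.IsStepAt pos k σ a b f f' v) {x y : Letters n} (hx : Touched σ a b x)
    (hy : Touched σ a b y) :
    Γ.tgt (f x) = Γ.tgt (f y) ↔ (σ.SameCycle a (tau n b) ∨
      ((σ.SameCycle x a ∨ σ.SameCycle x b) ∧ (σ.SameCycle y a ∨ σ.SameCycle y b)) ∨
      ((σ.SameCycle (tau n x) a ∨ σ.SameCycle (tau n x) b) ∧
        (σ.SameCycle (tau n y) a ∨ σ.SameCycle (tau n y) b))) := by
  have side : ∀ {z}, (σ.SameCycle z a ∨ σ.SameCycle z b) → Γ.tgt (f z) = some v := by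
    rintro z (hz | hz)
    · rw [(hs.eq_iff z a).2 hz, h.tgt_left]
    · rw [(hs.eq_iff z b).2 hz, h.tgt_right]
  have side' : ∀ {z}, (σ.SameCycle (tau n z) a ∨ σ.SameCycle (tau n z) b) →
      Γ.tgt (f z) = some (Γ.invV v) := by
    intro z hz
    have := side hz
    rw [hs.map_tau, hG.tgt_inv] at this
    cases h1 : Γ.tgt (f z) with
    | none => rw [h1] at this; simp at this
    | some w =>
      rw [h1] at this
      have h2 : Γ.invV w = v := by simpa using this
      rw [← h2, hG.invV_invV]
  constructor
  · intro hxy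
    by_cases hv : Γ.invV v = v
    · exact Or.inl ((h.crossing_iff hs).1 hv)
    · rcases h.tgt_cases hG hs hx with ⟨h1, h2⟩ | ⟨h1, h2⟩ <;>
        rcases h.tgt_cases hG hs hy with ⟨h3, h4⟩ | ⟨h3, h4⟩
      · exact Or.inr (Or.inl ⟨h2, h4⟩)
      · rw [h1, h3, Option.some_inj] at hxy
        exact absurd hxy.symm hv
      · rw [h1, h3, Option.some_inj] at hxy
        exact absurd hxy hv
      · exact Or.inr (Or.inr ⟨h2, h4⟩)
  · rintro (h1 | ⟨h1, h2⟩ | ⟨h1, h2⟩)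
    · have hv := (h.crossing_iff hs).2 h1
      have : ∀ {z}, Touched σ a b z → Γ.tgt (f z) = some v := fun hz =>
        (h.tgt_cases hG hs hz).elim (·.1) (fun h5 => h5.1.trans (by rw [hv]))
      rw [this hx, this hy]
    · rw [side h1, side h2]
    · rw [side' h1, side' h2]

namespace IsLabelling

theorem twist_state (h : Γ.IsLabelling pos σ a b f) {k : ℕ} (hk : k < m) :
    Γ.IsState pos (k + 1) (twist (a k) (b k) (σ k)) (f (k + 1)) := by
  rw [← h.twist_eq k hk]; exact h.state (k + 1) hk

theorem exists_tgt_of_touched (h : Γ.IsLabelling pos σ a b f) (hG : Γ.IsGraded pos) {k : ℕ}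
    (hk : k < m) {x : Letters n} (hx : Touched (σ k) (a k) (b k) x) :
    ∃ w, Γ.tgt (f k x) = some w ∧ (pos w : ℕ) = k := by
  obtain ⟨v, hv⟩ := h.step k hk
  rcases hv.tgt_cases hG (h.state k hk.le) hx with ⟨h1, _⟩ | ⟨h1, _⟩
  · exact ⟨v, h1, hv.pos_eq⟩
  · exact ⟨_, h1, by rw [hG.pos_inv, hv.pos_eq]⟩

theorem touched_of_tgt (h : Γ.IsLabelling pos σ a b f) {k : ℕ} (hk : k < m) {x : Letters n}
    {w : Γ.V} (hw : Γ.tgt (f k x) = some w) (hp : (pos w : ℕ) = k) :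
    Touched (σ k) (a k) (b k) x := by
  obtain ⟨v, hv⟩ := h.step k hk
  by_contra hx
  have := (((h.state (k + 1) hk).alive_iff _).1 ⟨x, hv.untouched x hx⟩).2 w hw
  omega

theorem touched_of_src (h : Γ.IsLabelling pos σ a b f) {k : ℕ} (hk : k < m) {x : Letters n}
    {w : Γ.V} (hw : Γ.src (f (k + 1) x) = some w) (hp : (pos w : ℕ) = k) :
    Touched (σ k) (a k) (b k) x := by
  obtain ⟨v, hv⟩ := h.step k hk
  by_contra hx
  have := (((h.state k hk.le).alive_iff _).1 ⟨x, (hv.untouched x hx).symm⟩).1 w hw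
  omega

theorem alive (h : Γ.IsLabelling pos σ a b f) {k : ℕ} (hk : k ≤ m) (x : Letters n) :
    Γ.Alive pos k (f k x) := ((h.state k hk).alive_iff _).1 ⟨x, rfl⟩

theorem eq_of_not_touched (h : Γ.IsLabelling pos σ a b f) {i j : ℕ} (hij : i ≤ j) (hj : j ≤ m)
    {x : Letters n} (hx : ∀ k, i ≤ k → k < j → ¬ Touched (σ k) (a k) (b k) x) :
    f j x = f i x := by
  induction j, hij using Nat.le_induction with
  | base => rfl
  | succ j hij ih =>
    obtain ⟨v, hv⟩ := h.step j hj
    rw [hv.untouched x (hx j hij (by omega))]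
    exact ih (by omega) fun k h1 h2 => hx k h1 (by omega)

/-- An edge stays the label of the same points as long as it is alive. -/
theorem not_touched_of_alive (h : Γ.IsLabelling pos σ a b f) (hG : Γ.IsGraded pos) {i j : ℕ}
    (hj : j ≤ m) {x : Letters n} (ha : Γ.Alive pos j (f i x)) (k : ℕ) (hik : i ≤ k) (hkj : k < j) :
    ¬ Touched (σ k) (a k) (b k) x := by
  induction k using Nat.strong_induction_on with
  | _ k ih =>
    intro ht
    obtain ⟨w, hw, hp⟩ := h.exists_tgt_of_touched hG (by omega) ht
    rw [h.eq_of_not_touched hik (by omega) (fun l h1 h2 => ih l h2 h1 (by omega))] at hw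
    have := ha.2 w hw
    omega

theorem eq_of_alive (h : Γ.IsLabelling pos σ a b f) (hG : Γ.IsGraded pos) {i j : ℕ}
    (hij : i ≤ j) (hj : j ≤ m) {x : Letters n} (ha : Γ.Alive pos j (f i x)) : f j x = f i x :=
  h.eq_of_not_touched hij hj (h.not_touched_of_alive hG hj ha)

theorem exists_src_none (h : Γ.IsLabelling pos σ a b f) {e : Γ.E} (he : Γ.src e = none) :
    ∃ x, f 0 x = e :=
  ((h.state 0 (Nat.zero_le _)).alive_iff e).2 ⟨by simp [he], by simp⟩

theorem exists_tgt_none (h : Γ.IsLabelling pos σ a b f) {e : Γ.E} (he : Γ.tgt e = none) :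
    ∃ x, f m x = e :=
  ((h.state m le_rfl).alive_iff e).2 ⟨fun v _ => (pos v).2, by simp [he]⟩

theorem exists_src_some (h : Γ.IsLabelling pos σ a b f) (hG : Γ.IsGraded pos) {e : Γ.E} {v : Γ.V}
    (he : Γ.src e = some v) : ∃ x, f (pos v + 1) x = e :=
  ((h.state _ (pos v).2).alive_iff e).2 ⟨fun u hu => by
    rw [he] at hu; cases hu; omega, fun w hw => hG.lt_of_arrow v w ⟨e, he, hw⟩⟩

theorem exists_tgt_some (h : Γ.IsLabelling pos σ a b f) (hG : Γ.IsGraded pos) {e : Γ.E} {v : Γ.V}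
    (he : Γ.tgt e = some v) : ∃ x, f (pos v) x = e :=
  ((h.state _ (pos v).2.le).alive_iff e).2 ⟨fun u hu => hG.lt_of_arrow u v ⟨e, hu, he⟩,
    fun w hw => by rw [he] at hw; cases hw; exact le_rfl⟩

theorem exists_label (h : Γ.IsLabelling pos σ a b f) (hG : Γ.IsGraded pos) (e : Γ.E) :
    ∃ k ≤ m, ∃ x, f k x = e := by
  cases he : Γ.src e with
  | none => exact ⟨0, Nat.zero_le _, h.exists_src_none he⟩
  | some v => exact ⟨_, (pos v).2, h.exists_src_some hG he⟩

theorem exists_step_at (h : Γ.IsLabelling pos σ a b f) (hG : Γ.IsGraded pos) (v : Γ.V) :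
    ∃ x, Γ.tgt (f (pos v) x) = some v ∧ Touched (σ (pos v)) (a (pos v)) (b (pos v)) x := by
  obtain ⟨w, hw⟩ := h.step (pos v) (pos v).2
  have hs := h.state _ (pos v).2.le
  rcases (hG.eq_iff w v).1 (Fin.ext hw.pos_eq) with rfl | h1
  · exact ⟨_, hw.tgt_left, touched_left _ _ _⟩
  · refine ⟨tau n (a (pos v)), ?_, hs.sym.touched_tau.2 (touched_left _ _ _)⟩
    rw [hs.map_tau, hG.tgt_inv, hw.tgt_left, h1]; rfl

variable {Δ : WGraph} {pos' : Δ.V → Fin m} {f' : ℕ → Letters n → Δ.E}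

/-- Two labellings of one sequence of permutations identify the same pairs of cycles: an edge is
the set of all cycles that are handed on unaffected from step to step. -/
theorem label_congr (h : Γ.IsLabelling pos σ a b f) (hG : Γ.IsGraded pos)
    (h' : Δ.IsLabelling pos' σ a b f') {i j : ℕ} (hi : i ≤ m) (hj : j ≤ m)
    {x y : Letters n} (hxy : f i x = f j y) : f' i x = f' j y := by
  wlog hij : i ≤ j generalizing i j x y
  · exact (this hj hi hxy.symm (by omega)).symm
  have ha : Γ.Alive pos j (f i x) := hxy ▸ h.alive hj y
  have h1 := h.not_touched_of_alive hG hj ha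
  rw [← h'.eq_of_not_touched hij hj h1, (h'.state j hj).eq_iff, ← (h.state j hj).eq_iff, ← hxy,
    h.eq_of_not_touched hij hj h1]

theorem tgt_congr (h : Γ.IsLabelling pos σ a b f) (hG : Γ.IsGraded pos)
    (h' : Δ.IsLabelling pos' σ a b f') (hG' : Δ.IsGraded pos') {k : ℕ} (hk : k < m)
    {x y : Letters n} (hx : Touched (σ k) (a k) (b k) x) (hy : Touched (σ k) (a k) (b k) y)
    (hxy : Γ.tgt (f k x) = Γ.tgt (f k y)) : Δ.tgt (f' k x) = Δ.tgt (f' k y) := by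
  obtain ⟨v, hv⟩ := h.step k hk
  obtain ⟨w, hw⟩ := h'.step k hk
  rw [hw.tgt_eq_iff hG' (h'.state k hk.le) hx hy]
  exact (hv.tgt_eq_iff hG (h.state k hk.le) hx hy).1 hxy

theorem exists_edge_map (h : Γ.IsLabelling pos σ a b f) (hG : Γ.IsGraded pos)
    (h' : Δ.IsLabelling pos' σ a b f') : ∃ φ : Γ.E → Δ.E, ∀ k ≤ m, ∀ x, φ (f k x) = f' k x := by
  choose k hk x hx using h.exists_label hG
  exact ⟨fun e => f' (k e) (x e), fun j hj y => h.label_congr hG h' (hk _) hj (hx _)⟩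

theorem exists_vertex_map (h : Γ.IsLabelling pos σ a b f) (hG : Γ.IsGraded pos)
    (h' : Δ.IsLabelling pos' σ a b f') (hG' : Δ.IsGraded pos') :
    ∃ φ : Γ.V → Δ.V, (∀ v, pos' (φ v) = pos v) ∧
      ∀ k < m, ∀ x v, Touched (σ k) (a k) (b k) x → Γ.tgt (f k x) = some v →
        Δ.tgt (f' k x) = some (φ v) := by
  have key : ∀ v : Γ.V, ∃ w : Δ.V, pos' w = pos v ∧ ∀ x,
      Touched (σ (pos v)) (a (pos v)) (b (pos v)) x → Γ.tgt (f (pos v) x) = some v →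
        Δ.tgt (f' (pos v) x) = some w := by
    intro v
    obtain ⟨x, hx, ht⟩ := h.exists_step_at hG v
    obtain ⟨w, hw, hp⟩ := h'.exists_tgt_of_touched hG' (pos v).2 ht
    refine ⟨w, Fin.ext hp, fun y hy hyv => ?_⟩
    rw [← hw]
    exact h.tgt_congr hG h' hG' (pos v).2 hy ht (hyv.trans hx.symm)
  choose φ h1 h2 using key
  refine ⟨φ, h1, fun k hk x v hx hv => ?_⟩
  obtain ⟨w, hw, hp⟩ := h.exists_tgt_of_touched hG hk hx
  rw [hv] at hw
  cases hw
  subst hp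
  exact h2 v x hx hv

/-- Two graphs that label the same sequence of permutations are isomorphic, compatibly with the
labels. -/
theorem exists_iso (h : Γ.IsLabelling pos σ a b f) (hG : Γ.IsGraded pos)
    (h' : Δ.IsLabelling pos' σ a b f') (hG' : Δ.IsGraded pos') :
    ∃ φ : Iso Γ Δ, (∀ v, pos' (φ.onV v) = pos v) ∧ ∀ k ≤ m, ∀ x, φ.onE (f k x) = f' k x := by
  obtain ⟨φ, hφ⟩ := h.exists_edge_map hG h'
  obtain ⟨ψ, hψ⟩ := h'.exists_edge_map hG' h
  obtain ⟨α, hα0, hα⟩ := h.exists_vertex_map hG h' hG'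
  obtain ⟨β, hβ0, hβ⟩ := h'.exists_vertex_map hG' h hG
  have hαv : ∀ v, ∃ x, Touched (σ (pos v)) (a (pos v)) (b (pos v)) x ∧
      Γ.tgt (f (pos v) x) = some v ∧ Δ.tgt (f' (pos v) x) = some (α v) := by
    intro v
    obtain ⟨x, hx, ht⟩ := h.exists_step_at hG v
    exact ⟨x, ht, hx, hα _ (pos v).2 x v ht hx⟩
  refine ⟨{
    onV := ⟨α, β, fun v => ?_, fun v => ?_⟩
    onE := ⟨φ, ψ, fun e => ?_, fun e => ?_⟩
    src_map := fun e => ?_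
    tgt_map := fun e => ?_
    weight_map := fun e => ?_
    invV_map := fun v => ?_
    invE_map := fun e => ?_ }, hα0, hφ⟩
  · obtain ⟨x, ht, h1, h2⟩ := hαv v
    have h3 := hβ _ (pos v).2 x _ ht h2
    rw [h1] at h3
    exact (Option.some.inj h3).symm
  · obtain ⟨x, hx, ht⟩ := h'.exists_step_at hG' v
    have h2 := hβ _ (pos' v).2 x v ht hx
    have h3 := hα _ (pos' v).2 x _ ht h2
    rw [hx] at h3
    exact (Option.some.inj h3).symm
  · obtain ⟨k, hk, x, rfl⟩ := h.exists_label hG e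
    rw [hφ k hk, hψ k hk]
  · obtain ⟨k, hk, x, rfl⟩ := h'.exists_label hG' e
    rw [hψ k hk, hφ k hk]
  · change Δ.src (φ e) = (Γ.src e).map α
    cases he : Γ.src e with
    | none =>
      obtain ⟨x, rfl⟩ := h.exists_src_none he
      rw [hφ 0 (Nat.zero_le _)]
      cases h1 : Δ.src (f' 0 x) with
      | none => rfl
      | some w => exact absurd ((h'.alive (Nat.zero_le _) x).1 w h1) (by simp)
    | some v =>
      obtain ⟨x, rfl⟩ := h.exists_src_some hG he
      have ht := h.touched_of_src (pos v).2 he rfl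
      obtain ⟨w, hw⟩ := h.step _ (pos v).2
      obtain ⟨w', hw'⟩ := h'.step _ (pos v).2
      rw [hφ _ (pos v).2, hw'.src_eq x ht]
      exact hα _ (pos v).2 x v ht (by rw [← hw.src_eq x ht, he])
  · change Δ.tgt (φ e) = (Γ.tgt e).map α
    cases he : Γ.tgt e with
    | none =>
      obtain ⟨x, rfl⟩ := h.exists_tgt_none he
      rw [hφ m le_rfl]
      cases h1 : Δ.tgt (f' m x) with
      | none => rfl
      | some w => exact absurd ((h'.alive le_rfl x).2 w h1) (by have := (pos' w).2; omega)
    | some v =>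
      obtain ⟨x, rfl⟩ := h.exists_tgt_some hG he
      have ht := h.touched_of_tgt (pos v).2 he rfl
      rw [hφ _ (pos v).2.le]
      exact hα _ (pos v).2 x v ht he
  · change Δ.weight (φ e) = _
    obtain ⟨k, hk, x, rfl⟩ := h.exists_label hG e
    rw [hφ k hk, (h.state k hk).weight_eq, (h'.state k hk).weight_eq]
  · change Δ.invV (α v) = α (Γ.invV v)
    obtain ⟨x, ht, h1, h2⟩ := hαv v
    have hs := h.state _ (pos v).2.le
    have hs' := h'.state _ (pos v).2.le
    have h3 := hα _ (pos v).2 (tau n x) (Γ.invV v) (hs.sym.touched_tau.2 ht)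
      (by rw [hs.map_tau, hG.tgt_inv, h1]; rfl)
    rw [hs'.map_tau, hG'.tgt_inv, h2] at h3
    exact Option.some.inj h3
  · change Δ.invE (φ e) = φ (Γ.invE e)
    obtain ⟨k, hk, x, rfl⟩ := h.exists_label hG e
    rw [← (h.state k hk).map_tau, hφ k hk, hφ k hk, (h'.state k hk).map_tau]

/-- Every edge carries a label, and every vertex is the target of a labelled edge, so the labels
determine an isomorphism. -/
theorem iso_unique (h : Γ.IsLabelling pos σ a b f) (hG : Γ.IsGraded pos) {φ ψ : Iso Γ Δ}
    (hφψ : ∀ k ≤ m, ∀ x, φ.onE (f k x) = ψ.onE (f k x)) : φ = ψ := by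
  have hE : φ.onE = ψ.onE := by
    ext e
    obtain ⟨k, hk, x, rfl⟩ := h.exists_label hG e
    exact hφψ k hk x
  refine Iso.ext ?_ hE
  ext v
  obtain ⟨x, hx, _⟩ := h.exists_step_at hG v
  have h1 := φ.tgt_map (f (pos v) x)
  rw [hE, ψ.tgt_map, hx] at h1
  exact (Option.some.inj h1).symm

end IsLabelling

/-! ### Transport of labels along isomorphisms -/

section Transport

variable {Δ : WGraph} {pos' : Δ.V → Fin m} (φ : Iso Γ Δ)

theorem Iso.alive_iff (hφ : ∀ v, pos' (φ.onV v) = pos v) {k : ℕ} {e : Γ.E} :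
    Δ.Alive pos' k (φ.onE e) ↔ Γ.Alive pos k e := by
  unfold Alive
  rw [φ.src_map, φ.tgt_map]
  constructor
  · rintro ⟨h1, h2⟩
    exact ⟨fun v hv => by rw [← hφ]; exact h1 _ (by rw [hv]; rfl),
      fun v hv => by rw [← hφ]; exact h2 _ (by rw [hv]; rfl)⟩
  · rintro ⟨h1, h2⟩
    refine ⟨fun v hv => ?_, fun v hv => ?_⟩
    · obtain ⟨u, hu, rfl⟩ := Option.map_eq_some_iff.1 hv
      rw [hφ]; exact h1 u hu
    · obtain ⟨u, hu, rfl⟩ := Option.map_eq_some_iff.1 hv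
      rw [hφ]; exact h2 u hu

theorem IsState.map_iso (hφ : ∀ v, pos' (φ.onV v) = pos v) {k : ℕ} {σ : Perm (Letters n)}
    {f : Letters n → Γ.E} (h : Γ.IsState pos k σ f) : Δ.IsState pos' k σ (φ.onE ∘ f) where
  sym := h.sym
  eq_iff x y := by simp [h.eq_iff]
  map_tau x := by simp [h.map_tau, φ.invE_map]
  weight_eq x := by simp [h.weight_eq, φ.weight_map]
  alive_iff e := by
    obtain ⟨e, rfl⟩ := φ.onE.surjective e
    rw [φ.alive_iff hφ, ← h.alive_iff]
    simp

theorem IsStepAt.map_iso (hφ : ∀ v, pos' (φ.onV v) = pos v) {k : ℕ} {σ : Perm (Letters n)}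
    {a b : Letters n} {f f' : Letters n → Γ.E} {v : Γ.V} (h : Γ.IsStepAt pos k σ a b f f' v) :
    Δ.IsStepAt pos' k σ a b (φ.onE ∘ f) (φ.onE ∘ f') (φ.onV v) where
  ne := h.ne
  ne_tau := h.ne_tau
  pos_eq := by rw [hφ, h.pos_eq]
  tgt_left := by rw [Function.comp, φ.tgt_map, h.tgt_left]; rfl
  tgt_right := by rw [Function.comp, φ.tgt_map, h.tgt_right]; rfl
  inv_iff := by simp [φ.invV_map, φ.invE_map, h.inv_iff]
  src_eq x hx := by simp [φ.src_map, φ.tgt_map, h.src_eq x hx]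
  untouched x hx := by simp [h.untouched x hx]

end Transport

end WGraph

end

/-! ### Cycle types -/

section

/-- If the cycles of `σ` are in bijection with a finite set `S`, by a map `f` from points, then
the cycle type, recording fixed points too, is the multiset of the cycle lengths indexed by `S`. -/
theorem partition_parts_eq {X E : Type*} [Fintype X] [DecidableEq X] [Nonempty X] (σ : Perm X)
    (S : Finset E) (f : X → E) (w : E → ℕ) (hf : ∀ x y, f x = f y ↔ σ.SameCycle x y)
    (hS : ∀ e, (∃ x, f x = e) ↔ e ∈ S) (hw : ∀ x, w (f x) = (cyc σ x).card) :
    σ.partition.parts = S.val.map w := by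
  classical
  have hfix : ∀ x, w (f x) = 1 ↔ σ x = x := by
    intro x
    rw [hw, Finset.card_eq_one]
    constructor
    · rintro ⟨y, hy⟩
      have h1 := hy ▸ self_mem_cyc σ x
      have h2 : σ x ∈ cyc σ x := mem_cyc.2 (sameCycle_apply_right.2 (SameCycle.refl _ _))
      rw [hy] at h2
      rw [Finset.mem_singleton] at h1 h2
      rw [h2, h1]
    · intro hx
      refine ⟨x, ?_⟩
      ext y
      rw [mem_cyc, Finset.mem_singleton]
      exact ⟨fun h => (h.eq_of_left hx).symm, fun h => h ▸ SameCycle.refl _ _⟩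
  have hp : ∀ e, ∃ x, e ∈ S → f x = e := by
    intro e
    by_cases he : e ∈ S
    · obtain ⟨x, hx⟩ := (hS e).2 he
      exact ⟨x, fun _ => hx⟩
    · exact ⟨Classical.arbitrary X, fun h => absurd h he⟩
  choose p hp using hp
  rw [parts_partition, ← Multiset.filter_add_not (fun e => w e ≠ 1) S.val, Multiset.map_add]
  congr 1
  · have himg : σ.cycleFactorsFinset =
        (S.filter fun e => w e ≠ 1).image fun e => σ.cycleOf (p e) := by
      ext c
      simp only [Finset.mem_image, Finset.mem_filter]
      constructor
      · intro hc
        obtain ⟨x, hx⟩ := (mem_cycleFactorsFinset_iff.1 hc).1.nonempty_support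
        have hx' := mem_support.1 (mem_cycleFactorsFinset_support_le hc hx)
        refine ⟨f x, ⟨(hS _).1 ⟨x, rfl⟩, fun h => hx' ((hfix x).1 h)⟩, ?_⟩
        rw [cycle_is_cycleOf hx hc]
        exact ((hf _ _).1 (hp _ ((hS _).1 ⟨x, rfl⟩))).cycleOf_eq
      · rintro ⟨e, ⟨he, hw1⟩, rfl⟩
        rw [cycleOf_mem_cycleFactorsFinset_iff, mem_support]
        intro h
        exact hw1 (by rw [← (hfix (p e)).2 h, hp e he])
    rw [cycleType_def, himg, Finset.image_val_of_injOn, Multiset.map_map, Finset.filter_val]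
    · refine Multiset.map_congr rfl fun e he => ?_
      obtain ⟨he, hw1⟩ := Multiset.mem_filter.1 he
      have h3 : σ (p e) ≠ p e := fun h => hw1 (by rw [← (hfix (p e)).2 h, hp e he])
      rw [← hp e he, hw, hp e he]
      simp only [Function.comp]
      congr 1
      ext y
      rw [mem_cyc, mem_support_cycleOf_iff' h3]
    · intro e he e' he' hee
      replace he := Finset.mem_filter.1 (Finset.mem_coe.1 he)
      replace he' := Finset.mem_filter.1 (Finset.mem_coe.1 he')
      replace hee : σ.cycleOf (p e) = σ.cycleOf (p e') := hee
      have h4 : p e' ∈ (σ.cycleOf (p e)).support := by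
        rw [hee, mem_support_cycleOf_iff]
        exact ⟨SameCycle.refl _ _, mem_support.2 fun h =>
          he'.2 (by rw [← (hfix (p e')).2 h, hp e' he'.1])⟩
      rw [← hp e he.1, ← hp e' he'.1, hf]
      exact (mem_support_cycleOf_iff.1 h4).1
  · have himg : (S.filter fun e => ¬ w e ≠ 1) = (σ.supportᶜ).image f := by
      ext e
      simp only [Finset.mem_image, Finset.mem_filter, Finset.mem_compl, mem_support, not_not]
      constructor
      · rintro ⟨he, h1⟩
        exact ⟨p e, (hfix _).1 (by rw [hp e he, h1]), hp e he⟩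
      · rintro ⟨x, hx, rfl⟩
        exact ⟨(hS _).1 ⟨x, rfl⟩, (hfix x).2 hx⟩
    rw [← Finset.filter_val, Multiset.map_congr rfl (g := fun _ => 1), Multiset.map_const']
    · congr 1
      rw [← Finset.card_def, himg, Finset.card_image_of_injOn, Finset.card_compl]
      intro x hx y _ hxy
      have hx : σ x = x := by simpa using hx
      exact ((hf x y).1 hxy).eq_of_left hx
    · intro e he
      simpa using (Finset.mem_filter.1 he).2

variable {n m : ℕ}

/-- The last term of the sequence with `σ (k + 1) = η k * σ k * (τ * η k * τ)` is the product in
the definition of a factorisation. -/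
theorem prod_ofFn_eq (η : Fin m → Perm (Letters n)) (σ : ℕ → Perm (Letters n))
    (h : ∀ i : Fin m, σ (i + 1) = η i * σ i * (tau n * η i * tau n)) :
    (List.ofFn η).reverse.prod * σ 0 * (List.ofFn fun i => tau n * η i * tau n).prod = σ m := by
  induction m with
  | zero => simp
  | succ m ih =>
    have h1 := ih (fun i => η i.castSucc) fun i => by simpa using h i.castSucc
    have h2 := h (Fin.last m)
    rw [List.ofFn_succ', List.ofFn_succ', List.concat_eq_append, List.concat_eq_append,
      List.reverse_append, List.prod_append, List.prod_append]
    simp only [Fin.val_last] at h2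
    rw [h2, ← h1]
    simp [mul_assoc]

namespace WGraph

variable {Γ : WGraph} {pos : Γ.V → Fin m} {σ : ℕ → Perm (Letters n)} {a b : ℕ → Letters n}
  {f : ℕ → Letters n → Γ.E}

namespace IsLabelling

/-! ### Connectivity of the graph and transitivity of the group -/

/-- The cycles that enter a vertex at its step are joined by the transpositions of that step (or
by the permutation itself). -/
theorem same_vertex_of_mem (h : Γ.IsLabelling pos σ a b f) (hG : Γ.IsGraded pos)
    (G : Subgroup (Perm (Letters n))) (hσ : ∀ k ≤ m, σ k ∈ G)
    (hs : ∀ k < m, swap (a k) (b k) ∈ G) (hs' : ∀ k < m, swap (tau n (a k)) (tau n (b k)) ∈ G)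
    {v : Γ.V} {x y : Letters n} (hx : Γ.tgt (f (pos v) x) = some v)
    (hy : Γ.tgt (f (pos v) y) = some v) : ∃ γ ∈ G, γ x = y := by
  have hk := (pos v).2
  generalize hkv : (pos v : ℕ) = k at *
  obtain ⟨w, hw⟩ := h.step k hk
  have hst := h.state k hk.le
  have htx := h.touched_of_tgt hk hx hkv
  have hty := h.touched_of_tgt hk hy hkv
  -- `r` is the orbit relation of `G`
  let r : Letters n → Letters n → Prop := fun x y => ∃ γ ∈ G, γ x = y
  have rs : ∀ {x y}, r x y → r y x := by
    rintro x y ⟨γ, hγ, rfl⟩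
    exact ⟨γ⁻¹, G.inv_mem hγ, by simp⟩
  have rt : ∀ {x y z}, r x y → r y z → r x z := by
    rintro x y z ⟨γ, hγ, rfl⟩ ⟨δ, hδ, rfl⟩
    exact ⟨δ * γ, G.mul_mem hδ hγ, rfl⟩
  have rc : ∀ {x y}, (σ k).SameCycle x y → r x y := by
    rintro x y ⟨i, rfl⟩
    exact ⟨σ k ^ i, G.zpow_mem (hσ k hk.le) i, rfl⟩
  have rab : r (a k) (b k) := ⟨_, hs k hk, swap_apply_left _ _⟩
  have rab' : r (tau n (a k)) (tau n (b k)) := ⟨_, hs' k hk, swap_apply_left _ _⟩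
  have side : ∀ {z}, ((σ k).SameCycle z (a k) ∨ (σ k).SameCycle z (b k)) → r z (a k) :=
    fun hz => hz.elim rc fun h => rt (rc h) (rs rab)
  have side' : ∀ {z}, ((σ k).SameCycle (tau n z) (a k) ∨ (σ k).SameCycle (tau n z) (b k)) →
      r z (tau n (a k)) := fun hz => hz.elim (fun h => rc (hst.sym.sameCycle_tau_left.1 h))
        fun h => rt (rc (hst.sym.sameCycle_tau_left.1 h)) (rs rab')
  rcases (hw.tgt_eq_iff hG hst htx hty).1 (hx.trans hy.symm) with h1 | ⟨h1, h2⟩ | ⟨h1, h2⟩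
  · have h3 : r (a k) (tau n (a k)) := rt (rc h1) (rs rab')
    have : ∀ {z}, Touched (σ k) (a k) (b k) z → r z (a k) := by
      rintro z (hz | hz | hz | hz)
      · exact rc hz
      · exact rt (rc hz) (rs rab)
      · exact rt (rc hz) (rs h3)
      · exact rt (rc hz) (rs (rc h1))
    exact rt (this htx) (rs (this hty))
  · exact rt (side h1) (rs (side h2))
  · exact rt (side' h1) (rs (side' h2))

/-- An edge from `u` to `v` is a cycle that leaves `u` and enters `v`. Some point of it already
lies on a cycle that enters `u`. -/
theorem exists_common (h : Γ.IsLabelling pos σ a b f) (hG : Γ.IsGraded pos) {u v : Γ.V}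
    (huv : Γ.Arrow u v) :
    ∃ x, Γ.tgt (f (pos u) x) = some u ∧ Γ.tgt (f (pos v) x) = some v := by
  obtain ⟨e, hu, hv⟩ := huv
  obtain ⟨x, rfl⟩ := h.exists_src_some hG hu
  have ht := h.touched_of_src (pos u).2 hu rfl
  obtain ⟨w, hw⟩ := h.step _ (pos u).2
  have hlt : (pos u : ℕ) < pos v := hG.lt_of_arrow u v ⟨_, hu, hv⟩
  refine ⟨x, by rw [← hw.src_eq x ht, hu], ?_⟩
  rw [h.eq_of_alive hG (i := pos u + 1) hlt (pos v).2.le, hv]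
  refine ⟨fun w hw => ?_, fun w hw => ?_⟩
  · rw [hu] at hw; cases hw; exact hlt
  · rw [hv] at hw; cases hw; exact le_rfl

/-- Any point is moved along its edge into an inner vertex, and from there along a path of
edges to any other point. -/
theorem isPretransitive (h : Γ.IsLabelling pos σ a b f) (hG : Γ.IsGraded pos)
    (hc : ∀ u v, Relation.EqvGen Γ.Arrow u v) (hatt : ∀ e, Γ.src e ≠ none ∨ Γ.tgt e ≠ none)
    (G : Subgroup (Perm (Letters n))) (hσ : ∀ k ≤ m, σ k ∈ G)
    (hs : ∀ k < m, swap (a k) (b k) ∈ G) (hs' : ∀ k < m, swap (tau n (a k)) (tau n (b k)) ∈ G) :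
    MulAction.IsPretransitive G (Letters n) := by
  have same := fun {v x y} => h.same_vertex_of_mem hG G hσ hs hs' (v := v) (x := x) (y := y)
  have key : ∀ u v, Relation.EqvGen Γ.Arrow u v → ∀ x y, Γ.tgt (f (pos u) x) = some u →
      Γ.tgt (f (pos v) y) = some v → ∃ γ ∈ G, γ x = y := by
    intro u v huv
    induction huv with
    | rel u v huv =>
      intro x y hx hy
      obtain ⟨z, hz, hz'⟩ := h.exists_common hG huv
      obtain ⟨γ, hγ, rfl⟩ := same hx hz
      obtain ⟨δ, hδ, rfl⟩ := same hz' hy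
      exact ⟨δ * γ, G.mul_mem hδ hγ, rfl⟩
    | refl u => intro x y hx hy; exact same hx hy
    | symm u v _ ih =>
      intro x y hx hy
      obtain ⟨γ, hγ, rfl⟩ := ih y x hy hx
      exact ⟨γ⁻¹, G.inv_mem hγ, by simp⟩
    | trans u w v _ _ ih1 ih2 =>
      intro x y hx hy
      obtain ⟨z, hz, _⟩ := h.exists_step_at hG w
      obtain ⟨γ, hγ, rfl⟩ := ih1 x z hx hz
      obtain ⟨δ, hδ, rfl⟩ := ih2 _ y hz hy
      exact ⟨δ * γ, G.mul_mem hδ hγ, rfl⟩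
  have hat : ∀ x, ∃ v, Γ.tgt (f (pos v) x) = some v := by
    intro x
    have h0 := h.alive (Nat.zero_le _) x
    have h1 : Γ.src (f 0 x) = none := by
      cases hs : Γ.src (f 0 x) with
      | none => rfl
      | some u => exact absurd (h0.1 u hs) (by simp)
    obtain ⟨v, hv⟩ := Option.ne_none_iff_exists'.1 ((hatt (f 0 x)).resolve_left (by simp [h1]))
    refine ⟨v, ?_⟩
    rw [h.eq_of_alive hG (Nat.zero_le _) (pos v).2.le, hv]
    exact ⟨by simp [h1], fun w hw => by rw [hv] at hw; cases hw; exact le_rfl⟩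
  refine ⟨fun x y => ?_⟩
  obtain ⟨u, hu⟩ := hat x
  obtain ⟨v, hv⟩ := hat y
  obtain ⟨γ, hγ, hxy⟩ := key u v (hc u v) x y hu hv
  exact ⟨⟨γ, hγ⟩, hxy⟩

/-- All vertices through which a point passes are connected. -/
theorem eqvGen_of_common (h : Γ.IsLabelling pos σ a b f) (hG : Γ.IsGraded pos) {x : Letters n}
    {u v : Γ.V} (hu : Γ.tgt (f (pos u) x) = some u) (hv : Γ.tgt (f (pos v) x) = some v)
    (huv : (pos u : ℕ) ≤ pos v) : Relation.EqvGen Γ.Arrow u v := by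
  induction hd : (pos v : ℕ) - pos u using Nat.strong_induction_on generalizing u with
  | _ d ih =>
  rcases huv.eq_or_lt with heq | hlt
  · rw [heq, hv, Option.some_inj] at hu
    rw [hu]; exact Relation.EqvGen.refl _
  have ht := h.touched_of_tgt (pos u).2 hu rfl
  have htv := h.touched_of_tgt (pos v).2 hv rfl
  obtain ⟨w, hw⟩ := h.step _ (pos u).2
  have hsrc : Γ.src (f (pos u + 1) x) = some u := by rw [hw.src_eq x ht, hu]
  cases hz : Γ.tgt (f (pos u + 1) x) with
  | none =>
    refine absurd htv (h.not_touched_of_alive hG (i := pos u + 1) le_rfl ?_ _ hlt (pos v).2)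
    exact ⟨fun w _ => (pos w).2, by simp [hz]⟩
  | some z =>
    have harr : Γ.Arrow u z := ⟨_, hsrc, hz⟩
    have huz : (pos u : ℕ) < pos z := hG.lt_of_arrow u z harr
    have halive : Γ.Alive pos (pos z) (f (pos u + 1) x) := by
      refine ⟨fun w hw => ?_, fun w hw => ?_⟩
      · rw [hsrc] at hw; cases hw; exact huz
      · rw [hz] at hw; cases hw; exact le_rfl
    have hzv : (pos z : ℕ) ≤ pos v := by
      by_contra hlt'
      exact h.not_touched_of_alive hG (pos z).2.le halive _ hlt (by omega) htv
    have hzx : Γ.tgt (f (pos z) x) = some z := by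
      rw [h.eq_of_alive hG (i := pos u + 1) huz (pos z).2.le halive, hz]
    exact (Relation.EqvGen.rel _ _ harr).trans _ _ _ (ih _ (by omega) hzx hzv rfl)

/-- Every generator moves a point only inside the cycles at one vertex or along one edge, so the
points at the vertices of one connected component are invariant under the group. In particular an
edge without inner vertices would be an invariant cycle. -/
theorem connected_of_isPretransitive (h : Γ.IsLabelling pos σ a b f) (hG : Γ.IsGraded pos)
    (hm : 0 < m) (s : Set (Perm (Letters n)))
    (hs : ∀ γ ∈ s, (∃ k ≤ m, γ = σ k) ∨ (∃ k < m, γ = swap (a k) (b k)) ∨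
      ∃ k < m, γ = swap (tau n (a k)) (tau n (b k)))
    (htr : MulAction.IsPretransitive (Subgroup.closure s) (Letters n)) :
    (∀ u v, Relation.EqvGen Γ.Arrow u v) ∧ ∀ e, Γ.src e ≠ none ∨ Γ.tgt e ≠ none := by
  let At : Γ.V → Letters n → Prop := fun v x => Γ.tgt (f (pos v) x) = some v
  have hcommon : ∀ {u v x}, At u x → At v x → Relation.EqvGen Γ.Arrow u v := by
    intro u v x hu hv
    rcases le_total (pos u : ℕ) (pos v) with huv | huv
    · exact h.eqvGen_of_common hG hu hv huv
    · exact (h.eqvGen_of_common hG hv hu huv).symm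
  -- points that pass through connected vertices, or through none at all
  let r : Letters n → Letters n → Prop := fun x y => ((∀ v, ¬ At v x) ∧ ∀ v, ¬ At v y) ∨
    ∃ u v, At u x ∧ At v y ∧ Relation.EqvGen Γ.Arrow u v
  have rr : ∀ x, r x x := by
    intro x
    by_cases hx : ∃ v, At v x
    · obtain ⟨v, hv⟩ := hx
      exact Or.inr ⟨v, v, hv, hv, Relation.EqvGen.refl _⟩
    · push Not at hx
      exact Or.inl ⟨hx, hx⟩
  have rs : ∀ {x y}, r x y → r y x := by
    rintro x y (⟨h1, h2⟩ | ⟨u, v, hu, hv, huv⟩)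
    · exact Or.inl ⟨h2, h1⟩
    · exact Or.inr ⟨v, u, hv, hu, huv.symm⟩
  have rt : ∀ {x y z}, r x y → r y z → r x z := by
    rintro x y z (⟨h1, h2⟩ | ⟨u, v, hu, hv, huv⟩) (⟨h3, h4⟩ | ⟨u', v', hu', hv', huv'⟩)
    · exact Or.inl ⟨h1, h4⟩
    · exact absurd hu' (h2 _)
    · exact absurd hv (h3 _)
    · exact Or.inr ⟨u, v', hu, hv', (huv.trans _ _ _ (hcommon hv hu')).trans _ _ _ huv'⟩
  have hsame : ∀ {k} (_ : k < m) {x y}, Touched (σ k) (a k) (b k) x →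
      Γ.tgt (f k x) = Γ.tgt (f k y) → r x y := by
    intro k hk x y hx hxy
    obtain ⟨v, hv, rfl⟩ := h.exists_tgt_of_touched hG hk hx
    exact Or.inr ⟨v, v, hv, hxy.symm.trans hv, Relation.EqvGen.refl _⟩
  have hswap : ∀ k < m, ∀ x, r x (swap (a k) (b k) x) := by
    intro k hk x
    obtain ⟨v, hv⟩ := h.step k hk
    rw [swap_apply_def]
    split_ifs with h1 h2
    · rw [h1]; exact hsame hk (touched_left _ _ _) (hv.tgt_left.trans hv.tgt_right.symm)
    · rw [h2]; exact hsame hk (touched_right _ _ _) (hv.tgt_right.trans hv.tgt_left.symm)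
    · exact rr x
  have hswap' : ∀ k < m, ∀ x, r x (swap (tau n (a k)) (tau n (b k)) x) := by
    intro k hk x
    obtain ⟨v, hv⟩ := h.step k hk
    have hst := h.state k hk.le
    have h0 : Γ.tgt (f k (tau n (a k))) = Γ.tgt (f k (tau n (b k))) := by
      rw [hst.map_tau, hst.map_tau, hG.tgt_inv, hG.tgt_inv, hv.tgt_left, hv.tgt_right]
    rw [swap_apply_def]
    split_ifs with h1 h2
    · rw [h1]
      exact hsame hk (hst.sym.touched_tau.2 (touched_left _ _ _)) h0
    · rw [h2]
      exact hsame hk (hst.sym.touched_tau.2 (touched_right _ _ _)) h0.symm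
    · exact rr x
  have hat0 : ∀ {x} {v : Γ.V}, Γ.tgt (f 0 x) = some v → At v x := by
    intro x v hv
    have h0 := h.alive (Nat.zero_le _) x
    change Γ.tgt _ = _
    rw [h.eq_of_alive hG (Nat.zero_le _) (pos v).2.le, hv]
    refine ⟨fun w hw => absurd (h0.1 w hw) (by simp), fun w hw => ?_⟩
    rw [hv] at hw; cases hw; exact le_rfl
  have hno : ∀ {x}, Γ.tgt (f 0 x) = none → ∀ v, ¬ At v x := by
    intro x hx v hv
    exact h.not_touched_of_alive hG le_rfl (i := 0) ⟨fun w _ => (pos w).2, by simp [hx]⟩ _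
      (Nat.zero_le _) (pos v).2 (h.touched_of_tgt (pos v).2 hv rfl)
  have hσ : ∀ k ≤ m, ∀ x, r x (σ k x) := by
    intro k
    induction k with
    | zero =>
      intro _ x
      have h1 : f 0 (σ 0 x) = f 0 x := ((h.state 0 (Nat.zero_le _)).eq_iff _ _).2
        (sameCycle_apply_left.2 (SameCycle.refl _ _))
      cases hx : Γ.tgt (f 0 x) with
      | none => exact Or.inl ⟨hno hx, hno (by rw [h1, hx])⟩
      | some v => exact Or.inr ⟨v, v, hat0 hx, hat0 (by rw [h1, hx]), Relation.EqvGen.refl _⟩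
    | succ k ih =>
      intro hk x
      rw [h.twist_eq k hk, twist_apply]
      exact rt (rt (hswap' k hk x) (ih (by omega) _)) (hswap k hk _)
  have hall : ∀ γ ∈ Subgroup.closure s, ∀ x, r x (γ x) := by
    intro γ hγ
    induction hγ using Subgroup.closure_induction with
    | mem γ hγ =>
      rcases hs γ hγ with ⟨k, hk, rfl⟩ | ⟨k, hk, rfl⟩ | ⟨k, hk, rfl⟩
      · exact hσ k hk
      · exact hswap k hk
      · exact hswap' k hk
    | one => exact rr
    | mul γ δ _ _ h1 h2 => exact fun x => rt (h2 x) (h1 _)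
    | inv γ _ h1 => exact fun x => rs (by simpa using h1 (γ⁻¹ x))
  have htot : ∀ x y, r x y := by
    intro x y
    obtain ⟨γ, rfl⟩ := htr.exists_smul_eq x y
    exact hall γ.1 γ.2 x
  have hat : ∀ x, ∃ v, At v x := by
    intro x
    obtain ⟨v, hv⟩ := h.step 0 hm
    rcases htot x (a 0) with ⟨_, h2⟩ | ⟨u, _, hu, _⟩
    · refine absurd ?_ (h2 v)
      change Γ.tgt _ = _
      rw [hv.pos_eq]; exact hv.tgt_left
    · exact ⟨u, hu⟩
  refine ⟨fun u v => ?_, fun e => ?_⟩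
  · obtain ⟨x, hx, _⟩ := h.exists_step_at hG u
    obtain ⟨y, hy, _⟩ := h.exists_step_at hG v
    rcases htot x y with ⟨h1, _⟩ | ⟨u', v', hu', hv', huv'⟩
    · exact absurd hx (h1 u)
    · exact ((hcommon hx hu').trans _ _ _ huv').trans _ _ _ (hcommon hv' hy)
  · by_contra he
    push Not at he
    obtain ⟨x, rfl⟩ := h.exists_src_none he.1
    obtain ⟨v, hv⟩ := hat x
    exact hno he.2 v hv

end IsLabelling
end WGraph

end

/-! ### Labelled factorisations -/

section

variable {n m : ℕ}

/-- `σ 0, …, σ m` are the partial products of the twisted factorisation with start `σ₁` and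
transpositions `η`, and `η k` is the transposition `(a k, b k)`. -/
structure IsSequence (σ₁ : Perm (Letters n)) (η : Fin m → Perm (Letters n))
    (σ : ℕ → Perm (Letters n)) (a b : ℕ → Letters n) : Prop where
  zero : σ 0 = σ₁
  ne : ∀ i : Fin m, a i ≠ b i
  swap_eq : ∀ i : Fin m, η i = swap (a i) (b i)
  twist_eq : ∀ k < m, σ (k + 1) = twist (a k) (b k) (σ k)

theorem exists_isSequence [Nonempty (Letters n)] (σ₁ : Perm (Letters n))
    (η : Fin m → Perm (Letters n)) (hη : ∀ i, (η i).IsSwap) :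
    ∃ σ a b, IsSequence σ₁ η σ a b := by
  choose a b hab h using hη
  let a' : ℕ → Letters n := fun k => if hk : k < m then a ⟨k, hk⟩ else Classical.arbitrary _
  let b' : ℕ → Letters n := fun k => if hk : k < m then b ⟨k, hk⟩ else Classical.arbitrary _
  refine ⟨fun k => Nat.rec σ₁ (fun k σ => twist (a' k) (b' k) σ) k, a', b', rfl, fun i => ?_,
    fun i => ?_, fun k _ => rfl⟩
  · simpa [a', b'] using hab i
  · simpa [a', b'] using h i

theorem eq_or_eq_of_swap_eq {X : Type*} [DecidableEq X] {a b c d : X} (hab : a ≠ b)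
    (h : swap a b = swap c d) : (c = a ∧ d = b) ∨ (c = b ∧ d = a) := by
  have h1 : swap c d a = b := by rw [← h, swap_apply_left]
  have h2 : swap c d b = a := by rw [← h, swap_apply_right]
  rw [swap_apply_def] at h1 h2
  split_ifs at h1 with h3 h4
  · exact Or.inl ⟨h3.symm, h1⟩
  · exact Or.inr ⟨h1, h4.symm⟩
  · exact absurd h1 hab

namespace WGraph

/-- One step of a labelled factorisation, from the state `s` to the state `s'` by means of the
transposition `η`. -/
def IsStep (Γ : WGraph) (pos : Γ.V → Fin m) (k : ℕ) (s : Perm (Letters n) × (Letters n → Γ.E))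
    (η : Perm (Letters n)) (s' : Perm (Letters n) × (Letters n → Γ.E)) : Prop :=
  Γ.IsState pos (k + 1) s'.1 s'.2 ∧ ∃ a b, η = swap a b ∧ s'.1 = twist a b s.1 ∧
    ∃ v, Γ.IsStepAt pos k s.1 a b s.2 s'.2 v

/-- A factorisation with transpositions `η` whose cycles are labelled by the edges of `Γ`, given by
the sequence `s` of its states. -/
structure IsChain (Γ : WGraph) (pos : Γ.V → Fin m)
    (s : Fin (m + 1) → Perm (Letters n) × (Letters n → Γ.E)) (η : Fin m → Perm (Letters n)) :
    Prop where
  init : Γ.IsState pos 0 (s 0).1 (s 0).2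
  step : ∀ i : Fin m, Γ.IsStep pos i (s i.castSucc) (η i) (s i.succ)

variable {Γ : WGraph} {pos : Γ.V → Fin m} {σ : ℕ → Perm (Letters n)} {a b : ℕ → Letters n}
  {s : Fin (m + 1) → Perm (Letters n) × (Letters n → Γ.E)} {η : Fin m → Perm (Letters n)}

theorem IsStep.of_swap (hG : Γ.IsGraded pos) {k : ℕ}
    {s s' : Perm (Letters n) × (Letters n → Γ.E)} {a b : Letters n}
    (h : Γ.IsStep pos k s (swap a b) s') :
    s'.1 = twist a b s.1 ∧ ∃ v, Γ.IsStepAt pos k s.1 a b s.2 s'.2 v := by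
  obtain ⟨_, c, d, hcd, h1, v, hv⟩ := h
  rcases eq_or_eq_of_swap_eq hv.ne hcd.symm with ⟨rfl, rfl⟩ | ⟨rfl, rfl⟩
  · exact ⟨h1, v, hv⟩
  · exact ⟨by rw [h1, twist_comm], v, hv.symm hG⟩

theorem ofNat_val (i : Fin (m + 1)) : Fin.ofNat (m + 1) i = i := by
  ext; simp [Fin.ofNat, Nat.mod_eq_of_lt i.2]

theorem IsChain.state (h : Γ.IsChain pos s η) (i : Fin (m + 1)) :
    Γ.IsState pos i (s i).1 (s i).2 := by
  cases i using Fin.cases with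
  | zero => exact h.init
  | succ i => exact (h.step i).1

theorem IsChain.perm_eq (h : Γ.IsChain pos s η) (hG : Γ.IsGraded pos)
    (hq : IsSequence (s 0).1 η σ a b) (i : Fin (m + 1)) : (s i).1 = σ i := by
  induction i using Fin.induction with
  | zero => exact hq.zero.symm
  | succ i ih =>
    have h1 := h.step i
    rw [hq.swap_eq] at h1
    rw [(h1.of_swap hG).1, ih, Fin.val_succ, hq.twist_eq _ i.2]
    rfl

theorem IsChain.isLabelling (h : Γ.IsChain pos s η) (hG : Γ.IsGraded pos)
    (hq : IsSequence (s 0).1 η σ a b) :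
    Γ.IsLabelling pos σ a b fun k => (s (Fin.ofNat (m + 1) k)).2 where
  state k hk := by
    have h1 := h.state ⟨k, by omega⟩
    rw [h.perm_eq hG hq] at h1
    have h2 := ofNat_val (⟨k, by omega⟩ : Fin (m + 1))
    simp only at h1 h2
    rwa [h2]
  twist_eq := hq.twist_eq
  step k hk := by
    have h1 := h.step ⟨k, hk⟩
    rw [hq.swap_eq] at h1
    obtain ⟨v, hv⟩ := (h1.of_swap hG).2
    rw [h.perm_eq hG hq] at hv
    refine ⟨v, ?_⟩
    have h2 := ofNat_val (⟨k, hk⟩ : Fin m).castSucc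
    have h3 := ofNat_val (⟨k, hk⟩ : Fin m).succ
    simp only [Fin.val_castSucc, Fin.val_succ] at h2 h3
    rw [h2, h3]
    exact hv

theorem IsLabelling.isChain {f : ℕ → Letters n → Γ.E} (h : Γ.IsLabelling pos σ a b f)
    {σ₁ : Perm (Letters n)} (hq : IsSequence σ₁ η σ a b) :
    Γ.IsChain pos (fun i => (σ i, f i)) η where
  init := h.state 0 (Nat.zero_le _)
  step i := ⟨h.state (i + 1) i.2, a i, b i, hq.swap_eq i, hq.twist_eq i i.2, h.step i i.2⟩

theorem IsChain.map_iso {Δ : WGraph} {pos' : Δ.V → Fin m} (φ : Iso Γ Δ)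
    (hφ : ∀ v, pos' (φ.onV v) = pos v) (h : Γ.IsChain pos s η) :
    Δ.IsChain pos' (fun i => ((s i).1, φ.onE ∘ (s i).2)) η where
  init := h.init.map_iso φ hφ
  step i := by
    obtain ⟨h1, a, b, h2, h3, v, hv⟩ := h.step i
    exact ⟨h1.map_iso φ hφ, a, b, h2, h3, _, hv.map_iso φ hφ⟩

/-- Two graphs that label the same factorisation are isomorphic, by a unique isomorphism that
respects the labels. -/
theorem IsChain.exists_iso [Nonempty (Letters n)] {Δ : WGraph} {pos' : Δ.V → Fin m}
    {s' : Fin (m + 1) → Perm (Letters n) × (Letters n → Δ.E)}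
    (h : Γ.IsChain pos s η) (hG : Γ.IsGraded pos) (h' : Δ.IsChain pos' s' η)
    (hG' : Δ.IsGraded pos') (h0 : (s' 0).1 = (s 0).1) :
    ∃ φ : Iso Γ Δ, (∀ v, pos' (φ.onV v) = pos v) ∧
      s' = fun i => ((s i).1, φ.onE ∘ (s i).2) := by
  obtain ⟨σ, a, b, hq⟩ := exists_isSequence (s 0).1 η fun i => by
    obtain ⟨_, a, b, h1, _, v, hv⟩ := h.step i
    exact ⟨a, b, hv.ne, h1⟩
  have hl := h.isLabelling hG hq
  rw [← h0] at hq
  obtain ⟨φ, h1, h2⟩ := hl.exists_iso hG (h'.isLabelling hG' hq) hG'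
  refine ⟨φ, h1, funext fun i => Prod.ext ?_ (funext fun x => ?_)⟩
  · rw [h'.perm_eq hG' hq, h.perm_eq hG (h0 ▸ hq)]
  · have h3 := h2 i (Nat.le_of_lt_succ i.2) x
    rw [ofNat_val] at h3
    exact h3.symm

theorem IsChain.iso_unique [Nonempty (Letters n)] {Δ : WGraph} (h : Γ.IsChain pos s η)
    (hG : Γ.IsGraded pos) {φ ψ : Iso Γ Δ}
    (hφψ : ∀ i, φ.onE ∘ (s i).2 = ψ.onE ∘ (s i).2) : φ = ψ := by
  obtain ⟨σ, a, b, hq⟩ := exists_isSequence (s 0).1 η fun i => by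
    obtain ⟨_, a, b, h1, _, v, hv⟩ := h.step i
    exact ⟨a, b, hv.ne, h1⟩
  exact (h.isLabelling hG hq).iso_unique hG fun k _ x => congrFun (hφψ (Fin.ofNat (m + 1) k)) x

end WGraph

theorem ne_conj_iff {a b : Letters n} (hab : a ≠ b) :
    swap a b ≠ tau n * swap a b * tau n ↔ b ≠ tau n a := by
  rw [tau_swap_tau, not_iff_not]
  constructor
  · intro h
    rcases eq_or_eq_of_swap_eq hab h with ⟨h1, _⟩ | ⟨h1, _⟩
    · exact absurd h1 (tau_ne a)
    · exact h1.symm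
  · rintro rfl
    rw [tau_tau, swap_comm]

namespace MonodromyGraph

variable {g : ℕ} {μ ν : n.Partition}

theorem isGraded (M : MonodromyGraph g μ ν) : M.graph.IsGraded M.pos :=
  M.isTwisted.isGraded M.isOrder

/-- The labellings of the factorisation `t` by the graph `M`. -/
def labellings (M : MonodromyGraph g μ ν)
    (t : Perm (Letters n) × (Fin (numBranch g μ ν) → Perm (Letters n)) × Perm (Letters n)) :
    Set (Fin (numBranch g μ ν + 1) → Perm (Letters n) × (Letters n → M.graph.E)) :=
  {s | M.graph.IsChain M.pos s t.2.1 ∧ (s 0).1 = t.1 ∧ (s (Fin.last _)).1 = t.2.2}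

theorem nonempty_iso_of_labellings [Nonempty (Letters n)] {M N : MonodromyGraph g μ ν}
    {t : Perm (Letters n) × (Fin (numBranch g μ ν) → Perm (Letters n)) × Perm (Letters n)}
    (hM : (M.labellings t).Nonempty) (hN : (N.labellings t).Nonempty) : Nonempty (M.Iso N) := by
  obtain ⟨s, hs, h0, _⟩ := hM
  obtain ⟨s', hs', h0', _⟩ := hN
  obtain ⟨φ, hφ, _⟩ := hs.exists_iso M.isGraded hs' N.isGraded (h0'.trans h0.symm)
  exact ⟨φ, hφ⟩

theorem labellings_nonempty_of_iso {M N : MonodromyGraph g μ ν} (φ : M.Iso N)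
    {t : Perm (Letters n) × (Fin (numBranch g μ ν) → Perm (Letters n)) × Perm (Letters n)}
    (hM : (M.labellings t).Nonempty) : (N.labellings t).Nonempty := by
  obtain ⟨s, hs, h0, h1⟩ := hM
  exact ⟨_, hs.map_iso φ.1 φ.2, h0, h1⟩

/-- The automorphisms act simply transitively on the labellings of a given factorisation. -/
theorem card_labellings [Nonempty (Letters n)] (M : MonodromyGraph g μ ν)
    {t : Perm (Letters n) × (Fin (numBranch g μ ν) → Perm (Letters n)) × Perm (Letters n)}
    (hM : (M.labellings t).Nonempty) : Nat.card (M.labellings t) = Nat.card (M.Iso M) := by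
  obtain ⟨s, hs, h0, h1⟩ := hM
  refine (Nat.card_congr (Equiv.ofBijective
    (fun φ : M.Iso M => (⟨fun i => ((s i).1, φ.1.onE ∘ (s i).2), hs.map_iso φ.1 φ.2, h0, h1⟩ :
      M.labellings t)) ⟨fun φ ψ h => Subtype.ext (hs.iso_unique M.isGraded fun i => ?_), ?_⟩)).symm
  · exact congrArg Prod.snd (congrFun (Subtype.ext_iff.1 h) i)
  · rintro ⟨s', hs', h0', h1'⟩
    obtain ⟨φ, hφ, h2⟩ := hs.exists_iso M.isGraded hs' M.isGraded (h0'.trans h0.symm)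
    exact ⟨⟨φ, hφ⟩, Subtype.ext h2.symm⟩

/-- The ends of the graph give the cycle types of `σ₁` and `σ₂`, its connectedness gives
transitivity. -/
theorem mem_factorizations_of_isChain [Nonempty (Letters n)] (M : MonodromyGraph g μ ν)
    {s : Fin (numBranch g μ ν + 1) → Perm (Letters n) × (Letters n → M.graph.E)}
    {η : Fin (numBranch g μ ν) → Perm (Letters n)} (h : M.graph.IsChain M.pos s η) :
    ((s 0).1, η, (s (Fin.last _)).1) ∈ factorizations g μ ν := by
  classical
  obtain ⟨σ, a, b, hq⟩ := exists_isSequence (s 0).1 η fun i => by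
    obtain ⟨_, a, b, h1, _, v, hv⟩ := h.step i
    exact ⟨a, b, hv.ne, h1⟩
  have hG := M.isGraded
  have hl := h.isLabelling hG hq
  have hσ := h.perm_eq hG hq
  obtain ⟨v₀⟩ := M.isTwisted.nonempty
  have hb : 0 < numBranch g μ ν := (Nat.zero_le _).trans_lt (M.pos v₀).2
  have hstep : ∀ i : Fin (numBranch g μ ν), b i ≠ tau n (a i) := fun i => by
    obtain ⟨v, hv⟩ := hl.step i i.2
    exact hv.ne_tau
  have hs0 := h.init
  have hsb := h.state (Fin.last _)
  have hprod : ∀ i : Fin (numBranch g μ ν), σ (i + 1) = η i * σ i * (tau n * η i * tau n) := by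
    intro i
    rw [hq.twist_eq i i.2, hq.swap_eq, tau_swap_tau]
    rfl
  have hleft : HasDoubledCycleType (s 0).1 μ := by
    unfold HasDoubledCycleType
    rw [← M.isTwisted.inward]
    refine partition_parts_eq _ _ (s 0).2 _ hs0.eq_iff (fun e => ?_) hs0.weight_eq
    rw [hs0.alive_iff]
    simp only [WGraph.Alive, WGraph.inwardEnds, Finset.mem_filter, Finset.mem_univ, true_and,
      Nat.not_lt_zero, zero_le, implies_true, and_true, imp_false]
    exact ⟨fun h => Option.eq_none_iff_forall_ne_some.2 h, fun h v hv => by simp [h] at hv⟩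
  have hright : HasDoubledCycleType (s (Fin.last _)).1 ν := by
    unfold HasDoubledCycleType
    rw [← M.isTwisted.outward]
    refine partition_parts_eq _ _ (s (Fin.last _)).2 _ hsb.eq_iff (fun e => ?_) hsb.weight_eq
    rw [hsb.alive_iff]
    simp only [WGraph.Alive, WGraph.outwardEnds, Finset.mem_filter, Finset.mem_univ, true_and,
      Fin.val_last, Fin.is_lt, implies_true]
    refine ⟨fun h => Option.eq_none_iff_forall_ne_some.2 fun v hv => ?_,
      fun h v hv => by simp [h] at hv⟩
    have := h v hv
    have := (M.pos v).2
    omega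
  refine ⟨hb, hleft, hright, fun i => ⟨a i, b i, hq.ne i, hq.swap_eq i⟩, fun i => ?_,
    ⟨mem_BTilde_iff.2 hs0.sym, hleft⟩, ?_, ?_⟩
  · change η i ≠ tau n * η i * tau n
    rw [hq.swap_eq, ne_conj_iff (hq.ne i)]
    exact hstep i
  · have := prod_ofFn_eq η σ hprod
    rw [hq.zero] at this
    exact this.trans (hσ (Fin.last _)).symm
  · have hswap : ∀ k < numBranch g μ ν, swap (a k) (b k) ∈ Subgroup.closure
        ({(s 0).1, (s (Fin.last _)).1} ∪ Set.range η ∪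
          Set.range fun i => tau n * η i * tau n) := fun k hk =>
      Subgroup.subset_closure (Or.inl (Or.inr ⟨⟨k, hk⟩, hq.swap_eq ⟨k, hk⟩⟩))
    have hswap' : ∀ k < numBranch g μ ν, swap (tau n (a k)) (tau n (b k)) ∈ Subgroup.closure
        ({(s 0).1, (s (Fin.last _)).1} ∪ Set.range η ∪
          Set.range fun i => tau n * η i * tau n) := fun k hk => by
      refine Subgroup.subset_closure (Or.inr ⟨⟨k, hk⟩, ?_⟩)
      simp only [hq.swap_eq, tau_swap_tau]
    refine hl.isPretransitive hG M.isTwisted.connected M.isTwisted.attached _ (fun k => ?_)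
      hswap hswap'
    induction k with
    | zero => exact fun _ => hq.zero ▸ Subgroup.subset_closure (Or.inl (Or.inl (Or.inl rfl)))
    | succ k ih =>
      intro hk
      rw [hq.twist_eq k hk]
      exact Subgroup.mul_mem _ (Subgroup.mul_mem _ (hswap k hk) (ih (by omega))) (hswap' k hk)

end MonodromyGraph

end

/-! ### The graph of a factorisation -/

section

variable {n : ℕ}

namespace Trace

variable (σ : ℕ → Perm (Letters n)) (a b : ℕ → Letters n)

/-- The cycle through `x` after `k` steps, with the time at which it came into being. These pairs
are the edges of the graph of the factorisation. -/
def birth : ℕ → Letters n → ℕ × Finset (Letters n)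
  | 0, x => (0, cyc (σ 0) x)
  | k + 1, x => open Classical in
    if Touched (σ k) (a k) (b k) x then (k + 1, cyc (σ (k + 1)) x) else birth k x

/-- The affected cycles of `x` and `z` enter the same vertex at step `k`. If the step is a crossing,
there is one vertex for all of them. Otherwise the cycles of `a k` and `b k` enter one vertex, and
their mirror images enter another one. -/
def SameVertex (k : ℕ) (x z : Letters n) : Prop :=
  (σ k).SameCycle (a k) (tau n (b k)) ∨
    (((σ k).SameCycle x (a k) ∨ (σ k).SameCycle x (b k)) ∧
      ((σ k).SameCycle z (a k) ∨ (σ k).SameCycle z (b k))) ∨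
    (((σ k).SameCycle (tau n x) (a k) ∨ (σ k).SameCycle (tau n x) (b k)) ∧
      ((σ k).SameCycle (tau n z) (a k) ∨ (σ k).SameCycle (tau n z) (b k)))

open Classical in
/-- The points whose cycles enter, at step `k`, the same vertex as the cycle of `x`. -/
def block (k : ℕ) (x : Letters n) : Finset (Letters n) :=
  Finset.univ.filter fun z => Touched (σ k) (a k) (b k) z ∧ SameVertex σ a b k x z

/-- The hypotheses on the partial products `σ 0, …, σ m` of a factorisation. -/
structure Valid (m : ℕ) : Prop where
  sym : ∀ k ≤ m, IsSym (σ k)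
  ne : ∀ k < m, a k ≠ b k
  ne_tau : ∀ k < m, b k ≠ tau n (a k)
  twist_eq : ∀ k < m, σ (k + 1) = twist (a k) (b k) (σ k)

variable {σ a b} {m : ℕ}

theorem birth_succ_of_touched {k : ℕ} {x : Letters n} (hx : Touched (σ k) (a k) (b k) x) :
    birth σ a b (k + 1) x = (k + 1, cyc (σ (k + 1)) x) := by
  rw [birth, if_pos hx]

theorem birth_succ_of_not {k : ℕ} {x : Letters n} (hx : ¬ Touched (σ k) (a k) (b k) x) :
    birth σ a b (k + 1) x = birth σ a b k x := by
  rw [birth, if_neg hx]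

theorem birth_fst_le (k : ℕ) (x : Letters n) : (birth σ a b k x).1 ≤ k := by
  induction k with
  | zero => exact le_rfl
  | succ k ih =>
    by_cases hx : Touched (σ k) (a k) (b k) x
    · rw [birth_succ_of_touched hx]
    · rw [birth_succ_of_not hx]; omega

theorem birth_snd (h : Valid σ a b m) {k : ℕ} (hk : k ≤ m) (x : Letters n) :
    (birth σ a b k x).2 = cyc (σ k) x := by
  induction k with
  | zero => rfl
  | succ k ih =>
    by_cases hx : Touched (σ k) (a k) (b k) x
    · rw [birth_succ_of_touched hx]
    · rw [birth_succ_of_not hx, ih (by omega)]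
      ext z
      rw [mem_cyc, mem_cyc, h.twist_eq k hk, sameCycle_twist_of_not_touched hx]

theorem birth_eq_of_sameCycle (h : Valid σ a b m) {k : ℕ} (hk : k ≤ m) {x y : Letters n}
    (hxy : (σ k).SameCycle x y) : birth σ a b k x = birth σ a b k y := by
  induction k with
  | zero => rw [birth, birth, cyc_eq_iff.2 hxy]
  | succ k ih =>
    have h1 : Touched (σ k) (a k) (b k) x ↔ Touched (σ k) (a k) (b k) y := by
      rw [h.twist_eq k hk] at hxy
      rw [← touched_twist, ← touched_twist (x := y)]
      exact ⟨fun h => h.of_sameCycle hxy.symm, fun h => h.of_sameCycle hxy⟩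
    by_cases hx : Touched (σ k) (a k) (b k) x
    · rw [birth_succ_of_touched hx, birth_succ_of_touched (h1.1 hx), cyc_eq_iff.2 hxy]
    · rw [birth_succ_of_not hx, birth_succ_of_not (mt h1.2 hx)]
      rw [h.twist_eq k hk, sameCycle_twist_of_not_touched hx] at hxy
      exact ih (by omega) hxy

theorem birth_eq_iff (h : Valid σ a b m) {k : ℕ} (hk : k ≤ m) {x y : Letters n} :
    birth σ a b k x = birth σ a b k y ↔ (σ k).SameCycle x y := by
  refine ⟨fun hxy => ?_, birth_eq_of_sameCycle h hk⟩
  rw [← cyc_eq_iff, ← birth_snd h hk, hxy, birth_snd h hk]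

theorem birth_tau (h : Valid σ a b m) {k : ℕ} (hk : k ≤ m) (x : Letters n) :
    birth σ a b k (tau n x) =
      ((birth σ a b k x).1, (birth σ a b k x).2.map (tau n).toEmbedding) := by
  induction k with
  | zero => rw [birth, birth, (h.sym 0 hk).cyc_tau]
  | succ k ih =>
    by_cases hx : Touched (σ k) (a k) (b k) x
    · rw [birth_succ_of_touched hx,
        birth_succ_of_touched ((h.sym k (by omega)).touched_tau.2 hx), (h.sym _ hk).cyc_tau]
    · rw [birth_succ_of_not hx,
        birth_succ_of_not (mt (h.sym k (by omega)).touched_tau.1 hx), ih (by omega)]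

theorem birth_eq_of_fst_le {i j : ℕ} {x : Letters n} (hij : i ≤ j)
    (hx : (birth σ a b j x).1 ≤ i) :
    birth σ a b j x = birth σ a b i x ∧
      ∀ k, i ≤ k → k < j → ¬ Touched (σ k) (a k) (b k) x := by
  induction j, hij using Nat.le_induction with
  | base => exact ⟨rfl, fun k h1 h2 => by omega⟩
  | succ j hij ih =>
    by_cases ht : Touched (σ j) (a j) (b j) x
    · rw [birth_succ_of_touched ht] at hx
      simp only at hx
      omega
    · rw [birth_succ_of_not ht] at hx ⊢
      obtain ⟨h1, h2⟩ := ih hx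
      refine ⟨h1, fun k hk hkj => ?_⟩
      rcases (Nat.lt_succ_iff.1 hkj).eq_or_lt with rfl | hlt
      · exact ht
      · exact h2 k hk hlt

theorem birth_eq_of_not_touched {i j : ℕ} {x : Letters n} (hij : i ≤ j)
    (hx : ∀ k, i ≤ k → k < j → ¬ Touched (σ k) (a k) (b k) x) :
    birth σ a b j x = birth σ a b i x := by
  induction j, hij using Nat.le_induction with
  | base => rfl
  | succ j hij ih =>
    rw [birth_succ_of_not (hx j hij (by omega))]
    exact ih fun k h1 h2 => hx k h1 (by omega)

/-- A cycle that exists at two times has not been affected in between. -/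
theorem not_touched_of_birth_eq (h : Valid σ a b m) {i j : ℕ} (hij : i ≤ j) (hj : j ≤ m)
    {x y : Letters n} (hxy : birth σ a b i x = birth σ a b j y) :
    ∀ k, i ≤ k → k < j → ¬ Touched (σ k) (a k) (b k) x := by
  have h1 : (birth σ a b j y).1 ≤ i := hxy ▸ birth_fst_le i x
  obtain ⟨h2, h3⟩ := birth_eq_of_fst_le hij h1
  rw [h2, birth_eq_iff h (by omega)] at hxy
  have key : ∀ k, i ≤ k → k ≤ j → (σ k).SameCycle x y := by
    intro k hik
    induction k, hik using Nat.le_induction with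
    | base => exact fun _ => hxy
    | succ k hik ih =>
      intro hk
      have h4 := ih (by omega)
      rw [h.twist_eq k (by omega), sameCycle_twist_of_not_touched]
      · exact h4
      · exact fun h5 => h3 k hik hk (h5.of_sameCycle h4.symm)
  exact fun k hik hkj ht => h3 k hik hkj (ht.of_sameCycle (key k hik hkj.le).symm)

theorem exists_birth (k : ℕ) (x : Letters n) : (birth σ a b k x).1 = 0 ∨ ∃ i < k,
    (birth σ a b k x).1 = i + 1 ∧ Touched (σ i) (a i) (b i) x ∧
      birth σ a b (i + 1) x = birth σ a b k x := by
  induction k with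
  | zero => exact Or.inl rfl
  | succ k ih =>
    by_cases hx : Touched (σ k) (a k) (b k) x
    · rw [birth_succ_of_touched hx]
      exact Or.inr ⟨k, by omega, rfl, hx, birth_succ_of_touched hx⟩
    · rw [birth_succ_of_not hx]
      refine ih.imp id ?_
      rintro ⟨i, hi, h1⟩
      exact ⟨i, by omega, h1⟩

theorem side_or_side (h : Valid σ a b m) {k : ℕ} (hk : k < m) {x : Letters n}
    (hx : Touched (σ k) (a k) (b k) x) :
    ((σ k).SameCycle x (a k) ∨ (σ k).SameCycle x (b k)) ∨
      ((σ k).SameCycle (tau n x) (a k) ∨ (σ k).SameCycle (tau n x) (b k)) := by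
  have hs := h.sym k hk.le
  rw [hs.sameCycle_tau_left, hs.sameCycle_tau_left]
  unfold Touched at hx
  tauto

theorem crossing_of_both_sides (h : Valid σ a b m) {k : ℕ} (hk : k < m) {x : Letters n}
    (hx : (σ k).SameCycle x (a k) ∨ (σ k).SameCycle x (b k))
    (hx' : (σ k).SameCycle (tau n x) (a k) ∨ (σ k).SameCycle (tau n x) (b k)) :
    (σ k).SameCycle (a k) (tau n (b k)) := by
  have hs := h.sym k hk.le
  rw [hs.sameCycle_tau_left, hs.sameCycle_tau_left] at hx'
  rcases hx with hx | hx <;> rcases hx' with hx' | hx'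
  · exact absurd (hx.symm.trans hx') (hs.not_sameCycle _)
  · exact hx.symm.trans hx'
  · exact hs.sameCycle_tau_left.1 (hx'.symm.trans hx)
  · exact absurd (hx.symm.trans hx') (hs.not_sameCycle _)

theorem SameVertex.refl (h : Valid σ a b m) {k : ℕ} (hk : k < m) {x : Letters n}
    (hx : Touched (σ k) (a k) (b k) x) : SameVertex σ a b k x x :=
  (side_or_side h hk hx).elim (fun h => Or.inr (Or.inl ⟨h, h⟩))
    fun h => Or.inr (Or.inr ⟨h, h⟩)

theorem SameVertex.symm {k : ℕ} {x y : Letters n} (hxy : SameVertex σ a b k x y) :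
    SameVertex σ a b k y x := hxy.imp id (Or.imp And.symm And.symm)

theorem SameVertex.trans (h : Valid σ a b m) {k : ℕ} (hk : k < m) {x y z : Letters n}
    (hxy : SameVertex σ a b k x y) (hyz : SameVertex σ a b k y z) : SameVertex σ a b k x z := by
  rcases hxy with hxy | hxy | hxy <;> rcases hyz with hyz | hyz | hyz
  · exact Or.inl hxy
  · exact Or.inl hxy
  · exact Or.inl hxy
  · exact Or.inl hyz
  · exact Or.inr (Or.inl ⟨hxy.1, hyz.2⟩)
  · exact Or.inl (crossing_of_both_sides h hk hxy.2 hyz.1)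
  · exact Or.inl hyz
  · exact Or.inl (crossing_of_both_sides h hk hyz.1 hxy.2)
  · exact Or.inr (Or.inr ⟨hxy.1, hyz.2⟩)

theorem SameVertex.tau {k : ℕ} {x y : Letters n} :
    SameVertex σ a b k (tau n x) (tau n y) ↔ SameVertex σ a b k x y := by
  unfold SameVertex
  rw [tau_tau, tau_tau]
  tauto

theorem mem_block {k : ℕ} {x z : Letters n} : z ∈ block σ a b k x ↔
    Touched (σ k) (a k) (b k) z ∧ SameVertex σ a b k x z := by
  simp [block]

theorem block_eq_iff (h : Valid σ a b m) {k : ℕ} (hk : k < m) {x y : Letters n}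
    (hy : Touched (σ k) (a k) (b k) y) :
    block σ a b k x = block σ a b k y ↔ SameVertex σ a b k x y := by
  constructor
  · intro hxy
    have : y ∈ block σ a b k y := mem_block.2 ⟨hy, SameVertex.refl h hk hy⟩
    rw [← hxy, mem_block] at this
    exact this.2
  · intro hxy
    ext z
    rw [mem_block, mem_block]
    exact and_congr_right fun _ => ⟨fun h1 => SameVertex.trans h hk hxy.symm h1,
      fun h1 => SameVertex.trans h hk hxy h1⟩

theorem block_tau (h : Valid σ a b m) {k : ℕ} (hk : k < m) (x : Letters n) :
    block σ a b k (tau n x) = (block σ a b k x).map (tau n).toEmbedding := by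
  ext z
  rw [Finset.mem_map_equiv, mem_block, mem_block]
  change _ ↔ Touched _ _ _ (tau n z) ∧ SameVertex _ _ _ _ _ (tau n z)
  rw [(h.sym k hk.le).touched_tau, ← SameVertex.tau, tau_tau]

theorem block_eq_of_sameCycle (h : Valid σ a b m) {k : ℕ} (hk : k < m) {x y : Letters n}
    (hx : Touched (σ k) (a k) (b k) x)
    (hxy : (σ k).SameCycle x y) : block σ a b k x = block σ a b k y := by
  have hy := hx.of_sameCycle hxy.symm
  rw [block_eq_iff h hk hy]
  rcases side_or_side h hk hx with h1 | h1
  · exact Or.inr (Or.inl ⟨h1, h1.imp hxy.symm.trans hxy.symm.trans⟩)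
  · have hxy' := (h.sym k hk.le).sameCycle_tau.2 hxy
    exact Or.inr (Or.inr ⟨h1, h1.imp hxy'.symm.trans hxy'.symm.trans⟩)

/-- The cycle that contains `x` after step `k` leaves one vertex only: the points on it lie on
cycles which entered the same vertex. -/
theorem block_eq_of_sameCycle_succ (h : Valid σ a b m) {k : ℕ} (hk : k < m) {x y : Letters n}
    (hx : Touched (σ k) (a k) (b k) x)
    (hxy : (σ (k + 1)).SameCycle x y) : block σ a b k x = block σ a b k y := by
  have hs := h.sym k hk.le
  have hs' := h.sym (k + 1) hk
  have hxy' := hs'.sameCycle_tau.2 hxy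
  rw [h.twist_eq k hk] at hxy hxy' hs'
  have hy : Touched (σ k) (a k) (b k) y :=
    touched_twist.1 ((touched_twist.2 hx).of_sameCycle hxy.symm)
  rw [block_eq_iff h hk hy]
  by_cases hc : (σ k).SameCycle (a k) (tau n (b k))
  · exact Or.inl hc
  have key : ∀ {x y}, (twist (a k) (b k) (σ k)).SameCycle x y →
      ((σ k).SameCycle x (a k) ∨ (σ k).SameCycle x (b k)) →
      ((σ k).SameCycle y (a k) ∨ (σ k).SameCycle y (b k)) := by
    intro x y hxy
    rw [← sameCycle_or_twist hs (h.ne k hk) hc, ← sameCycle_or_twist hs (h.ne k hk) hc]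
    exact Or.imp hxy.symm.trans hxy.symm.trans
  rcases side_or_side h hk hx with h1 | h1
  · exact Or.inr (Or.inl ⟨h1, key hxy h1⟩)
  · exact Or.inr (Or.inr ⟨h1, key hxy' h1⟩)

end Trace

open Trace

open Classical in
/-- The element with property `P`, if there is one. -/
def theOption {α : Type*} (P : α → Prop) : Option α := if h : ∃ v, P v then some h.choose else none

theorem theOption_eq_some {α : Type*} {P : α → Prop} (hP : ∀ v w, P v → P w → v = w) {v : α} :
    theOption P = some v ↔ P v := by
  unfold theOption
  split_ifs with h1
  · rw [Option.some_inj]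
    exact ⟨fun h2 => h2 ▸ h1.choose_spec, fun h2 => hP _ _ h1.choose_spec h2⟩
  · simp only [false_iff]
    exact fun h2 => h1 ⟨v, h2⟩

section Graph

variable (σ : ℕ → Perm (Letters n)) (a b : ℕ → Letters n) (m : ℕ)

/-- The edges of the graph of a factorisation: cycles with their times of birth. -/
abbrev TraceEdge : Type := {p : ℕ × Finset (Letters n) // ∃ k ≤ m, ∃ x, birth σ a b k x = p}

/-- The vertices of the graph of a factorisation: the blocks of affected points of each step. -/
abbrev TraceVertex : Type := {p : ℕ × Finset (Letters n) // ∃ k < m, ∃ x,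
  Touched (σ k) (a k) (b k) x ∧ (k, block σ a b k x) = p}

instance : Finite (TraceEdge σ a b m) := by
  refine Finite.of_surjective (fun q : Fin (m + 1) × Letters n =>
    (⟨birth σ a b q.1 q.2, q.1, Nat.lt_succ_iff.1 q.1.2, q.2, rfl⟩ : TraceEdge σ a b m)) ?_
  rintro ⟨p, k, hk, x, rfl⟩
  exact ⟨(⟨k, by omega⟩, x), rfl⟩

instance : Finite (TraceVertex σ a b m) := by
  refine Finite.of_injective (fun q : TraceVertex σ a b m =>
    ((⟨q.1.1, by obtain ⟨p, k, hk, x, _, rfl⟩ := q; exact hk⟩, q.1.2) :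
      Fin m × Finset (Letters n))) ?_
  rintro ⟨p, hp⟩ ⟨q, hq⟩ h
  simp only [Prod.mk.injEq, Fin.mk.injEq] at h
  exact Subtype.ext (Prod.ext h.1 h.2)

variable {σ a b m}

/-- The vertex that the cycle of `x` enters at step `k`. -/
def traceVertex {k : ℕ} (hk : k < m) {x : Letters n} (hx : Touched (σ k) (a k) (b k) x) :
    TraceVertex σ a b m := ⟨(k, block σ a b k x), k, hk, x, hx, rfl⟩

variable (m) in
/-- The edge to which the cycle of `x` after `k` steps belongs. (Only `k ≤ m` matters; beyond that
the value is the one at `m`.) -/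
def traceEdge (k : ℕ) (x : Letters n) : TraceEdge σ a b m :=
  ⟨birth σ a b (min k m) x, min k m, min_le_right _ _, x, rfl⟩

/-- The graph of a factorisation. Its edges are the maximal periods of time in which a cycle is not
affected, its vertices are the sets of points on the cycles that meet at one step, and the involution
is induced by `τ`. -/
def traceGraph (h : Valid σ a b m) : WGraph where
  V := TraceVertex σ a b m
  E := TraceEdge σ a b m
  fintypeV := Fintype.ofFinite _
  fintypeE := Fintype.ofFinite _
  src e := theOption fun v : TraceVertex σ a b m => ∃ k, ∃ hk : k < m, ∃ x, ∃ hx,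
    v = traceVertex hk (x := x) hx ∧ birth σ a b (k + 1) x = e.1
  tgt e := theOption fun v : TraceVertex σ a b m => ∃ k, ∃ hk : k < m, ∃ x, ∃ hx,
    v = traceVertex hk (x := x) hx ∧ birth σ a b k x = e.1
  weight e := e.1.2.card
  invV v := ⟨(v.1.1, v.1.2.map (tau n).toEmbedding), by
    obtain ⟨p, k, hk, x, hx, rfl⟩ := v
    exact ⟨k, hk, tau n x, (h.sym k hk.le).touched_tau.2 hx, by rw [block_tau h hk]⟩⟩
  invE e := ⟨(e.1.1, e.1.2.map (tau n).toEmbedding), by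
    obtain ⟨p, k, hk, x, rfl⟩ := e
    exact ⟨k, hk, tau n x, birth_tau h hk x⟩⟩

/-- The step at which a vertex of the graph of a factorisation is passed. -/
def tracePos (h : Valid σ a b m) (v : (traceGraph h).V) : Fin m :=
  ⟨v.1.1, by obtain ⟨p, k, hk, x, _, rfl⟩ := v; exact hk⟩

variable (h : Valid σ a b m)

theorem traceVertex_eq_iff {k j : ℕ} (hk : k < m) (hj : j < m) {x y : Letters n}
    (hx : Touched (σ k) (a k) (b k) x) (hy : Touched (σ j) (a j) (b j) y) :
    traceVertex hk hx = traceVertex hj hy ↔ k = j ∧ block σ a b k x = block σ a b j y := by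
  rw [traceVertex, traceVertex, Subtype.mk.injEq, Prod.mk.injEq]

theorem trace_src_eq_some {e : (traceGraph h).E} {v : (traceGraph h).V} :
    (traceGraph h).src e = some v ↔ ∃ k, ∃ hk : k < m, ∃ x, ∃ hx,
      v = traceVertex hk (x := x) hx ∧ birth σ a b (k + 1) x = e.1 := by
  have huniq : ∀ {v w : TraceVertex σ a b m}, (∃ k, ∃ hk : k < m, ∃ x, ∃ hx,
      v = traceVertex hk (x := x) hx ∧ birth σ a b (k + 1) x = e.1) →
      (∃ k, ∃ hk : k < m, ∃ x, ∃ hx,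
      w = traceVertex hk (x := x) hx ∧ birth σ a b (k + 1) x = e.1) → v = w := by
    rintro _ _ ⟨k, hk, x, hx, rfl, h1⟩ ⟨j, hj, y, hy, rfl, h2⟩
    rw [← h1, birth_succ_of_touched hx, birth_succ_of_touched hy, Prod.mk.injEq] at h2
    obtain rfl : j = k := by omega
    rw [traceVertex_eq_iff]
    exact ⟨rfl, block_eq_of_sameCycle_succ h hk hx (cyc_eq_iff.1 h2.2.symm)⟩
  exact theOption_eq_some fun v w => huniq

theorem trace_tgt_eq_some {e : (traceGraph h).E} {v : (traceGraph h).V} :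
    (traceGraph h).tgt e = some v ↔ ∃ k, ∃ hk : k < m, ∃ x, ∃ hx,
      v = traceVertex hk (x := x) hx ∧ birth σ a b k x = e.1 := by
  have huniq : ∀ {v w : TraceVertex σ a b m}, (∃ k, ∃ hk : k < m, ∃ x, ∃ hx,
      v = traceVertex hk (x := x) hx ∧ birth σ a b k x = e.1) →
      (∃ k, ∃ hk : k < m, ∃ x, ∃ hx,
      w = traceVertex hk (x := x) hx ∧ birth σ a b k x = e.1) → v = w := by
    rintro _ _ ⟨k, hk, x, hx, rfl, h1⟩ ⟨j, hj, y, hy, rfl, h2⟩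
    rw [← h2] at h1
    obtain rfl : k = j := by
      rcases lt_trichotomy k j with hlt | heq | hlt
      · exact absurd hx (not_touched_of_birth_eq h hlt.le hj.le h1 k le_rfl hlt)
      · exact heq
      · exact absurd hy (not_touched_of_birth_eq h hlt.le hk.le h1.symm j le_rfl hlt)
    rw [birth_eq_iff h hk.le] at h1
    rw [traceVertex_eq_iff]
    exact ⟨rfl, block_eq_of_sameCycle h hk hx h1⟩
  exact theOption_eq_some fun v w => huniq

theorem trace_invV {k : ℕ} (hk : k < m) {x : Letters n} (hx : Touched (σ k) (a k) (b k) x) :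
    (traceGraph h).invV (traceVertex hk hx) =
      traceVertex hk ((h.sym k hk.le).touched_tau.2 hx) :=
  Subtype.ext (Prod.ext rfl (block_tau h hk x).symm)

theorem trace_invE (k : ℕ) (x : Letters n) :
    (traceGraph h).invE (traceEdge m k x) = traceEdge m k (tau n x) :=
  Subtype.ext (birth_tau h (min_le_right _ _) x).symm

theorem exists_traceEdge (e : TraceEdge σ a b m) : ∃ k ≤ m, ∃ x, e = traceEdge m k x := by
  obtain ⟨p, k, hk, x, rfl⟩ := e
  refine ⟨k, hk, x, Subtype.ext ?_⟩
  simp only [traceEdge, min_eq_left hk]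

theorem traceEdge_val {k : ℕ} (hk : k ≤ m) (x : Letters n) :
    (traceEdge m k x : TraceEdge σ a b m).1 = birth σ a b k x := by
  simp only [traceEdge, min_eq_left hk]

theorem map_tau_map_tau (S : Finset (Letters n)) :
    (S.map (tau n).toEmbedding).map (tau n).toEmbedding = S := by
  ext x
  simp [Finset.mem_map_equiv, tau]

theorem trace_invV_invV (v : (traceGraph h).V) :
    (traceGraph h).invV ((traceGraph h).invV v) = v :=
  Subtype.ext (Prod.ext rfl (map_tau_map_tau _))

theorem trace_invE_invE (e : (traceGraph h).E) :
    (traceGraph h).invE ((traceGraph h).invE e) = e :=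
  Subtype.ext (Prod.ext rfl (map_tau_map_tau _))

theorem trace_birth_inv {k : ℕ} (hk : k ≤ m) {x : Letters n} {e : TraceEdge σ a b m}
    (hx : birth σ a b k x = e.1) :
    birth σ a b k (tau n x) = ((traceGraph h).invE e).1 := by
  rw [birth_tau h hk, hx]; rfl

theorem map_inv_eq_some {Γ : WGraph} (hinv : ∀ v, Γ.invV (Γ.invV v) = v) {o : Option Γ.V}
    {v : Γ.V} : o.map Γ.invV = some v ↔ o = some (Γ.invV v) := by
  cases o with
  | none => simp
  | some u =>
    simp only [Option.map_some, Option.some_inj]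
    exact ⟨fun h => by rw [← h, hinv], fun h => by rw [h, hinv]⟩

/-- The vertices that belong to one step form an orbit of the involution: one vertex for
a crossing, and two for a cut or a join. -/
theorem trace_isGraded : (traceGraph h).IsGraded (tracePos h) where
  invV_invV := trace_invV_invV h
  invE_invE := trace_invE_invE h
  src_inv e := by
    have key : ∀ {e v}, (traceGraph h).src e = some v →
        (traceGraph h).src ((traceGraph h).invE e) = some ((traceGraph h).invV v) := by
      intro e v hv
      obtain ⟨k, hk, x, hx, rfl, h1⟩ := (trace_src_eq_some h).1 hv
      exact (trace_src_eq_some h).2 ⟨k, hk, tau n x, _, trace_invV h hk hx, trace_birth_inv h hk h1⟩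
    refine Option.ext fun v => ?_
    rw [map_inv_eq_some (trace_invV_invV h)]
    refine ⟨fun h1 => ?_, fun h1 => ?_⟩
    · rw [← trace_invE_invE h e]; exact key h1
    · rw [← trace_invV_invV h v]; exact key h1
  tgt_inv e := by
    have key : ∀ {e v}, (traceGraph h).tgt e = some v →
        (traceGraph h).tgt ((traceGraph h).invE e) = some ((traceGraph h).invV v) := by
      intro e v hv
      obtain ⟨k, hk, x, hx, rfl, h1⟩ := (trace_tgt_eq_some h).1 hv
      exact (trace_tgt_eq_some h).2 ⟨k, hk, tau n x, _, trace_invV h hk hx, trace_birth_inv h hk.le h1⟩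
    refine Option.ext fun v => ?_
    rw [map_inv_eq_some (trace_invV_invV h)]
    refine ⟨fun h1 => ?_, fun h1 => ?_⟩
    · rw [← trace_invE_invE h e]; exact key h1
    · rw [← trace_invV_invV h v]; exact key h1
  eq_iff u v := by
    obtain ⟨_, k, hk, x, hx, rfl⟩ := u
    obtain ⟨_, j, hj, y, hy, rfl⟩ := v
    change tracePos h (traceVertex hk hx) = tracePos h (traceVertex hj hy) ↔
      traceVertex hj hy = traceVertex hk hx ∨
        traceVertex hj hy = (traceGraph h).invV (traceVertex hk hx)
    rw [trace_invV, traceVertex_eq_iff, traceVertex_eq_iff]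
    constructor
    · intro h1
      obtain rfl : k = j := congrArg Fin.val h1
      rw [block_eq_iff h hk hx, block_eq_iff h hk ((h.sym k hk.le).touched_tau.2 hx)]
      unfold SameVertex
      have h2 := side_or_side h hk hx
      have h3 := side_or_side h hk hy
      rw [tau_tau]
      tauto
    · rintro (⟨rfl, _⟩ | ⟨rfl, _⟩) <;> rfl
  lt_of_arrow u v := by
    rintro ⟨e, hu, hv⟩
    obtain ⟨k, hk, x, hx, rfl, h1⟩ := (trace_src_eq_some h).1 hu
    obtain ⟨j, hj, y, hy, rfl, h2⟩ := (trace_tgt_eq_some h).1 hv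
    have h3 := birth_fst_le (σ := σ) (a := a) (b := b) j y
    rw [h2, ← h1, birth_succ_of_touched hx] at h3
    exact h3

theorem trace_alive_iff {k : ℕ} (hk : k ≤ m) (e : (traceGraph h).E) :
    (∃ x, traceEdge m k x = e) ↔ (traceGraph h).Alive (tracePos h) k e := by
  constructor
  · rintro ⟨x, rfl⟩
    refine ⟨fun v hv => ?_, fun v hv => ?_⟩
    · obtain ⟨i, hi, y, hy, rfl, h1⟩ := (trace_src_eq_some h).1 hv
      rw [traceEdge_val hk, birth_succ_of_touched hy] at h1
      have h2 := birth_fst_le (σ := σ) (a := a) (b := b) k x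
      rw [← h1] at h2
      exact h2
    · obtain ⟨j, hj, y, hy, rfl, h1⟩ := (trace_tgt_eq_some h).1 hv
      rw [traceEdge_val hk] at h1
      change k ≤ j
      by_contra hlt
      exact not_touched_of_birth_eq h (by omega) hk h1 j le_rfl (by omega) hy
  · intro ha
    obtain ⟨j, hj, x, rfl⟩ := exists_traceEdge e
    refine ⟨x, Subtype.ext ?_⟩
    rw [traceEdge_val hk, traceEdge_val hj]
    rcases le_total k j with hkj | hjk
    · refine (birth_eq_of_fst_le hkj ?_).1.symm
      rcases exists_birth (σ := σ) (a := a) (b := b) j x with h0 | ⟨i, hi, h1, h2, h3⟩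
      · omega
      · have := ha.1 (traceVertex (by omega) h2) ((trace_src_eq_some h).2
          ⟨i, by omega, x, h2, rfl, by rw [traceEdge_val hj, h3]⟩)
        change i < k at this
        omega
    · refine birth_eq_of_not_touched hjk fun l => ?_
      induction l using Nat.strong_induction_on with
      | _ l ih =>
        intro hjl hlk hl
        have h1 : birth σ a b l x = birth σ a b j x :=
          birth_eq_of_not_touched hjl fun i hi hil => ih i hil hi (by omega)
        have := ha.2 (traceVertex (by omega) hl) ((trace_tgt_eq_some h).2
          ⟨l, by omega, x, hl, rfl, by rw [traceEdge_val hj, h1]⟩)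
        change k ≤ l at this
        omega

/-- The cycles of a factorisation are labelled by the edges of its graph. -/
theorem trace_isLabelling :
    (traceGraph h).IsLabelling (tracePos h) σ a b (traceEdge m) where
  state k hk :=
    { sym := h.sym k hk
      eq_iff := fun x y => by
        rw [← birth_eq_iff h hk, ← traceEdge_val hk, ← traceEdge_val hk]
        exact Subtype.ext_iff
      map_tau := fun x => (trace_invE h k x).symm
      weight_eq := fun x => by
        change (traceEdge m k x : TraceEdge σ a b m).1.2.card = _
        rw [traceEdge_val hk, birth_snd h hk]
      alive_iff := trace_alive_iff h hk }
  twist_eq := h.twist_eq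
  step k hk := by
    have ta := WGraph.touched_left (σ k) (a k) (b k)
    have tb := WGraph.touched_right (σ k) (a k) (b k)
    have hs := h.sym k hk.le
    have hab : block σ a b k (b k) = block σ a b k (a k) := by
      rw [block_eq_iff h hk ta]
      exact Or.inr (Or.inl ⟨Or.inr (SameCycle.refl _ _), Or.inl (SameCycle.refl _ _)⟩)
    refine ⟨traceVertex hk ta, h.ne k hk, h.ne_tau k hk, rfl, ?_, ?_, ?_, fun x hx => ?_,
      fun x hx => Subtype.ext ?_⟩
    · exact (trace_tgt_eq_some h).2 ⟨k, hk, a k, ta, rfl, (traceEdge_val hk.le _).symm⟩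
    · refine (trace_tgt_eq_some h).2 ⟨k, hk, b k, tb, ?_, (traceEdge_val hk.le _).symm⟩
      exact (traceVertex_eq_iff hk hk ta tb).2 ⟨rfl, hab.symm⟩
    · have e1 : traceEdge m k (a k) = (traceGraph h).invE (traceEdge m k (b k)) ↔
          (σ k).SameCycle (a k) (tau n (b k)) := by
        rw [trace_invE, ← birth_eq_iff h hk.le, ← traceEdge_val hk.le, ← traceEdge_val hk.le]
        exact Subtype.ext_iff
      refine Iff.trans ?_ e1.symm
      rw [trace_invV]
      refine (traceVertex_eq_iff hk hk _ ta).trans ?_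
      rw [block_eq_iff h hk ta]
      refine ⟨?_, fun h1 => ⟨rfl, Or.inl h1⟩⟩
      rintro ⟨-, h1 | ⟨h1, h2⟩ | ⟨h1, h2⟩⟩
      · exact h1
      · exact crossing_of_both_sides h hk h2 h1
      · rw [tau_tau] at h1
        exact crossing_of_both_sides h hk h1 h2
    · rw [(trace_src_eq_some h).2 ⟨k, hk, x, hx, rfl, (traceEdge_val hk _).symm⟩,
        (trace_tgt_eq_some h).2 ⟨k, hk, x, hx, rfl, (traceEdge_val hk.le _).symm⟩]
    · rw [traceEdge_val hk, traceEdge_val hk.le, birth_succ_of_not hx]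

end Graph

end

/-! ### Valences, genus and the classes of labelled graphs -/

section

variable {n m : ℕ}

namespace WGraph

variable {Γ : WGraph}

/-- The sum of the valences counts the internal edges twice and the ends once. -/
theorem sum_valence (hatt : ∀ e, Γ.src e ≠ none ∨ Γ.tgt e ≠ none) :
    ∑ v, Γ.valence v =
      2 * Γ.internalEdges.card + Γ.inwardEnds.card + Γ.outwardEnds.card := by
  classical
  have h1 : ∑ v, (Γ.inEdges v).card = (Finset.univ.filter fun e => Γ.tgt e ≠ none).card := by
    rw [← Finset.card_biUnion]
    · congr 1
      ext e
      simp only [Finset.mem_biUnion, Finset.mem_univ, true_and, mem_inEdges, Finset.mem_filter]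
      exact Option.ne_none_iff_exists'.symm
    · intro u _ v _ huv
      refine Finset.disjoint_left.2 fun e hu hv => huv ?_
      rw [mem_inEdges] at hu hv
      exact Option.some.inj (hu.symm.trans hv)
  have h2 : ∑ v, (Γ.outEdges v).card = (Finset.univ.filter fun e => Γ.src e ≠ none).card := by
    rw [← Finset.card_biUnion]
    · congr 1
      ext e
      simp only [Finset.mem_biUnion, Finset.mem_univ, true_and, mem_outEdges, Finset.mem_filter]
      exact Option.ne_none_iff_exists'.symm
    · intro u _ v _ huv
      refine Finset.disjoint_left.2 fun e hu hv => huv ?_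
      rw [mem_outEdges] at hu hv
      exact Option.some.inj (hu.symm.trans hv)
  have h3 : (Finset.univ.filter fun e => Γ.tgt e ≠ none).card =
      Γ.internalEdges.card + Γ.inwardEnds.card := by
    rw [← Finset.card_union_of_disjoint]
    · congr 1
      ext e
      have := hatt e
      simp only [internalEdges, inwardEnds, IsInternal, Finset.mem_filter, Finset.mem_univ,
        true_and, Finset.mem_union]
      tauto
    · refine Finset.disjoint_left.2 fun e he he' => ?_
      simp only [internalEdges, inwardEnds, IsInternal, Finset.mem_filter, Finset.mem_univ,
        true_and] at he he'
      exact he.1 he'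
  have h4 : (Finset.univ.filter fun e => Γ.src e ≠ none).card =
      Γ.internalEdges.card + Γ.outwardEnds.card := by
    rw [← Finset.card_union_of_disjoint]
    · congr 1
      ext e
      have := hatt e
      simp only [internalEdges, outwardEnds, IsInternal, Finset.mem_filter, Finset.mem_univ,
        true_and, Finset.mem_union]
      tauto
    · refine Finset.disjoint_left.2 fun e he he' => ?_
      simp only [internalEdges, outwardEnds, IsInternal, Finset.mem_filter, Finset.mem_univ,
        true_and] at he he'
      exact he.2 he'
  simp only [valence, Finset.sum_add_distrib]
  omega

/-- Every orbit of vertices, a 4-valent vertex or a pair of 3-valent ones, contributes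
two more than twice its size to the sum of the valences. -/
theorem sum_valence_eq_of_orbits {O : Type*} [Fintype O] (q : Γ.V → O)
    (hq : Function.Surjective q) (hinv : ∀ v, Γ.invV (Γ.invV v) = v)
    (hfib : ∀ u v, q u = q v ↔ v = u ∨ v = Γ.invV u)
    (h3 : ∀ v, Γ.invV v ≠ v → Γ.valence v = 3) (h4 : ∀ v, Γ.invV v = v → Γ.valence v = 4) :
    ∑ v, Γ.valence v = 2 * Fintype.card Γ.V + 2 * Fintype.card O := by
  classical
  have key : ∀ o, ∑ v with q v = o, Γ.valence v =
      2 * (Finset.univ.filter fun v => q v = o).card + 2 := by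
    intro o
    obtain ⟨u, rfl⟩ := hq o
    have hf : (Finset.univ.filter fun v => q v = q u) = {u, Γ.invV u} := by
      ext v
      rw [Finset.mem_filter, Finset.mem_insert, Finset.mem_singleton, eq_comm, hfib]
      simp
    rw [hf]
    by_cases hu : Γ.invV u = u
    · rw [hu, Finset.pair_eq_singleton, Finset.sum_singleton, h4 u hu, Finset.card_singleton]
    · rw [Finset.sum_pair (Ne.symm hu), Finset.card_pair (Ne.symm hu), h3 u hu, h3]
      rw [hinv]; exact Ne.symm hu
  rw [← Finset.sum_fiberwise Finset.univ q, Finset.sum_congr rfl fun o _ => key o,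
    Finset.sum_add_distrib, ← Finset.mul_sum, Finset.sum_const, Finset.card_univ,
    ← Finset.card_univ (α := Γ.V), Finset.card_eq_sum_card_fiberwise (f := q) (t := Finset.univ)]
  · rw [smul_eq_mul, mul_comm (Fintype.card O)]
  · exact fun _ _ => Finset.mem_coe.2 (Finset.mem_univ _)

/-- The involution is an automorphism. -/
def IsGraded.invIso {pos : Γ.V → Fin m} (hG : Γ.IsGraded pos)
    (hw : ∀ e, Γ.weight (Γ.invE e) = Γ.weight e) : Iso Γ Γ where
  onV := Function.Involutive.toPerm Γ.invV hG.invV_invV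
  onE := Function.Involutive.toPerm Γ.invE hG.invE_invE
  src_map := hG.src_inv
  tgt_map := hG.tgt_inv
  weight_map := hw
  invV_map _ := rfl
  invE_map _ := rfl

namespace IsLabelling

variable {pos : Γ.V → Fin m} {σ : ℕ → Perm (Letters n)} {a b : ℕ → Letters n}
  {f : ℕ → Letters n → Γ.E}

theorem weight_inv (h : Γ.IsLabelling pos σ a b f) (hG : Γ.IsGraded pos) (e : Γ.E) :
    Γ.weight (Γ.invE e) = Γ.weight e := by
  obtain ⟨k, hk, x, rfl⟩ := h.exists_label hG e
  have hs := h.state k hk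
  rw [← hs.map_tau, hs.weight_eq, hs.weight_eq, hs.sym.card_cyc_tau]

/-- Every vertex, and not only one of each orbit, is the vertex of a labelled step. -/
theorem exists_stepAt (h : Γ.IsLabelling pos σ a b f) (hG : Γ.IsGraded pos) (v : Γ.V) :
    ∃ σ a b, ∃ f f' : Letters n → Γ.E, Γ.IsState pos (pos v) σ f ∧
      Γ.IsState pos (pos v + 1) (twist a b σ) f' ∧ Γ.IsStepAt pos (pos v) σ a b f f' v := by
  obtain ⟨w, hw⟩ := h.step (pos v) (pos v).2
  have hs := h.state _ (pos v).2.le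
  have hs' := h.twist_state (pos v).2
  rcases (hG.eq_iff w v).1 (Fin.ext hw.pos_eq) with rfl | rfl
  · exact ⟨_, _, _, _, _, hs, hs', hw⟩
  · have hp : ∀ v, pos ((hG.invIso (h.weight_inv hG)).onV v) = pos v := hG.pos_inv
    exact ⟨_, _, _, _, _, hs.map_iso _ hp, hs'.map_iso _ hp, hw.map_iso _ hp⟩

/-- The graph of a transitive factorisation is a twisted monodromy graph. -/
theorem isTwistedMonodromy [Nonempty (Letters n)] {g : ℕ} {μ ν : n.Partition}
    {pos : Γ.V → Fin (numBranch g μ ν)} (h : Γ.IsLabelling pos σ a b f) (hG : Γ.IsGraded pos)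
    (hb : 0 < numBranch g μ ν) (hc : ∀ u v, Relation.EqvGen Γ.Arrow u v)
    (hatt : ∀ e, Γ.src e ≠ none ∨ Γ.tgt e ≠ none) (hμ : HasDoubledCycleType (σ 0) μ)
    (hν : HasDoubledCycleType (σ (numBranch g μ ν)) ν) :
    Γ.IsTwistedMonodromy g μ ν ∧ Γ.IsVertexOrder pos := by
  classical
  have hval3 : ∀ v, Γ.invV v ≠ v → Γ.valence v = 3 := fun v hv => by
    obtain ⟨_, _, _, _, _, hs, hs', hst⟩ := h.exists_stepAt hG v
    exact hst.valence_of_ne hG hs hs' hv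
  have hval4 : ∀ v, Γ.invV v = v → Γ.valence v = 4 := fun v hv => by
    obtain ⟨_, _, _, _, _, hs, hs', hst⟩ := h.exists_stepAt hG v
    exact hst.valence_of_eq hG hs hs' hv
  have hsurj : Function.Surjective pos := fun i => by
    obtain ⟨v, hv⟩ := h.step i i.2
    exact ⟨v, Fin.ext hv.pos_eq⟩
  have hs0 := h.state 0 (Nat.zero_le _)
  have hsb := h.state _ le_rfl
  have hin : Γ.inwardEnds.val.map Γ.weight = μ.parts + μ.parts := by
    rw [← hμ]
    refine (partition_parts_eq _ _ (f 0) _ hs0.eq_iff (fun e => ?_) hs0.weight_eq).symm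
    rw [hs0.alive_iff]
    simp only [WGraph.Alive, WGraph.inwardEnds, Finset.mem_filter, Finset.mem_univ, true_and,
      Nat.not_lt_zero, zero_le, implies_true, and_true, imp_false]
    exact ⟨fun h => Option.eq_none_iff_forall_ne_some.2 h, fun h v hv => by simp [h] at hv⟩
  have hout : Γ.outwardEnds.val.map Γ.weight = ν.parts + ν.parts := by
    rw [← hν]
    refine (partition_parts_eq _ _ (f _) _ hsb.eq_iff (fun e => ?_) hsb.weight_eq).symm
    rw [hsb.alive_iff]
    simp only [WGraph.Alive, WGraph.outwardEnds, Finset.mem_filter, Finset.mem_univ, true_and,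
      Fin.is_lt, implies_true]
    refine ⟨fun h => Option.eq_none_iff_forall_ne_some.2 fun v hv => ?_,
      fun h v hv => by simp [h] at hv⟩
    have := h v hv
    have := (pos v).2
    omega
  have hacyc : ∀ u v, Relation.TransGen Γ.Arrow u v → pos u < pos v := by
    intro u v huv
    induction huv with
    | single h1 => exact hG.lt_of_arrow _ _ h1
    | tail _ h1 ih => exact ih.trans (hG.lt_of_arrow _ _ h1)
  refine ⟨?_, ⟨hsurj, hG.eq_iff, hG.lt_of_arrow⟩⟩
  exact
    { nonempty := ⟨(hsurj ⟨0, hb⟩).choose⟩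
      connected := hc
      attached := hatt
      genus := by
        have h1 := sum_valence hatt
        have h2 := sum_valence_eq_of_orbits pos hsurj hG.invV_invV hG.eq_iff hval3 hval4
        have h3 := congrArg Multiset.card hin
        have h4 := congrArg Multiset.card hout
        simp only [Multiset.card_map, Multiset.card_add, Finset.card_val, Fintype.card_fin]
          at h2 h3 h4
        unfold numBranch at h2 hb
        omega
      valence_eq := fun v => by
        by_cases hv : Γ.invV v = v
        · exact Or.inr (hval4 v hv)
        · exact Or.inl (hval3 v hv)
      invV_invV := hG.invV_invV
      invE_invE := hG.invE_invE
      src_inv := hG.src_inv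
      tgt_inv := hG.tgt_inv
      weight_inv := h.weight_inv hG
      invV_eq_iff := fun v => by
        refine ⟨hval4 v, fun h1 => ?_⟩
        by_contra hv
        have := hval3 v hv
        omega
      invE_ne := fun e => by
        obtain ⟨k, hk, x, rfl⟩ := h.exists_label hG e
        have hs := h.state k hk
        rw [← hs.map_tau, Ne, hs.eq_iff]
        exact hs.sym.not_sameCycle' x
      inward := hin
      outward := hout
      no_source := fun v => by
        obtain ⟨_, _, _, _, _, hs, hs', hst⟩ := h.exists_stepAt hG v
        exact ⟨_, mem_inEdges.2 hst.tgt_left⟩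
      no_sink := fun v => by
        obtain ⟨_, _, _, _, _, hs, hs', hst⟩ := h.exists_stepAt hG v
        exact ⟨_, mem_outEdges.2 hst.src_left⟩
      acyclic := fun v hv => lt_irrefl _ (hacyc v v hv)
      weight_pos := fun e => by
        obtain ⟨k, hk, x, rfl⟩ := h.exists_label hG e
        rw [(h.state k hk).weight_eq]
        exact card_cyc_pos _ _
      balanced := fun v => by
        obtain ⟨_, _, _, _, _, hs, hs', hst⟩ := h.exists_stepAt hG v
        exact hst.balanced hG hs hs'
      weight_four := fun v hv e e' he he' => by
        obtain ⟨_, _, _, _, _, hs, hs', hst⟩ := h.exists_stepAt hG v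
        have hv' : Γ.invV v = v := by
          by_contra h1
          have := hval3 v h1
          omega
        rw [hst.weight_crossing hG hs hs' hv' he, hst.weight_crossing hG hs hs' hv' he'] }

end IsLabelling
end WGraph

/-- Every twisted factorisation is labelled by some twisted monodromy graph. -/
theorem exists_labelling_of_mem_factorizations [Nonempty (Letters n)] {g : ℕ} {μ ν : n.Partition}
    {t : Perm (Letters n) × (Fin (numBranch g μ ν) → Perm (Letters n)) × Perm (Letters n)}
    (ht : t ∈ factorizations g μ ν) :
    ∃ M : MonodromyGraph g μ ν, (M.labellings t).Nonempty := by
  obtain ⟨σ₁, η, σ₂⟩ := t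
  replace ht : IsFactorization g μ ν σ₁ η σ₂ := ht
  obtain ⟨σ, a, b, hq⟩ := exists_isSequence σ₁ η ht.isSwap
  have hprod : ∀ i : Fin (numBranch g μ ν), σ (i + 1) = η i * σ i * (tau n * η i * tau n) := by
    intro i
    rw [hq.twist_eq i i.2, hq.swap_eq, tau_swap_tau]
    rfl
  have hlast : σ (numBranch g μ ν) = σ₂ := by
    rw [← prod_ofFn_eq η σ hprod, hq.zero, ht.prod_eq]
  have hv : Trace.Valid σ a b (numBranch g μ ν) :=
    { sym := fun k => by
        induction k with
        | zero => exact fun _ => hq.zero ▸ mem_BTilde_iff.1 ht.mem_left.1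
        | succ k ih => exact fun hk => hq.twist_eq k hk ▸ (ih (by omega)).twist _ _
      ne := fun k hk => hq.ne ⟨k, hk⟩
      ne_tau := fun k hk => by
        have := ht.ne_conj ⟨k, hk⟩
        rw [hq.swap_eq] at this
        exact (ne_conj_iff (hq.ne ⟨k, hk⟩)).1 this
      twist_eq := hq.twist_eq }
  have hl := trace_isLabelling hv
  have hG := trace_isGraded hv
  obtain ⟨hc, hatt⟩ := hl.connected_of_isPretransitive hG ht.b_pos _ (by
    rintro γ (((rfl | rfl) | ⟨i, rfl⟩) | ⟨i, rfl⟩)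
    · exact Or.inl ⟨0, Nat.zero_le _, hq.zero.symm⟩
    · exact Or.inl ⟨_, le_rfl, hlast.symm⟩
    · exact Or.inr (Or.inl ⟨i, i.2, hq.swap_eq i⟩)
    · exact Or.inr (Or.inr ⟨i, i.2, by rw [← tau_swap_tau, ← hq.swap_eq]⟩)) ht.transitive
  obtain ⟨h1, h2⟩ := hl.isTwistedMonodromy hG ht.b_pos hc hatt (hq.zero ▸ ht.type_left)
    (hlast ▸ ht.type_right)
  exact ⟨⟨_, h1, _, h2⟩, _, hl.isChain hq, hq.zero, hlast⟩

end

/-! ### Counting the labelled permutations of a given type -/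

section

section Model

variable {n : ℕ} {E : Type*}

/-- The standard model of `2n` points decomposed into pairs of mirror cycles: for every `e ∈ H` a
cyclically ordered set of `w e` points and its mirror image, told apart by the Boolean. -/
abbrev ModelPoint (H : Finset E) (w : E → ℕ) : Type _ := (Σ e : H, ZMod (w e)) × Bool

/-- The equivariant bijections from a doubled set to the letters. -/
abbrev EquivariantEquiv (Z : Type*) (n : ℕ) : Type _ :=
  {Φ : Z × Bool ≃ Letters n // ∀ z s, Φ (z, !s) = tau n (Φ (z, s))}

theorem card_equivariantEquiv (Z : Type*) [Fintype Z] (hZ : Fintype.card Z = n) :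
    Nat.card (EquivariantEquiv Z n) = 2 ^ n * n.factorial := by
  classical
  let F : (Z ≃ Fin n) × (Z → Bool) → EquivariantEquiv Z n := fun p =>
    ⟨{ toFun := fun y => if xor (p.2 y.1) y.2 then Sum.inr (p.1 y.1) else Sum.inl (p.1 y.1)
       invFun := fun x => x.elim (fun i => (p.1.symm i, p.2 (p.1.symm i)))
        (fun i => (p.1.symm i, !p.2 (p.1.symm i)))
       left_inv := by
        rintro ⟨z, s⟩
        cases hp : p.2 z <;> cases s <;> simp [hp]
       right_inv := by
        rintro (i | i) <;> simp }, by
      intro z s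
      cases hp : p.2 z <;> cases s <;> simp [hp, tau]⟩
  have hF : Function.Bijective F := by
    constructor
    · rintro ⟨π, ε⟩ ⟨π', ε'⟩ h
      have h1 : ∀ z, (F (π, ε)).1 (z, false) = (F (π', ε')).1 (z, false) := fun z => by rw [h]
      have h2 : ∀ z, π z = π' z ∧ ε z = ε' z := by
        intro z
        have := h1 z
        simp only [F, coe_fn_mk, Bool.xor_false] at this
        cases he : ε z <;> cases he' : ε' z <;> simp [he, he'] at this ⊢ <;> exact this
      rw [Prod.mk.injEq]
      exact ⟨Equiv.ext fun z => (h2 z).1, funext fun z => (h2 z).2⟩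
    · rintro ⟨Φ, hΦ⟩
      let π₀ : Z → Fin n := fun z => (Φ (z, false)).elim id id
      have hinj : Function.Injective π₀ := by
        intro z z' h
        have h3 : Φ (z, false) = Φ (z', false) ∨ Φ (z, false) = tau n (Φ (z', false)) := by
          simp only [π₀] at h
          cases h1 : Φ (z, false) <;> cases h2 : Φ (z', false) <;>
            rw [h1, h2] at h <;> simp [tau] at h ⊢ <;> exact h
        rw [← hΦ] at h3
        rcases h3 with h3 | h3
        · simpa using h3
        · simp at h3
      let π : Z ≃ Fin n := Equiv.ofBijective π₀
        ((Fintype.bijective_iff_injective_and_card π₀).2 ⟨hinj, by simp [hZ]⟩)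
      have h0 : ∀ z, (F (π, fun z => (Φ (z, false)).isRight)).1 (z, false) = Φ (z, false) := by
        intro z
        simp only [F, coe_fn_mk, Bool.xor_false]
        change (if _ then Sum.inr (π₀ z) else Sum.inl (π₀ z)) = _
        simp only [π₀]
        cases h1 : Φ (z, false) <;> simp
      refine ⟨(π, fun z => (Φ (z, false)).isRight), Subtype.ext (Equiv.ext ?_)⟩
      rintro ⟨z, s⟩
      cases s
      · exact h0 z
      · rw [← Bool.not_false, hΦ, ← h0]
        exact (F (π, fun z => (Φ (z, false)).isRight)).2 z false
  rw [← Nat.card_congr (Equiv.ofBijective F hF), Nat.card_prod, Nat.card_eq_fintype_card,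
    Nat.card_eq_fintype_card, Fintype.card_equiv (Fintype.equivFinOfCardEq hZ), hZ,
    Fintype.card_fun, Fintype.card_bool, hZ, mul_comm]

variable {S H : Finset E} {ι : E → E} {w : E → ℕ}

/-- The permutation `σ` has its cycles in equivariant bijection, by means of `f`, with `S`, and
the lengths of the cycles are given by `w`. -/
structure IsCycleLabelling (S : Finset E) (ι : E → E) (w : E → ℕ) (σ : Perm (Letters n))
    (f : Letters n → E) : Prop where
  sym : IsSym σ
  eq_iff : ∀ x y, f x = f y ↔ σ.SameCycle x y
  map_tau : ∀ x, f (tau n x) = ι (f x)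
  weight_eq : ∀ x, w (f x) = (cyc σ x).card
  mem_iff : ∀ e, (∃ x, f x = e) ↔ e ∈ S

theorem IsCycleLabelling.card_fiber {σ : Perm (Letters n)} {f : Letters n → E}
    (h : IsCycleLabelling S ι w σ f) {e : E} (he : e ∈ S) : Nat.card {x // f x = e} = w e := by
  classical
  obtain ⟨x, rfl⟩ := (h.mem_iff e).2 he
  rw [h.weight_eq, Nat.card_eq_fintype_card, Fintype.card_subtype]
  congr 1
  ext y
  rw [Finset.mem_filter, mem_cyc, eq_comm, h.eq_iff]
  simp

theorem pow_mod_card_cyc {X : Type*} [Fintype X] (σ : Perm X) (x : X) (k : ℕ) :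
    (σ ^ (k % (cyc σ x).card)) x = (σ ^ k) x := by
  rw [card_cyc, ← iterate_eq_pow, ← iterate_eq_pow, Function.iterate_mod_minimalPeriod_eq]

/-- Base points of all cycles indexed by `H` identify the model with the letters. -/
def basedMap (σ : Perm (Letters n)) (x : H → Letters n) : ModelPoint H w → Letters n :=
  fun y => if y.2 then tau n ((σ ^ y.1.2.val) (x y.1.1)) else (σ ^ y.1.2.val) (x y.1.1)

/-- The label of a point of the model. -/
def modelLabel (ι : E → E) : ModelPoint H w → E := fun y => if y.2 then ι y.1.1 else y.1.1

theorem modelLabel_inj (hι : ∀ e, ι (ι e) = e) (hH : ∀ e ∈ H, ι e ∉ H) {y z : ModelPoint H w}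
    (h : modelLabel ι y = modelLabel ι z) : y.1.1 = z.1.1 ∧ y.2 = z.2 := by
  obtain ⟨⟨⟨e, he⟩, i⟩, s⟩ := y
  obtain ⟨⟨⟨e', he'⟩, j⟩, s'⟩ := z
  cases s <;> cases s' <;> simp only [modelLabel, if_true, Bool.false_eq_true, if_false] at h
  · subst h; exact ⟨rfl, rfl⟩
  · exact absurd he (h ▸ hH _ he')
  · exact absurd he' (h ▸ hH _ he)
  · have := congrArg ι h
    rw [hι, hι] at this
    subst this; exact ⟨rfl, rfl⟩

section

variable {σ : Perm (Letters n)} {f : Letters n → E} {x : H → Letters n}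

theorem label_basedMap (h : IsCycleLabelling S ι w σ f) (hx : ∀ e, f (x e) = e)
    (y : ModelPoint H w) : f (basedMap σ x y) = modelLabel ι y := by
  obtain ⟨⟨e, j⟩, s⟩ := y
  have h1 : f ((σ ^ j.val) (x e)) = e :=
    ((h.eq_iff _ _).2 (sameCycle_pow_left.2 (SameCycle.refl _ _))).trans (hx e)
  cases s
  · simpa [basedMap, modelLabel] using h1
  · simp [basedMap, modelLabel, h.map_tau, h1]

theorem basedMap_injective [∀ e : H, NeZero (w e)] (hι : ∀ e, ι (ι e) = e)
    (hH : ∀ e ∈ H, ι e ∉ H) (h : IsCycleLabelling S ι w σ f) (hx : ∀ e, f (x e) = e) :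
    Function.Injective (basedMap (w := w) σ x) := by
  intro y z hyz
  have h1 := congrArg f hyz
  rw [label_basedMap h hx, label_basedMap h hx] at h1
  obtain ⟨h2, h3⟩ := modelLabel_inj hι hH h1
  obtain ⟨⟨e, i⟩, s⟩ := y
  obtain ⟨⟨e', j⟩, s'⟩ := z
  obtain rfl : e = e' := h2
  obtain rfl : s = s' := h3
  have h4 : (σ ^ i.val) (x e) = (σ ^ j.val) (x e) := by
    cases s
    · simpa [basedMap] using hyz
    · simpa [basedMap] using hyz
  have hc : (cyc σ (x e)).card = w e := by rw [← h.weight_eq, hx]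
  have := pow_apply_injOn (by rw [hc]; exact i.val_lt) (by rw [hc]; exact j.val_lt) h4
  rw [ZMod.val_injective _ this]

theorem pow_val_add_one [∀ e : H, NeZero (w e)] (h : IsCycleLabelling S ι w σ f)
    (hx : ∀ e, f (x e) = e) (e : H) (j : ZMod (w e)) :
    (σ ^ (j + 1).val) (x e) = σ ((σ ^ j.val) (x e)) := by
  have hc : (cyc σ (x e)).card = w e := by rw [← h.weight_eq, hx]
  have hm : ∀ k, (σ ^ (k % w e)) (x e) = (σ ^ k) (x e) := fun k => by rw [← hc, pow_mod_card_cyc]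
  rw [ZMod.val_add, ZMod.val_one_eq_one_mod, Nat.add_mod_mod, hm, pow_succ', mul_apply]

theorem apply_basedMap_false [∀ e : H, NeZero (w e)] (h : IsCycleLabelling S ι w σ f)
    (hx : ∀ e, f (x e) = e) (e : H) (j : ZMod (w e)) :
    σ (basedMap σ x (⟨e, j⟩, false)) = basedMap σ x (⟨e, j + 1⟩, false) := by
  simp only [basedMap, Bool.false_eq_true, if_false]
  rw [pow_val_add_one h hx]

theorem apply_basedMap_true [∀ e : H, NeZero (w e)] (h : IsCycleLabelling S ι w σ f)
    (hx : ∀ e, f (x e) = e) (e : H) (j : ZMod (w e)) :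
    σ (basedMap σ x (⟨e, j + 1⟩, true)) = basedMap σ x (⟨e, j⟩, true) := by
  simp only [basedMap, if_true]
  rw [pow_val_add_one h hx, h.sym.tau_apply]
  simp

end

/-- The rotation of the cycles of the model; mirror cycles are rotated backwards. -/
def modelPerm (H : Finset E) (w : E → ℕ) : Perm (ModelPoint H w) where
  toFun y := (⟨y.1.1, if y.2 then y.1.2 - 1 else y.1.2 + 1⟩, y.2)
  invFun y := (⟨y.1.1, if y.2 then y.1.2 + 1 else y.1.2 - 1⟩, y.2)
  left_inv := by rintro ⟨⟨e, j⟩, s⟩; cases s <;> simp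
  right_inv := by rintro ⟨⟨e, j⟩, s⟩; cases s <;> simp

theorem modelPerm_pow (y : ModelPoint H w) (k : ℕ) : (modelPerm H w ^ k) y =
    (⟨y.1.1, if y.2 then y.1.2 - k else y.1.2 + k⟩, y.2) := by
  induction k with
  | zero => obtain ⟨⟨e, j⟩, s⟩ := y; cases s <;> simp
  | succ k ih =>
    rw [pow_succ', mul_apply, ih]
    obtain ⟨⟨e, j⟩, s⟩ := y
    cases s
    · simp [modelPerm, add_assoc]
    · simp [modelPerm, sub_sub]

theorem permCongr_pow {Y X : Type*} (Φ : Y ≃ X) (π : Perm Y) (k : ℕ) (y : Y) :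
    ((Φ.permCongr π) ^ k) (Φ y) = Φ ((π ^ k) y) := by
  induction k with
  | zero => rfl
  | succ k ih => rw [pow_succ', mul_apply, ih, pow_succ', mul_apply]; simp

theorem modelPerm_sameCycle [∀ e : H, NeZero (w e)] {e : H} {i j : ZMod (w e)} {s : Bool} :
    ∃ k : ℕ, (modelPerm H w ^ k) (⟨e, i⟩, s) = (⟨e, j⟩, s) := by
  cases s
  · exact ⟨(j - i).val, by rw [modelPerm_pow]; simp⟩
  · exact ⟨(i - j).val, by rw [modelPerm_pow]; simp⟩

theorem isCycleLabelling_permCongr [∀ e : H, NeZero (w e)] (hι : ∀ e, ι (ι e) = e)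
    (hH : ∀ e ∈ H, ι e ∉ H) (hS : ∀ e, e ∈ S ↔ e ∈ H ∨ ι e ∈ H) (hw : ∀ e, w (ι e) = w e)
    (Φ : EquivariantEquiv (Σ e : H, ZMod (w e)) n) :
    IsCycleLabelling S ι w (Φ.1.permCongr (modelPerm H w)) fun x =>
      modelLabel ι (Φ.1.symm x) := by
  classical
  obtain ⟨Φ, hΦ⟩ := Φ
  have hsucc : ∀ y, modelLabel ι (modelPerm H w y) = modelLabel ι y := by
    rintro ⟨⟨e, j⟩, s⟩
    rfl
  have heq : ∀ x y, modelLabel ι (Φ.symm x) = modelLabel ι (Φ.symm y) ↔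
      (Φ.permCongr (modelPerm H w)).SameCycle x y := by
    intro x y
    obtain ⟨x, rfl⟩ := Φ.surjective x
    obtain ⟨y, rfl⟩ := Φ.surjective y
    rw [Equiv.symm_apply_apply, Equiv.symm_apply_apply]
    constructor
    · intro h
      obtain ⟨h1, h2⟩ := modelLabel_inj hι hH h
      obtain ⟨⟨e, i⟩, s⟩ := x
      obtain ⟨⟨e', j⟩, s'⟩ := y
      obtain rfl : e = e' := h1
      obtain rfl : s = s' := h2
      obtain ⟨k, hk⟩ := modelPerm_sameCycle (e := e) (i := i) (j := j) (s := s)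
      exact ⟨k, by rw [zpow_natCast, permCongr_pow, hk]⟩
    · intro h
      have := sameCycle_mem_of_invariant (p := fun z => modelLabel ι x = modelLabel ι (Φ.symm z))
        (fun z hz => by rw [hz]; simp [hsucc]) (by simp) h
      simpa using this
  have htau : ∀ x, modelLabel ι (Φ.symm (tau n x)) = ι (modelLabel ι (Φ.symm x)) := by
    intro x
    obtain ⟨⟨z, s⟩, rfl⟩ := Φ.surjective x
    rw [← hΦ, Equiv.symm_apply_apply, Equiv.symm_apply_apply]
    cases s
    · simp [modelLabel]
    · simp [modelLabel, hι]
  have hmem : ∀ y : ModelPoint H w, modelLabel ι y ∈ S := by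
    rintro ⟨⟨⟨e, he⟩, j⟩, s⟩
    cases s
    · exact (hS _).2 (Or.inl he)
    · exact (hS _).2 (Or.inr (by simpa [modelLabel, hι] using he))
  refine ⟨⟨fun x => ?_, fun x hx => ?_⟩, heq, htau, fun x => ?_, fun e => ⟨?_, fun he => ?_⟩⟩
  · obtain ⟨⟨⟨e, j⟩, s⟩, rfl⟩ := Φ.surjective x
    rw [Perm.eq_inv_iff_eq, ← hΦ]
    simp only [permCongr_apply, Equiv.symm_apply_apply]
    have : modelPerm H w (⟨e, j⟩, s) = (⟨e, if s then j - 1 else j + 1⟩, s) := rfl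
    rw [this, ← hΦ, Equiv.symm_apply_apply]
    cases s <;> simp [modelPerm]
  · rw [← heq, htau] at hx
    rcases (hS _).1 (hmem (Φ.symm x)) with h1 | h1
    · exact hH _ h1 (hx ▸ h1)
    · rw [← hx] at h1
      have := hH _ h1
      rw [← hx] at this
      exact this h1
  · obtain ⟨⟨⟨e, j⟩, s⟩, rfl⟩ := Φ.surjective x
    have h1 : cyc (Φ.permCongr (modelPerm H w)) (Φ (⟨e, j⟩, s)) =
        Finset.univ.map ⟨fun i : ZMod (w e) => Φ (⟨e, i⟩, s), fun i j hij => by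
          simpa using hij⟩ := by
      ext y
      obtain ⟨⟨⟨e', i⟩, s'⟩, rfl⟩ := Φ.surjective y
      rw [mem_cyc, ← heq, Equiv.symm_apply_apply, Equiv.symm_apply_apply]
      simp only [Finset.mem_map, Finset.mem_univ, true_and]
      constructor
      · intro h
        obtain ⟨h1, h2⟩ := modelLabel_inj hι hH h
        obtain rfl : e = e' := h1
        obtain rfl : s = s' := h2
        exact ⟨i, rfl⟩
      · rintro ⟨k, hk⟩
        have := Φ.injective hk
        rw [← this]; rfl
    rw [h1, Finset.card_map, Finset.card_univ, ZMod.card, Equiv.symm_apply_apply]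
    cases s
    · rfl
    · exact hw e
  · rintro ⟨x, rfl⟩
    exact hmem _
  · rcases (hS e).1 he with h1 | h1
    · exact ⟨Φ (⟨⟨e, h1⟩, 0⟩, false), by simp [modelLabel]⟩
    · exact ⟨Φ (⟨⟨ι e, h1⟩, 0⟩, true), by simp [modelLabel, hι]⟩

/-- The number of labelled permutations of a given type. With a base point on one cycle of each
pair of mirror cycles, they correspond to the equivariant bijections from the model. -/
theorem card_isCycleLabelling (hι : ∀ e, ι (ι e) = e) (hH : ∀ e ∈ H, ι e ∉ H)
    (hS : ∀ e, e ∈ S ↔ e ∈ H ∨ ι e ∈ H) (hw : ∀ e, w (ι e) = w e) (hpos : ∀ e, 0 < w e)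
    (hsum : ∑ e ∈ H, w e = n) :
    Nat.card {p : Perm (Letters n) × (Letters n → E) // IsCycleLabelling S ι w p.1 p.2} *
      ∏ e ∈ H, w e = 2 ^ n * n.factorial := by
  classical
  have : ∀ e : H, NeZero (w e) := fun e => ⟨(hpos e).ne'⟩
  have hZ : Fintype.card (Σ e : H, ZMod (w e)) = n := by
    rw [Fintype.card_sigma]
    simp only [ZMod.card]
    rw [← hsum, ← Finset.sum_coe_sort H]
  rw [← card_equivariantEquiv _ hZ]
  let T := Σ p : {p : Perm (Letters n) × (Letters n → E) // IsCycleLabelling S ι w p.1 p.2},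
    ∀ e : H, {x // p.1.2 x = e}
  have hT : Nat.card T = Nat.card {p : Perm (Letters n) × (Letters n → E) //
      IsCycleLabelling S ι w p.1 p.2} * ∏ e ∈ H, w e := by
    have h1 : ∀ p : {p : Perm (Letters n) × (Letters n → E) // IsCycleLabelling S ι w p.1 p.2},
        Nat.card (∀ e : H, {x // p.1.2 x = e}) = ∏ e ∈ H, w e := by
      intro p
      rw [Nat.card_pi, ← Finset.prod_coe_sort H]
      exact Finset.prod_congr rfl fun e _ => p.2.card_fiber ((hS e).2 (Or.inl e.2))
    have : Finite {p : Perm (Letters n) × (Letters n → E) //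
        IsCycleLabelling S ι w p.1 p.2} := by
      -- the labels take values in the finite set `S`
      refine Finite.of_injective (β := Perm (Letters n) × (Letters n → S))
        (fun p => (p.1.1, fun x => ⟨p.1.2 x, (p.2.mem_iff _).1 ⟨x, rfl⟩⟩)) fun p q h => ?_
      rw [Prod.mk.injEq] at h
      exact Subtype.ext (Prod.ext h.1 (funext fun x => congrArg Subtype.val (congrFun h.2 x)))
    have := Fintype.ofFinite {p : Perm (Letters n) × (Letters n → E) //
        IsCycleLabelling S ι w p.1 p.2}
    rw [Nat.card_sigma, Finset.sum_congr rfl fun p _ => h1 p, Finset.sum_const, smul_eq_mul,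
      Finset.card_univ, Nat.card_eq_fintype_card]
  rw [← hT]
  have hx : ∀ t : T, ∀ e : H, t.1.1.2 ((t.2 e).1) = e := fun t e => (t.2 e).2
  let F : T → EquivariantEquiv (Σ e : H, ZMod (w e)) n := fun t =>
    ⟨Equiv.ofBijective (basedMap (w := w) t.1.1.1 fun e => (t.2 e).1)
      ((Fintype.bijective_iff_injective_and_card _).2
        ⟨basedMap_injective hι hH t.1.2 (hx t), by
          rw [Fintype.card_prod, hZ, Fintype.card_bool, Fintype.card_sum, Fintype.card_fin]
          omega⟩), by
      intro z s
      simp only [Equiv.ofBijective_apply, basedMap]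
      cases s <;> simp⟩
  have hFa : ∀ t y, (F t).1 y = basedMap (w := w) t.1.1.1 (fun e => (t.2 e).1) y := fun t y => rfl
  refine Nat.card_congr (Equiv.ofBijective F ⟨?_, fun Φ => ?_⟩)
  · intro t t' h
    have hy : ∀ y, basedMap (w := w) t.1.1.1 (fun e => (t.2 e).1) y =
        basedMap t'.1.1.1 (fun e => (t'.2 e).1) y := fun y => by rw [← hFa, ← hFa, h]
    have hxt := hx t
    have hxt' := hx t'
    have hsurj := (F t).1.surjective
    obtain ⟨⟨⟨σ, f⟩, hp⟩, x⟩ := t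
    obtain ⟨⟨⟨σ', f'⟩, hp'⟩, x'⟩ := t'
    replace hp : IsCycleLabelling S ι w σ f := hp
    replace hp' : IsCycleLabelling S ι w σ' f' := hp'
    replace hsurj : Function.Surjective (basedMap (w := w) σ fun e => (x e).1) := hsurj
    replace hy : ∀ y, basedMap (w := w) σ (fun e => (x e).1) y =
      basedMap σ' (fun e => (x' e).1) y := hy
    dsimp only at x x' hy hxt hxt' hsurj
    obtain rfl : σ = σ' := by
      ext z : 1
      obtain ⟨⟨⟨e, j⟩, s⟩, rfl⟩ := hsurj z
      cases s
      · rw [apply_basedMap_false hp hxt, hy, hy, apply_basedMap_false hp' hxt']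
      · obtain ⟨j, rfl⟩ : ∃ i, j = i + 1 := ⟨j - 1, by ring⟩
        rw [apply_basedMap_true hp hxt, hy, hy, apply_basedMap_true hp' hxt']
    obtain rfl : f = f' := by
      ext z : 1
      obtain ⟨y, rfl⟩ := hsurj z
      rw [label_basedMap hp hxt, hy, label_basedMap hp' hxt']
    obtain rfl : x = x' := by
      ext e : 2
      have := hy (⟨e, 0⟩, false)
      simpa [basedMap] using this
    rfl
  · refine ⟨⟨⟨(Φ.1.permCongr (modelPerm H w), fun x => modelLabel ι (Φ.1.symm x)),
        isCycleLabelling_permCongr hι hH hS hw Φ⟩, fun e =>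
      ⟨Φ.1 (⟨e, 0⟩, false), by simp [modelLabel]⟩⟩, Subtype.ext (Equiv.ext ?_)⟩
    rintro ⟨⟨e, j⟩, s⟩
    rw [hFa]
    have h1 : (Φ.1.permCongr (modelPerm H w) ^ j.val) (Φ.1 (⟨e, 0⟩, false)) =
        Φ.1 (⟨e, j⟩, false) := by
      rw [permCongr_pow, modelPerm_pow]
      simp
    cases s
    · simpa [basedMap] using h1
    · simp only [basedMap, if_true, h1]
      exact (Φ.2 _ false).symm

end Model

end

/-! ### Admissible pairs of points at one vertex -/

section

variable {n m g : ℕ} {μ ν : n.Partition}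

namespace WGraph

variable {Γ : WGraph} {pos : Γ.V → Fin m} {k : ℕ} {σ : Perm (Letters n)} {a b : Letters n}
  {f f' f'' : Letters n → Γ.E} {v : Γ.V} {r s : Γ.E}

/-- The pair `(a, b)` can be used for a step at the vertex `v`, such that `a` and `b` lie
on cycles labelled `r` and `s` after the step. -/
structure IsAdmissible (Γ : WGraph) (pos : Γ.V → Fin m) (k : ℕ) (σ : Perm (Letters n))
    (f : Letters n → Γ.E) (v : Γ.V) (r s : Γ.E) (a b : Letters n) : Prop where
  ne : a ≠ b
  ne_tau : b ≠ tau n a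
  pos_eq : (pos v : ℕ) = k
  inv_iff : Γ.invV v = v ↔ f a = Γ.invE (f b)
  in_iff : ∀ e, Γ.tgt e = some v ↔ e = f a ∨ e = f b
  out_iff : ∀ e, Γ.src e = some v ↔ e = r ∨ e = s
  same_iff : r = s ↔ (twist a b σ).SameCycle a b
  same_tau_iff : r = Γ.invE s ↔ (twist a b σ).SameCycle a (tau n b)
  weight_left : Γ.weight r = (cyc (twist a b σ) a).card
  weight_right : Γ.weight s = (cyc (twist a b σ) b).card

theorem IsStepAt.isAdmissible (hG : Γ.IsGraded pos) (hs : Γ.IsState pos k σ f)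
    (hs' : Γ.IsState pos (k + 1) (twist a b σ) f') (h : Γ.IsStepAt pos k σ a b f f' v) :
    Γ.IsAdmissible pos k σ f v (f' a) (f' b) a b where
  ne := h.ne
  ne_tau := h.ne_tau
  pos_eq := h.pos_eq
  inv_iff := h.inv_iff
  in_iff e := by
    classical
    rw [← mem_inEdges, h.inEdges_eq hG hs hs', Finset.mem_insert, Finset.mem_singleton]
  out_iff e := by
    classical
    rw [← mem_outEdges, h.outEdges_eq hG hs hs', Finset.mem_insert, Finset.mem_singleton]
  same_iff := hs'.eq_iff a b
  same_tau_iff := by rw [← hs'.map_tau, hs'.eq_iff]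
  weight_left := hs'.weight_eq a
  weight_right := hs'.weight_eq b

/-- The labels after a step are determined by those of `a` and `b`. -/
theorem IsStepAt.eq_of_eq {v' : Γ.V} (hs' : Γ.IsState pos (k + 1) (twist a b σ) f')
    (h' : Γ.IsStepAt pos k σ a b f f' v) (hs'' : Γ.IsState pos (k + 1) (twist a b σ) f'')
    (h'' : Γ.IsStepAt pos k σ a b f f'' v') (ha : f' a = f'' a) (hb : f' b = f'' b) :
    f' = f'' := by
  ext x : 1
  by_cases hx : Touched σ a b x
  · rcases touched_twist.2 hx with h1 | h1 | h1 | h1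
    · rw [(hs'.eq_iff _ _).2 h1, (hs''.eq_iff _ _).2 h1, ha]
    · rw [(hs'.eq_iff _ _).2 h1, (hs''.eq_iff _ _).2 h1, hb]
    · rw [(hs'.eq_iff _ _).2 h1, (hs''.eq_iff _ _).2 h1, hs'.map_tau, hs''.map_tau, ha]
    · rw [(hs'.eq_iff _ _).2 h1, (hs''.eq_iff _ _).2 h1, hs'.map_tau, hs''.map_tau, hb]
  · rw [h'.untouched x hx, h''.untouched x hx]

open Classical in
/-- The labels after the step, if the cycles of `a` and `b` are labelled `r` and `s`. -/
def relabel (Γ : WGraph) (σ' : Perm (Letters n)) (a b : Letters n) (r s : Γ.E)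
    (f : Letters n → Γ.E) (x : Letters n) : Γ.E :=
  if σ'.SameCycle x a then r else if σ'.SameCycle x b then s
  else if σ'.SameCycle x (tau n a) then Γ.invE r
  else if σ'.SameCycle x (tau n b) then Γ.invE s else f x

namespace IsAdmissible

theorem relabel_left (x : Letters n) (hx : (twist a b σ).SameCycle x a) :
    Γ.relabel (twist a b σ) a b r s f x = r := if_pos hx

theorem relabel_right (h : Γ.IsAdmissible pos k σ f v r s a b) {x : Letters n}
    (hx : (twist a b σ).SameCycle x b) : Γ.relabel (twist a b σ) a b r s f x = s := by
  unfold relabel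
  split_ifs with h1
  · exact h.same_iff.2 (h1.symm.trans hx)
  · rfl

theorem relabel_tau_left (hG : Γ.IsGraded pos) (hs : Γ.IsState pos k σ f)
    (h : Γ.IsAdmissible pos k σ f v r s a b) {x : Letters n}
    (hx : (twist a b σ).SameCycle x (tau n a)) :
    Γ.relabel (twist a b σ) a b r s f x = Γ.invE r := by
  have hS := hs.sym.twist a b
  unfold relabel
  split_ifs with h1 h2
  · exact absurd (h1.symm.trans hx) (hS.not_sameCycle _)
  · rw [h.same_tau_iff.2 (hS.sameCycle_tau_left.1 (hx.symm.trans h2)), hG.invE_invE]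
  · rfl

theorem relabel_tau_right (hs : Γ.IsState pos k σ f)
    (h : Γ.IsAdmissible pos k σ f v r s a b) {x : Letters n}
    (hx : (twist a b σ).SameCycle x (tau n b)) :
    Γ.relabel (twist a b σ) a b r s f x = Γ.invE s := by
  have hS := hs.sym.twist a b
  unfold relabel
  split_ifs with h1 h2 h3
  · exact h.same_tau_iff.2 (h1.symm.trans hx)
  · exact absurd (h2.symm.trans hx) (hS.not_sameCycle _)
  · rw [h.same_iff.2 (hS.sameCycle_tau.1 (h3.symm.trans hx))]
  · rfl

theorem relabel_of_not_touched {x : Letters n} (hx : ¬ Touched σ a b x) :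
    Γ.relabel (twist a b σ) a b r s f x = f x := by
  have h1 := mt touched_twist.1 hx
  unfold Touched at h1
  push Not at h1
  unfold relabel
  rw [if_neg h1.1, if_neg h1.2.1, if_neg h1.2.2.1, if_neg h1.2.2.2]

theorem src_left (h : Γ.IsAdmissible pos k σ f v r s a b) : Γ.src r = some v :=
  (h.out_iff r).2 (Or.inl rfl)

theorem src_right (h : Γ.IsAdmissible pos k σ f v r s a b) : Γ.src s = some v :=
  (h.out_iff s).2 (Or.inr rfl)

theorem tgt_left (h : Γ.IsAdmissible pos k σ f v r s a b) : Γ.tgt (f a) = some v :=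
  (h.in_iff _).2 (Or.inl rfl)

theorem tgt_right (h : Γ.IsAdmissible pos k σ f v r s a b) : Γ.tgt (f b) = some v :=
  (h.in_iff _).2 (Or.inr rfl)

theorem exists_src_relabel (hG : Γ.IsGraded pos) (hs : Γ.IsState pos k σ f)
    (h : Γ.IsAdmissible pos k σ f v r s a b) {x : Letters n} (hx : Touched σ a b x) :
    ∃ u, Γ.src (Γ.relabel (twist a b σ) a b r s f x) = some u ∧ (pos u : ℕ) = k := by
  have hi : (pos (Γ.invV v) : ℕ) = k := by
    rw [← h.pos_eq, (hG.eq_iff v (Γ.invV v)).2 (Or.inr rfl)]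
  rcases touched_twist.2 hx with h1 | h1 | h1 | h1
  · exact ⟨v, by rw [relabel_left x h1, h.src_left], h.pos_eq⟩
  · exact ⟨v, by rw [h.relabel_right h1, h.src_right], h.pos_eq⟩
  · exact ⟨Γ.invV v, by rw [h.relabel_tau_left hG hs h1, hG.src_inv, h.src_left]; rfl, hi⟩
  · exact ⟨Γ.invV v, by rw [h.relabel_tau_right hs h1, hG.src_inv, h.src_right]; rfl, hi⟩

theorem relabel_eq_of_sameCycle (hG : Γ.IsGraded pos) (hs : Γ.IsState pos k σ f)
    (h : Γ.IsAdmissible pos k σ f v r s a b) {x y : Letters n}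
    (hxy : (twist a b σ).SameCycle x y) :
    Γ.relabel (twist a b σ) a b r s f x = Γ.relabel (twist a b σ) a b r s f y := by
  by_cases hx : Touched σ a b x
  · rcases touched_twist.2 hx with h1 | h1 | h1 | h1
    · rw [relabel_left x h1, relabel_left y (hxy.symm.trans h1)]
    · rw [h.relabel_right h1, h.relabel_right (hxy.symm.trans h1)]
    · rw [h.relabel_tau_left hG hs h1, h.relabel_tau_left hG hs (hxy.symm.trans h1)]
    · rw [h.relabel_tau_right hs h1, h.relabel_tau_right hs (hxy.symm.trans h1)]
  · have hy : ¬ Touched σ a b y := fun h' => hx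
      (touched_twist.1 ((touched_twist.2 h').of_sameCycle hxy))
    rw [relabel_of_not_touched hx, relabel_of_not_touched hy, hs.eq_iff]
    exact (sameCycle_twist_of_not_touched hx).1 hxy

theorem relabel_tau (hG : Γ.IsGraded pos) (hs : Γ.IsState pos k σ f)
    (h : Γ.IsAdmissible pos k σ f v r s a b) (x : Letters n) :
    Γ.relabel (twist a b σ) a b r s f (tau n x) =
      Γ.invE (Γ.relabel (twist a b σ) a b r s f x) := by
  have hS := hs.sym.twist a b
  by_cases hx : Touched σ a b x
  · rcases touched_twist.2 hx with h1 | h1 | h1 | h1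
    · rw [relabel_left x h1, h.relabel_tau_left hG hs (hS.sameCycle_tau.2 h1)]
    · rw [h.relabel_right h1, h.relabel_tau_right hs (hS.sameCycle_tau.2 h1)]
    · rw [h.relabel_tau_left hG hs h1, relabel_left _ (hS.sameCycle_tau_left.2 h1),
        hG.invE_invE]
    · rw [h.relabel_tau_right hs h1, h.relabel_right (hS.sameCycle_tau_left.2 h1),
        hG.invE_invE]
  · rw [relabel_of_not_touched hx, relabel_of_not_touched (mt hs.sym.touched_tau.1 hx),
      hs.map_tau]

theorem relabel_eq_iff (hT : Γ.IsTwistedMonodromy g μ ν) (hG : Γ.IsGraded pos)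
    (hs : Γ.IsState pos k σ f) (h : Γ.IsAdmissible pos k σ f v r s a b) (x y : Letters n) :
    Γ.relabel (twist a b σ) a b r s f x = Γ.relabel (twist a b σ) a b r s f y ↔
      (twist a b σ).SameCycle x y := by
  have hS := hs.sym.twist a b
  refine ⟨fun hxy => ?_, h.relabel_eq_of_sameCycle hG hs⟩
  -- new labels start at level `k`, old ones start below
  have hmix : ∀ {x y}, Touched σ a b x → ¬ Touched σ a b y →
      Γ.relabel (twist a b σ) a b r s f x ≠ Γ.relabel (twist a b σ) a b r s f y := by
    intro x y hx hy hxy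
    obtain ⟨u, hu, hk⟩ := h.exists_src_relabel hG hs hx
    rw [hxy, relabel_of_not_touched hy] at hu
    have := ((hs.alive_iff _).1 ⟨y, rfl⟩).1 u hu
    omega
  by_cases hx : Touched σ a b x
  · by_cases hy : Touched σ a b y
    · have hra : Γ.relabel (twist a b σ) a b r s f a = r := relabel_left a (SameCycle.refl _ _)
      have hrb : Γ.relabel (twist a b σ) a b r s f b = s := h.relabel_right (SameCycle.refl _ _)
      -- it is enough to compare the points `a`, `b` and their mirror images
      have key : ∀ c d, (c = a ∨ c = b) → (d = a ∨ d = b) →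
          (Γ.relabel (twist a b σ) a b r s f c = Γ.relabel (twist a b σ) a b r s f d →
            (twist a b σ).SameCycle c d) ∧
          (Γ.relabel (twist a b σ) a b r s f c = Γ.invE (Γ.relabel (twist a b σ) a b r s f d) →
            (twist a b σ).SameCycle c (tau n d)) := by
        rintro c d (rfl | rfl) (rfl | rfl)
        · exact ⟨fun _ => SameCycle.refl _ _, fun h' => absurd h'.symm (hT.invE_ne _)⟩
        · rw [hra, hrb]
          exact ⟨h.same_iff.1, h.same_tau_iff.1⟩
        · rw [hra, hrb]
          refine ⟨fun h' => (h.same_iff.1 h'.symm).symm, fun h' => ?_⟩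
          exact hS.sameCycle_tau_left.1 (h.same_tau_iff.1 (by rw [h', hG.invE_invE])).symm
        · exact ⟨fun _ => SameCycle.refl _ _, fun h' => absurd h'.symm (hT.invE_ne _)⟩
      have hrep : ∀ {x}, Touched σ a b x → ∃ c, (c = a ∨ c = b) ∧
          ((twist a b σ).SameCycle x c ∨ (twist a b σ).SameCycle x (tau n c)) := by
        intro x hx
        rcases touched_twist.2 hx with h1 | h1 | h1 | h1
        exacts [⟨a, Or.inl rfl, Or.inl h1⟩, ⟨b, Or.inr rfl, Or.inl h1⟩,
          ⟨a, Or.inl rfl, Or.inr h1⟩, ⟨b, Or.inr rfl, Or.inr h1⟩]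
      obtain ⟨c, hc, hxc⟩ := hrep hx
      obtain ⟨d, hd, hyd⟩ := hrep hy
      have hk := key c d hc hd
      have hinj : Function.Injective Γ.invE := fun e e' he => by
        rw [← hG.invE_invE e, he, hG.invE_invE]
      rcases hxc with hxc | hxc <;> rcases hyd with hyd | hyd <;>
        rw [h.relabel_eq_of_sameCycle hG hs hxc, h.relabel_eq_of_sameCycle hG hs hyd] at hxy <;>
        refine hxc.trans (SameCycle.trans ?_ hyd.symm)
      · exact hk.1 hxy
      · rw [h.relabel_tau hG hs] at hxy
        exact hk.2 hxy
      · rw [h.relabel_tau hG hs] at hxy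
        exact hS.sameCycle_tau_left.2 (hk.2 (by rw [← hxy, hG.invE_invE]))
      · rw [h.relabel_tau hG hs, h.relabel_tau hG hs] at hxy
        exact hS.sameCycle_tau.2 (hk.1 (hinj hxy))
    · exact absurd hxy (hmix hx hy)
  · by_cases hy : Touched σ a b y
    · exact absurd hxy.symm (hmix hy hx)
    · rw [relabel_of_not_touched hx, relabel_of_not_touched hy, hs.eq_iff] at hxy
      exact (sameCycle_twist_of_not_touched hx).2 hxy

/-- The cycles affected by an admissible pair are those that enter `v` or its mirror image. -/
theorem touched_iff_tgt (hG : Γ.IsGraded pos) (hs : Γ.IsState pos k σ f)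
    (h : Γ.IsAdmissible pos k σ f v r s a b) {x : Letters n} :
    Touched σ a b x ↔ Γ.tgt (f x) = some v ∨ Γ.tgt (f x) = some (Γ.invV v) := by
  rw [hs.touched_iff]
  constructor
  · rintro (h1 | h1 | h1 | h1) <;> rw [h1]
    · exact Or.inl h.tgt_left
    · exact Or.inl h.tgt_right
    · rw [hG.tgt_inv, h.tgt_left]; exact Or.inr rfl
    · rw [hG.tgt_inv, h.tgt_right]; exact Or.inr rfl
  · rintro (h1 | h1)
    · rcases (h.in_iff _).1 h1 with h1 | h1
      exacts [Or.inl h1, Or.inr (Or.inl h1)]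
    · have : Γ.tgt (Γ.invE (f x)) = some v := by
        rw [hG.tgt_inv, h1, Option.map_some, hG.invV_invV]
      rcases (h.in_iff _).1 this with h1 | h1
      · rw [← h1, hG.invE_invE]; tauto
      · rw [← h1, hG.invE_invE]; tauto

theorem relabel_alive_iff (hG : Γ.IsGraded pos) (hs : Γ.IsState pos k σ f)
    (h : Γ.IsAdmissible pos k σ f v r s a b) (e : Γ.E) :
    (∃ x, Γ.relabel (twist a b σ) a b r s f x = e) ↔ Γ.Alive pos (k + 1) e := by
  have hi : pos (Γ.invV v) = pos v := (hG.eq_iff _ _).2 (Or.inr (hG.invV_invV v).symm)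
  constructor
  · rintro ⟨x, rfl⟩
    by_cases hx : Touched σ a b x
    · obtain ⟨u, hu, hk⟩ := h.exists_src_relabel hG hs hx
      refine ⟨fun w hw => ?_, fun w hw => ?_⟩
      · rw [hu] at hw; cases hw; omega
      · have : (pos u : ℕ) < pos w := hG.lt_of_arrow u w ⟨_, hu, hw⟩
        omega
    · rw [relabel_of_not_touched hx]
      have hal := (hs.alive_iff _).1 ⟨x, rfl⟩
      refine ⟨fun w hw => Nat.lt_succ_of_lt (hal.1 w hw), fun w hw => ?_⟩
      have h1 := hal.2 w hw
      rcases h1.lt_or_eq with h2 | h2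
      · exact h2
      · have h3 : pos v = pos w := Fin.ext (h.pos_eq.trans h2)
        refine absurd ((h.touched_iff_tgt hG hs).2 ?_) hx
        rcases (hG.eq_iff _ _).1 h3 with rfl | rfl
        exacts [Or.inl hw, Or.inr hw]
  · intro he
    by_cases h1 : ∀ u, Γ.src e = some u → (pos u : ℕ) < k
    · obtain ⟨x, rfl⟩ := (hs.alive_iff e).2 ⟨h1, fun w hw => (Nat.lt_of_succ_le (he.2 w hw)).le⟩
      refine ⟨x, relabel_of_not_touched fun hx => ?_⟩
      have hk := h.pos_eq
      rcases (h.touched_iff_tgt hG hs).1 hx with h2 | h2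
      · have := he.2 _ h2
        omega
      · have := he.2 _ h2
        rw [hi] at this
        omega
    · push Not at h1
      obtain ⟨u, hu, huk⟩ := h1
      have h2 : pos v = pos u := by
        have := he.1 u hu
        have := h.pos_eq
        exact Fin.ext (by omega)
      rcases (hG.eq_iff _ _).1 h2 with rfl | rfl
      · rcases (h.out_iff e).1 hu with rfl | rfl
        exacts [⟨a, relabel_left a (SameCycle.refl _ _)⟩,
          ⟨b, h.relabel_right (SameCycle.refl _ _)⟩]
      · have h3 : Γ.src (Γ.invE e) = some v := by
          rw [hG.src_inv, hu, Option.map_some, hG.invV_invV]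
        rcases (h.out_iff _).1 h3 with h4 | h4
        · exact ⟨tau n a, by
            rw [h.relabel_tau_left hG hs (SameCycle.refl _ _), ← h4, hG.invE_invE]⟩
        · exact ⟨tau n b, by
            rw [h.relabel_tau_right hs (SameCycle.refl _ _), ← h4, hG.invE_invE]⟩

/-- An admissible pair and labels for the outgoing edges determine the state after the step. -/
theorem isState_relabel (hT : Γ.IsTwistedMonodromy g μ ν) (hG : Γ.IsGraded pos)
    (hs : Γ.IsState pos k σ f) (h : Γ.IsAdmissible pos k σ f v r s a b) :
    Γ.IsState pos (k + 1) (twist a b σ) (Γ.relabel (twist a b σ) a b r s f) where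
  sym := hs.sym.twist a b
  eq_iff := h.relabel_eq_iff hT hG hs
  map_tau := h.relabel_tau hG hs
  weight_eq x := by
    have hS := hs.sym.twist a b
    by_cases hx : Touched σ a b x
    · rcases touched_twist.2 hx with h1 | h1 | h1 | h1
      · rw [relabel_left x h1, cyc_eq_iff.2 h1, h.weight_left]
      · rw [h.relabel_right h1, cyc_eq_iff.2 h1, h.weight_right]
      · rw [h.relabel_tau_left hG hs h1, cyc_eq_iff.2 h1, hT.weight_inv, hS.card_cyc_tau,
          h.weight_left]
      · rw [h.relabel_tau_right hs h1, cyc_eq_iff.2 h1, hT.weight_inv, hS.card_cyc_tau,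
          h.weight_right]
    · rw [relabel_of_not_touched hx, hs.weight_eq]
      congr 1
      ext y
      rw [mem_cyc, mem_cyc, sameCycle_twist_of_not_touched hx]
  alive_iff := h.relabel_alive_iff hG hs

/-- The step from a state to its relabelling is a step at `v`. -/
theorem isStepAt_relabel (hG : Γ.IsGraded pos) (hs : Γ.IsState pos k σ f)
    (h : Γ.IsAdmissible pos k σ f v r s a b) :
    Γ.IsStepAt pos k σ a b f (Γ.relabel (twist a b σ) a b r s f) v where
  ne := h.ne
  ne_tau := h.ne_tau
  pos_eq := h.pos_eq
  tgt_left := h.tgt_left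
  tgt_right := h.tgt_right
  inv_iff := h.inv_iff
  untouched x hx := relabel_of_not_touched hx
  src_eq := by
    have hside : ∀ {x}, σ.SameCycle x a ∨ σ.SameCycle x b → Γ.tgt (f x) = some v := by
      rintro x (h1 | h1)
      · rw [(hs.eq_iff _ _).2 h1, h.tgt_left]
      · rw [(hs.eq_iff _ _).2 h1, h.tgt_right]
    have hside' : ∀ {x}, (twist a b σ).SameCycle x a ∨ (twist a b σ).SameCycle x b →
        Γ.src (Γ.relabel (twist a b σ) a b r s f x) = some v := by
      rintro x (h1 | h1)
      · rw [relabel_left x h1, h.src_left]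
      · rw [h.relabel_right h1, h.src_right]
    have hopp : ∀ {x}, Touched σ a b x → ¬ (σ.SameCycle x a ∨ σ.SameCycle x b) →
        σ.SameCycle (tau n x) a ∨ σ.SameCycle (tau n x) b := by
      intro x hx h1
      rw [hs.sym.sameCycle_tau_left, hs.sym.sameCycle_tau_left]
      unfold Touched at hx
      tauto
    have hopp' : ∀ {x}, Touched σ a b x →
        ¬ ((twist a b σ).SameCycle x a ∨ (twist a b σ).SameCycle x b) →
        (twist a b σ).SameCycle (tau n x) a ∨ (twist a b σ).SameCycle (tau n x) b := by
      intro x hx h1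
      have hS := hs.sym.twist a b
      rw [hS.sameCycle_tau_left, hS.sameCycle_tau_left]
      have := touched_twist.2 hx
      unfold Touched at this
      tauto
    intro x hx
    have hinv : ∀ {x}, Γ.tgt (f (tau n x)) = some v → Γ.tgt (f x) = some (Γ.invV v) := by
      intro x h1
      rw [← tau_tau x, hs.map_tau, hG.tgt_inv, h1]; rfl
    have hinv' : ∀ {x}, Γ.src (Γ.relabel (twist a b σ) a b r s f (tau n x)) = some v →
        Γ.src (Γ.relabel (twist a b σ) a b r s f x) = some (Γ.invV v) := by
      intro x h1
      rw [← tau_tau x, h.relabel_tau hG hs, hG.src_inv, h1]; rfl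
    by_cases hv : Γ.invV v = v
    · -- at a 4-valent vertex all labels involved are adjacent to `v`
      have h1 : Γ.tgt (f x) = some v := by
        by_cases h1 : σ.SameCycle x a ∨ σ.SameCycle x b
        · exact hside h1
        · rw [hinv (hside (hopp hx h1)), hv]
      rw [h1]
      by_cases h1 : (twist a b σ).SameCycle x a ∨ (twist a b σ).SameCycle x b
      · exact hside' h1
      · rw [hinv' (hside' (hopp' hx h1)), hv]
    · have hc : ¬ σ.SameCycle a (tau n b) := by
        rw [← hs.eq_iff, hs.map_tau, ← h.inv_iff]; exact hv
      have hor := sameCycle_or_twist hs.sym h.ne hc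
      by_cases h1 : σ.SameCycle x a ∨ σ.SameCycle x b
      · rw [hside h1, hside' ((hor x).2 h1)]
      · rw [hinv (hside (hopp hx h1)), hinv' (hside' (hopp' hx (mt (hor x).1 h1)))]

end IsAdmissible

end WGraph

end

/-! ### The number of steps at one vertex -/

section

variable {n m g : ℕ} {μ ν : n.Partition}

namespace WGraph

variable {Γ : WGraph} {pos : Γ.V → Fin m} {k : ℕ} {σ : Perm (Letters n)} {a b : Letters n}
  {f f' f'' : Letters n → Γ.E} {v : Γ.V} {p q r s : Γ.E}

open Classical in
/-- The edges that are alive at level `k`. -/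
def aliveEdges (Γ : WGraph) (pos : Γ.V → Fin m) (k : ℕ) : Finset Γ.E :=
  Finset.univ.filter (Γ.Alive pos k)

theorem isState_iff_isCycleLabelling :
    Γ.IsState pos k σ f ↔ IsCycleLabelling (Γ.aliveEdges pos k) Γ.invE Γ.weight σ f :=
  ⟨fun h => ⟨h.sym, h.eq_iff, h.map_tau, h.weight_eq, fun e => by
    simp [aliveEdges, h.alive_iff]⟩,
  fun h => ⟨h.sym, h.eq_iff, h.map_tau, h.weight_eq, fun e => by
    simp [aliveEdges, h.mem_iff]⟩⟩

theorem alive_of_tgt (hG : Γ.IsGraded pos) (hk : (pos v : ℕ) = k) (hp : Γ.tgt p = some v) :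
    Γ.Alive pos k p := by
  refine ⟨fun u hu => ?_, fun w hw => ?_⟩
  · rw [← hk]
    exact hG.lt_of_arrow u v ⟨p, hu, hp⟩
  · rw [hp] at hw; cases hw; exact hk.ge

theorem IsState.card_fiber [DecidableEq Γ.E] (hs : Γ.IsState pos k σ f)
    (hp : Γ.Alive pos k p) : (Finset.univ.filter fun x => f x = p).card = Γ.weight p := by
  rw [← (isState_iff_isCycleLabelling.1 hs).card_fiber (e := p) (by simpa [aliveEdges] using hp),
    Nat.card_eq_fintype_card, Fintype.card_subtype]

theorem IsGraded.ne_invE_of_tgt (hG : Γ.IsGraded pos) (hv : Γ.invV v ≠ v)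
    (hp : Γ.tgt p = some v) (hq : Γ.tgt q = some v) : p ≠ Γ.invE q := by
  rintro rfl
  rw [hG.tgt_inv, hq] at hp
  exact hv (by simpa using hp)

theorem IsGraded.ne_invE_of_src (hG : Γ.IsGraded pos) (hv : Γ.invV v ≠ v)
    (hp : Γ.src p = some v) (hq : Γ.src q = some v) : p ≠ Γ.invE q := by
  rintro rfl
  rw [hG.src_inv, hq] at hp
  exact hv (by simpa using hp)

theorem inEdges_eq_pair [DecidableEq Γ.E] (h : ∀ e, Γ.tgt e = some v ↔ e = p ∨ e = q) :
    Γ.inEdges v = {p, q} := by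
  ext e
  rw [mem_inEdges, h, Finset.mem_insert, Finset.mem_singleton]

theorem outEdges_eq_pair [DecidableEq Γ.E] (h : ∀ e, Γ.src e = some v ↔ e = r ∨ e = s) :
    Γ.outEdges v = {r, s} := by
  ext e
  rw [mem_outEdges, h, Finset.mem_insert, Finset.mem_singleton]

/-- Any two points on the two incoming cycles can be used to join them. -/
theorem isAdmissible_join (hT : Γ.IsTwistedMonodromy g μ ν) (hG : Γ.IsGraded pos)
    (hs : Γ.IsState pos k σ f) (hk : (pos v : ℕ) = k) (hv : Γ.invV v ≠ v)
    (hin : ∀ e, Γ.tgt e = some v ↔ e = f a ∨ e = f b)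
    (hout : ∀ e, Γ.src e = some v ↔ e = r ∨ e = r) (hab : f a ≠ f b) :
    Γ.IsAdmissible pos k σ f v r r a b := by
  classical
  have hta := (hin _).2 (Or.inl rfl)
  have htb := (hin _).2 (Or.inr rfl)
  have hr := (hout _).2 (Or.inl rfl)
  have h1 : ¬ σ.SameCycle a b := mt (hs.eq_iff a b).2 hab
  have h2 : f a ≠ Γ.invE (f b) := hG.ne_invE_of_tgt hv hta htb
  have h3 : ¬ σ.SameCycle a (tau n b) := by rwa [← hs.eq_iff, hs.map_tau]
  have h4 := sameCycle_twist_join' hs.sym h1 h3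
  have h5 : Γ.weight r = (cyc (twist a b σ) a).card := by
    have := hT.balanced v
    rw [inEdges_eq_pair hin, outEdges_eq_pair hout, Finset.sum_pair hab, Finset.pair_eq_singleton,
      Finset.sum_singleton, hs.weight_eq, hs.weight_eq] at this
    rw [card_cyc_twist_join hs.sym h1 h3, this]
  refine ⟨fun h => hab (h ▸ rfl), ?_, hk, ⟨fun h => absurd h hv, fun h => absurd h h2⟩, hin,
    hout, ⟨fun _ => h4, fun _ => rfl⟩, ⟨fun h => absurd h (hG.ne_invE_of_src hv hr hr), fun h =>
      absurd ((sameCycle_tau_twist_iff hs.sym).1 h) h3⟩, h5, ?_⟩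
  · rintro rfl
    exact h2 (by rw [hs.map_tau, hG.invE_invE])
  · rw [h5, cyc_eq_iff.2 h4]

/-- If a cycle is cut, then the weights of the outgoing edges fix the distance of the two points
along it. -/
theorem isAdmissible_cut_iff (hT : Γ.IsTwistedMonodromy g μ ν) (hG : Γ.IsGraded pos)
    (hs : Γ.IsState pos k σ f) (hk : (pos v : ℕ) = k) (hv : Γ.invV v ≠ v)
    (hin : ∀ e, Γ.tgt e = some v ↔ e = f a ∨ e = f a)
    (hout : ∀ e, Γ.src e = some v ↔ e = r ∨ e = s) (hrs : r ≠ s) :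
    (f b = f a ∧ Γ.IsAdmissible pos k σ f v r s a b) ↔ b = (σ ^ Γ.weight r) a := by
  classical
  have hta := (hin _).2 (Or.inl rfl)
  have hr := (hout _).2 (Or.inl rfl)
  have hs' := (hout _).2 (Or.inr rfl)
  have hw : (cyc σ a).card = Γ.weight r + Γ.weight s := by
    have := hT.balanced v
    rwa [inEdges_eq_pair hin, outEdges_eq_pair hout, Finset.sum_pair hrs,
      Finset.pair_eq_singleton, Finset.sum_singleton, hs.weight_eq] at this
  have hr0 := hT.weight_pos r
  have hs0 := hT.weight_pos s
  constructor
  · rintro ⟨hb, h⟩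
    obtain ⟨j, hj, rfl⟩ := exists_pow_of_sameCycle ((hs.eq_iff _ _).1 hb.symm)
    have hj0 : 0 < j := by
      refine Nat.pos_of_ne_zero ?_
      rintro rfl
      exact h.ne rfl
    rw [h.weight_left, (card_cyc_twist_of_pow hs.sym hj0 hj rfl).1]
  · intro hb
    have hab : σ.SameCycle a b := by
      rw [hb]; exact sameCycle_pow_right.2 (SameCycle.refl _ _)
    have hfb : f b = f a := ((hs.eq_iff _ _).2 hab).symm
    have h1 := card_cyc_twist_of_pow hs.sym hr0 (by omega) hb.symm
    have hne : a ≠ b := by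
      rw [hb]
      exact (pow_apply_ne_self hr0 (by omega)).symm
    have h2 : f a ≠ Γ.invE (f b) := hG.ne_invE_of_tgt hv hta (hfb ▸ hta)
    have h3 : ¬ σ.SameCycle a (tau n b) := by rwa [← hs.eq_iff, hs.map_tau]
    have h4 := card_cyc_twist_cut hs.sym hne hab
    refine ⟨hfb, hne, ?_, hk, ⟨fun h => absurd h hv, fun h => absurd h h2⟩,
      by rw [hfb]; exact hin, hout, ⟨fun h => absurd h hrs, fun h => absurd h h1.2⟩,
      ⟨fun h => absurd h (hG.ne_invE_of_src hv hr hs'), fun h =>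
      absurd ((sameCycle_tau_twist_iff hs.sym).1 h) h3⟩, h1.1.symm, by omega⟩
    rintro rfl
    exact hs.sym.not_sameCycle _ hab

/-- At a 4-valent vertex only `b = τ a` is excluded. -/
theorem isAdmissible_crossing_iff (hT : Γ.IsTwistedMonodromy g μ ν) (hG : Γ.IsGraded pos)
    (hs : Γ.IsState pos k σ f) (hk : (pos v : ℕ) = k) (hv : Γ.invV v = v)
    (hin : ∀ e, Γ.tgt e = some v ↔ e = f a ∨ e = Γ.invE (f a))
    (hout : ∀ e, Γ.src e = some v ↔ e = r ∨ e = Γ.invE r) :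
    (f b = Γ.invE (f a) ∧ Γ.IsAdmissible pos k σ f v r (Γ.invE r) a b) ↔
      (f b = Γ.invE (f a) ∧ b ≠ tau n a) := by
  classical
  refine and_congr_right fun hb => ⟨fun h => h.ne_tau, fun hne => ?_⟩
  have h4 := (hT.invV_eq_iff v).1 hv
  have hab : f a ≠ f b := by rw [hb]; exact (hT.invE_ne _).symm
  have hc : σ.SameCycle a (tau n b) := by
    rw [← hs.eq_iff, hs.map_tau, hb, hG.invE_invE]
  have hc' : σ.SameCycle b (tau n a) := (hs.sym.sameCycle_tau_left.1 hc.symm)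
  have h5 := (sameCycle_tau_twist_iff hs.sym).2 hc
  have hwr : Γ.weight r = Γ.weight (f a) :=
    hT.weight_four v h4 _ _ (Or.inl ((hout _).2 (Or.inl rfl))) (Or.inr ((hin _).2 (Or.inl rfl)))
  have hnab : a ≠ b := fun h => hab (h ▸ rfl)
  refine ⟨hnab, hne, hk, ⟨fun _ => by rw [hb, hG.invE_invE], fun _ => hv⟩, by rwa [hb], hout,
    ⟨fun h => absurd h.symm (hT.invE_ne r), fun h =>
      absurd (h.symm.trans h5) ((hs.sym.twist a b).not_sameCycle b)⟩,
    ⟨fun _ => h5, fun _ => (hG.invE_invE r).symm⟩, ?_, ?_⟩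
  · rw [hwr, hs.weight_eq, card_cyc_twist_crossing hs.sym hc]
  · rw [hT.weight_inv, hwr, ← hT.weight_inv, ← hb, hs.weight_eq, twist_comm,
      card_cyc_twist_crossing hs.sym hc']

/-- The three kinds of inner vertices. -/
theorem IsTwistedMonodromy.vertex_cases (hT : Γ.IsTwistedMonodromy g μ ν) (v : Γ.V) :
    (Γ.invV v ≠ v ∧ ∃ p q r, p ≠ q ∧ (∀ e, Γ.tgt e = some v ↔ e = p ∨ e = q) ∧
      ∀ e, Γ.src e = some v ↔ e = r) ∨
    (Γ.invV v ≠ v ∧ ∃ p r s, r ≠ s ∧ (∀ e, Γ.tgt e = some v ↔ e = p) ∧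
      ∀ e, Γ.src e = some v ↔ e = r ∨ e = s) ∨
    (Γ.invV v = v ∧ ∃ p r, (∀ e, Γ.tgt e = some v ↔ e = p ∨ e = Γ.invE p) ∧
      ∀ e, Γ.src e = some v ↔ e = r ∨ e = Γ.invE r) := by
  classical
  have hin := Finset.card_pos.2 (hT.no_source v)
  have hout := Finset.card_pos.2 (hT.no_sink v)
  by_cases hv : Γ.invV v = v
  · have h4 := (hT.invV_eq_iff v).1 hv
    obtain ⟨p, hp⟩ := hT.no_source v
    obtain ⟨r, hr⟩ := hT.no_sink v
    have hp' : Γ.invE p ∈ Γ.inEdges v := by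
      rw [mem_inEdges] at hp ⊢
      rw [hT.tgt_inv, hp, Option.map_some, hv]
    have hr' : Γ.invE r ∈ Γ.outEdges v := by
      rw [mem_outEdges] at hr ⊢
      rw [hT.src_inv, hr, Option.map_some, hv]
    have h1 : ({p, Γ.invE p} : Finset Γ.E) ⊆ Γ.inEdges v := by
      simp [Finset.insert_subset_iff, hp, hp']
    have h2 : ({r, Γ.invE r} : Finset Γ.E) ⊆ Γ.outEdges v := by
      simp [Finset.insert_subset_iff, hr, hr']
    have h1' := Finset.card_le_card h1
    have h2' := Finset.card_le_card h2
    rw [Finset.card_pair (hT.invE_ne _).symm] at h1' h2'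
    rw [valence] at h4
    have e1 := Finset.eq_of_subset_of_card_le h1
      (by rw [Finset.card_pair (hT.invE_ne _).symm]; omega)
    have e2 := Finset.eq_of_subset_of_card_le h2
      (by rw [Finset.card_pair (hT.invE_ne _).symm]; omega)
    refine Or.inr (Or.inr ⟨hv, p, r, fun e => ?_, fun e => ?_⟩)
    · rw [← mem_inEdges, ← e1]; simp
    · rw [← mem_outEdges, ← e2]; simp
  · have h3 : Γ.valence v = 3 := (hT.valence_eq v).resolve_right (mt (hT.invV_eq_iff v).2 hv)
    rw [valence] at h3
    have : (Γ.inEdges v).card = 2 ∧ (Γ.outEdges v).card = 1 ∨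
        (Γ.inEdges v).card = 1 ∧ (Γ.outEdges v).card = 2 := by omega
    rcases this with ⟨h1, h2⟩ | ⟨h1, h2⟩
    · obtain ⟨p, q, hpq, e1⟩ := Finset.card_eq_two.1 h1
      obtain ⟨r, e2⟩ := Finset.card_eq_one.1 h2
      refine Or.inl ⟨hv, p, q, r, hpq, fun e => ?_, fun e => ?_⟩
      · rw [← mem_inEdges, e1]; simp
      · rw [← mem_outEdges, e2]; simp
    · obtain ⟨p, e1⟩ := Finset.card_eq_one.1 h1
      obtain ⟨r, s, hrs, e2⟩ := Finset.card_eq_two.1 h2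
      refine Or.inr (Or.inl ⟨hv, p, r, s, hrs, fun e => ?_, fun e => ?_⟩)
      · rw [← mem_inEdges, e1]; simp
      · rw [← mem_outEdges, e2]; simp

open Classical in
/-- The number of pairs `(a, b)` for a step at `v` with given labels before and after it. -/
def localCount (Γ : WGraph) (v : Γ.V) : ℕ :=
  if Γ.invV v = v then Γ.vertexWeight v * (Γ.vertexWeight v - 1)
  else ∏ e ∈ Γ.inEdges v, Γ.weight e

theorem IsTwistedMonodromy.vertexWeight_eq (hT : Γ.IsTwistedMonodromy g μ ν)
    (hv : Γ.invV v = v) {e : Γ.E} (he : Γ.Incident e v) : Γ.vertexWeight v = Γ.weight e := by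
  classical
  have h4 := (hT.invV_eq_iff v).1 hv
  refine le_antisymm (Finset.sup_le fun e' he' => ?_) (Finset.le_sup (f := Γ.weight) ?_)
  · exact (hT.weight_four v h4 _ _ (by simpa [incidentEdges] using he') he).le
  · simpa [incidentEdges] using he

open Classical in
/-- With labels `p`, `q` of the incoming and `r`, `s` of the outgoing edges fixed (equal ones if
there is only one edge): for a join, `a` and `b` are arbitrary points of the two cycles. For a cut,
`a` is arbitrary and `b` is determined by the length of the cycle `r`. For a crossing, `a` is
arbitrary and `b` is any point of the mirror cycle except `τ a`. -/
theorem card_isAdmissible (hT : Γ.IsTwistedMonodromy g μ ν) (hG : Γ.IsGraded pos)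
    (hs : Γ.IsState pos k σ f) (hk : (pos v : ℕ) = k)
    (hin : ∀ e, Γ.tgt e = some v ↔ e = p ∨ e = q) (hout : ∀ e, Γ.src e = some v ↔ e = r ∨ e = s) :
    (Finset.univ.filter fun x : Letters n × Letters n =>
      f x.1 = p ∧ f x.2 = q ∧ Γ.IsAdmissible pos k σ f v r s x.1 x.2).card = Γ.localCount v := by
  have hp := (hin p).2 (Or.inl rfl)
  have hq := (hin q).2 (Or.inr rfl)
  have hr := (hout r).2 (Or.inl rfl)
  have hs' := (hout s).2 (Or.inr rfl)
  have hcp := hs.card_fiber (alive_of_tgt hG hk hp)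
  have hcq := hs.card_fiber (alive_of_tgt hG hk hq)
  unfold localCount
  rcases hT.vertex_cases v with ⟨hv, p', q', r', hpq, hin', hout'⟩ |
      ⟨hv, p', r', s', hrs, hin', hout'⟩ | ⟨hv, p', r', hin', hout'⟩
  · rw [if_neg hv]
    obtain rfl : r = s := ((hout' r).1 hr).trans ((hout' s).1 hs').symm
    have hne : p ≠ q := by
      rintro rfl
      have h1 := (hin p').1 ((hin' p').2 (Or.inl rfl))
      have h2 := (hin q').1 ((hin' q').2 (Or.inr rfl))
      rw [or_self] at h1 h2
      exact hpq (h1.trans h2.symm)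
    rw [inEdges_eq_pair hin, Finset.prod_pair hne, ← hcp, ← hcq, ← Finset.card_product]
    congr 1
    ext ⟨a, b⟩
    simp only [Finset.mem_filter, Finset.mem_univ, true_and, Finset.mem_product]
    constructor
    · exact fun h => ⟨h.1, h.2.1⟩
    · rintro ⟨rfl, rfl⟩
      exact ⟨rfl, rfl, isAdmissible_join hT hG hs hk hv hin hout hne⟩
  · rw [if_neg hv]
    obtain rfl : p = q := ((hin' p).1 hp).trans ((hin' q).1 hq).symm
    have hne : r ≠ s := by
      rintro rfl
      have h1 := (hout r').1 ((hout' r').2 (Or.inl rfl))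
      have h2 := (hout s').1 ((hout' s').2 (Or.inr rfl))
      rw [or_self] at h1 h2
      exact hrs (h1.trans h2.symm)
    rw [inEdges_eq_pair hin, Finset.pair_eq_singleton, Finset.prod_singleton, ← hcp]
    refine Finset.card_bij (fun x _ => x.1) ?_ ?_ ?_
    · intro x hx
      simpa using (Finset.mem_filter.1 hx).2.1
    · rintro ⟨a, b⟩ hx ⟨a', b'⟩ hx' hxx'
      obtain rfl : a = a' := hxx'
      obtain ⟨rfl, h1⟩ := (Finset.mem_filter.1 hx).2
      obtain ⟨-, h2⟩ := (Finset.mem_filter.1 hx').2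
      have e1 := (isAdmissible_cut_iff hT hG hs hk hv hin hout hne).1 h1
      have e2 := (isAdmissible_cut_iff hT hG hs hk hv hin hout hne).1 h2
      exact Prod.ext rfl (e1.trans e2.symm)
    · intro a ha
      obtain rfl : f a = p := by simpa using ha
      exact ⟨(a, (σ ^ Γ.weight r) a), by
        simpa using (isAdmissible_cut_iff hT hG hs hk hv hin hout hne).2 rfl, rfl⟩
  · rw [if_pos hv, hT.vertexWeight_eq hv (Or.inr hp)]
    have hqp : q = Γ.invE p := by
      have h1 : Γ.tgt (Γ.invE p) = some v := by rw [hT.tgt_inv, hp, Option.map_some, hv]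
      exact (((hin _).1 h1).resolve_left (hT.invE_ne p)).symm
    have hsr : s = Γ.invE r := by
      have h1 : Γ.src (Γ.invE r) = some v := by rw [hT.src_inv, hr, Option.map_some, hv]
      exact (((hout _).1 h1).resolve_left (hT.invE_ne r)).symm
    subst hqp hsr
    rw [hT.weight_inv] at hcq
    -- all pairs of points on the two cycles, except those with `b = τ a`
    have hfib : ∀ a ∈ Finset.univ.filter fun a => f a = p,
        (Finset.univ.filter fun b => f b = Γ.invE p ∧ b ≠ tau n a).card = Γ.weight p - 1 := by
      intro a ha
      obtain rfl : f a = p := by simpa using ha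
      rw [← hcq, ← Finset.card_erase_of_mem (a := tau n a) (by simp [hs.map_tau])]
      congr 1
      ext b
      simp [and_comm]
    rw [← hcp, ← smul_eq_mul, ← Finset.sum_const, hcp, ← Finset.sum_congr rfl hfib,
      ← Finset.card_sigma]
    refine Finset.card_bij (fun x _ => ⟨x.1, x.2⟩) ?_ ?_ ?_
    · rintro ⟨a, b⟩ hx
      obtain ⟨rfl, h1⟩ := (Finset.mem_filter.1 hx).2
      simpa using (isAdmissible_crossing_iff hT hG hs hk hv hin hout).1 h1
    · rintro ⟨a, b⟩ - ⟨a', b'⟩ - h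
      simpa using h
    · rintro ⟨a, b⟩ hx
      rw [Finset.mem_sigma, Finset.mem_filter, Finset.mem_filter] at hx
      obtain ⟨⟨-, rfl⟩, -, h1⟩ := hx
      exact ⟨(a, b), by
        simpa using (isAdmissible_crossing_iff hT hG hs hk hv hin hout).2 h1, rfl⟩

open Classical in
/-- The pairs of labels of a set of at most two edges. -/
def labelPairs {E : Type*} [Fintype E] (S : Finset E) : Finset (E × E) :=
  Finset.univ.filter fun x => S = {x.1, x.2}

theorem card_labelPairs_singleton {E : Type*} [Fintype E] (p : E) :
    (labelPairs ({p} : Finset E)).card = 1 := by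
  classical
  rw [Finset.card_eq_one]
  refine ⟨(p, p), ?_⟩
  ext ⟨x, y⟩
  simp only [labelPairs, Finset.mem_filter, Finset.mem_univ, true_and, Finset.mem_singleton,
    Prod.mk.injEq]
  constructor
  · intro h
    have hx : x ∈ ({x, y} : Finset E) := by simp
    have hy : y ∈ ({x, y} : Finset E) := by simp
    rw [← h] at hx hy
    simpa using And.intro hx hy
  · rintro ⟨rfl, rfl⟩
    simp

theorem card_labelPairs_pair {E : Type*} [Fintype E] [DecidableEq E] {p q : E} (hpq : p ≠ q) :
    (labelPairs ({p, q} : Finset E)).card = 2 := by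
  rw [Finset.card_eq_two]
  refine ⟨(p, q), (q, p), fun h => hpq (congrArg Prod.fst h), ?_⟩
  ext ⟨x, y⟩
  simp only [labelPairs, Finset.mem_filter, Finset.mem_univ, true_and, Finset.mem_singleton,
    Finset.mem_insert, Prod.mk.injEq]
  constructor
  · intro h
    have hp : p ∈ ({p, q} : Finset E) := by simp
    have hq : q ∈ ({p, q} : Finset E) := by simp
    have hx : x ∈ ({x, y} : Finset E) := by simp
    have hy : y ∈ ({x, y} : Finset E) := by simp
    have h' : ({p, q} : Finset E) = {x, y} := by convert h
    rw [h'] at hp hq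
    rw [← h'] at hx hy
    simp only [Finset.mem_insert, Finset.mem_singleton] at hp hq hx hy
    grind
  · rintro (⟨rfl, rfl⟩ | ⟨rfl, rfl⟩)
    · ext; simp
    · ext; simp [or_comm]

end WGraph

end

section

variable {n m g : ℕ} {μ ν : n.Partition}

namespace WGraph

variable {Γ : WGraph} {pos : Γ.V → Fin m} {k : ℕ} {σ : Perm (Letters n)} {a b : Letters n}
  {f f' f'' : Letters n → Γ.E} {v : Γ.V} {p q r s : Γ.E}

open Classical in
/-- The vertices numbered `k`. -/
def level (Γ : WGraph) (pos : Γ.V → Fin m) (k : ℕ) : Finset Γ.V :=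
  Finset.univ.filter fun v => (pos v : ℕ) = k

open Classical in
/-- The steps from the state `(σ, f)`, with the two points of the transposition ordered. -/
def orderedSteps (Γ : WGraph) (pos : Γ.V → Fin m) (k : ℕ) (σ : Perm (Letters n))
    (f : Letters n → Γ.E) : Finset ((Letters n × Letters n) × (Letters n → Γ.E)) :=
  Finset.univ.filter fun x => Γ.IsState pos (k + 1) (twist x.1.1 x.1.2 σ) x.2 ∧
    ∃ v, Γ.IsStepAt pos k σ x.1.1 x.1.2 f x.2 v

theorem mem_labelPairs_inEdges : (p, q) ∈ labelPairs (Γ.inEdges v) ↔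
    ∀ e, Γ.tgt e = some v ↔ e = p ∨ e = q := by
  classical
  simp only [labelPairs, Finset.mem_filter, Finset.mem_univ, true_and, Finset.ext_iff,
    mem_inEdges, Finset.mem_insert, Finset.mem_singleton]

theorem mem_labelPairs_outEdges : (r, s) ∈ labelPairs (Γ.outEdges v) ↔
    ∀ e, Γ.src e = some v ↔ e = r ∨ e = s := by
  classical
  simp only [labelPairs, Finset.mem_filter, Finset.mem_univ, true_and, Finset.ext_iff,
    mem_outEdges, Finset.mem_insert, Finset.mem_singleton]

/-- Steps are sorted by their vertex and by the labels of the two points before and after the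
step. -/
theorem card_orderedSteps_eq_sum (hT : Γ.IsTwistedMonodromy g μ ν) (hG : Γ.IsGraded pos)
    (hs : Γ.IsState pos k σ f) :
    (Γ.orderedSteps pos k σ f).card = ∑ v ∈ Γ.level pos k,
      (labelPairs (Γ.inEdges v)).card * (labelPairs (Γ.outEdges v)).card * Γ.localCount v := by
  classical
  let L : Γ.V → Finset ((Γ.E × Γ.E) × (Γ.E × Γ.E)) := fun v =>
    labelPairs (Γ.inEdges v) ×ˢ labelPairs (Γ.outEdges v)
  let A : Γ.V → (Γ.E × Γ.E) × (Γ.E × Γ.E) → Finset (Letters n × Letters n) := fun v l =>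
    Finset.univ.filter fun x => f x.1 = l.1.1 ∧ f x.2 = l.1.2 ∧
      Γ.IsAdmissible pos k σ f v l.2.1 l.2.2 x.1 x.2
  have h1 : ∀ v ∈ Γ.level pos k, ((L v).sigma (A v)).card =
      (labelPairs (Γ.inEdges v)).card * (labelPairs (Γ.outEdges v)).card * Γ.localCount v := by
    intro v hv
    have hk : (pos v : ℕ) = k := (Finset.mem_filter.1 hv).2
    rw [Finset.card_sigma, ← Finset.card_product, ← smul_eq_mul, ← Finset.sum_const]
    refine Finset.sum_congr rfl ?_
    rintro ⟨⟨p, q⟩, r, s⟩ hl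
    rw [Finset.mem_product] at hl
    exact card_isAdmissible hT hG hs hk (mem_labelPairs_inEdges.1 hl.1)
      (mem_labelPairs_outEdges.1 hl.2)
  rw [← Finset.sum_congr rfl h1, ← Finset.card_sigma]
  symm
  refine Finset.card_bij (fun x _ => (x.2.2, Γ.relabel (twist x.2.2.1 x.2.2.2 σ) x.2.2.1 x.2.2.2
    x.2.1.2.1 x.2.1.2.2 f)) ?_ ?_ ?_
  · rintro ⟨v, ⟨⟨p, q⟩, r, s⟩, a, b⟩ hx
    rw [Finset.mem_sigma, Finset.mem_sigma] at hx
    have hA := (Finset.mem_filter.1 hx.2.2).2.2.2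
    exact Finset.mem_filter.2 ⟨Finset.mem_univ _, hA.isState_relabel hT hG hs, v,
      hA.isStepAt_relabel hG hs⟩
  · rintro ⟨v, ⟨⟨p, q⟩, r, s⟩, a, b⟩ hx ⟨v', ⟨⟨p', q'⟩, r', s'⟩, a', b'⟩ hx' h
    rw [Finset.mem_sigma, Finset.mem_sigma] at hx hx'
    obtain ⟨-, e1, e2, hA⟩ := Finset.mem_filter.1 hx.2.2
    obtain ⟨-, e1', e2', hA'⟩ := Finset.mem_filter.1 hx'.2.2
    rw [Prod.mk.injEq, Prod.mk.injEq] at h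
    obtain ⟨⟨h3, h4⟩, h⟩ := h
    dsimp only at e1 e2 e1' e2' hA hA' h3 h4 h
    subst h3 h4 e1 e2 e1' e2'
    have hr := congrFun h a
    have hs := congrFun h b
    rw [IsAdmissible.relabel_left a (SameCycle.refl _ _),
      IsAdmissible.relabel_left a (SameCycle.refl _ _)] at hr
    rw [hA.relabel_right (SameCycle.refl _ _), hA'.relabel_right (SameCycle.refl _ _)] at hs
    have hv := hA.tgt_left.symm.trans hA'.tgt_left
    rw [Option.some_inj] at hv
    subst hr hs hv
    rfl
  · rintro ⟨⟨a, b⟩, f'⟩ hx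
    obtain ⟨-, hs', v, hv⟩ := Finset.mem_filter.1 hx
    have hA := hv.isAdmissible hG hs hs'
    refine ⟨⟨v, ((f a, f b), (f' a, f' b)), (a, b)⟩, ?_, ?_⟩
    · rw [Finset.mem_sigma, Finset.mem_sigma]
      exact ⟨Finset.mem_filter.2 ⟨Finset.mem_univ _, hv.pos_eq⟩,
        Finset.mem_product.2 ⟨mem_labelPairs_inEdges.2 hA.in_iff,
          mem_labelPairs_outEdges.2 hA.out_iff⟩,
        Finset.mem_filter.2 ⟨Finset.mem_univ _, rfl, rfl, hA⟩⟩
    · refine Prod.ext rfl ?_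
      exact IsStepAt.eq_of_eq (hA.isState_relabel hT hG hs) (hA.isStepAt_relabel hG hs) hs' hv
        (IsAdmissible.relabel_left a (SameCycle.refl _ _)) (hA.relabel_right (SameCycle.refl _ _))

theorem level_eq [DecidableEq Γ.V] (hG : Γ.IsGraded pos) (hk : (pos v : ℕ) = k) :
    Γ.level pos k = {v, Γ.invV v} := by
  ext u
  rw [level, Finset.mem_filter, Finset.mem_insert, Finset.mem_singleton, ← hG.eq_iff, ← hk,
    Fin.ext_iff]
  simp [eq_comm]

theorem inEdges_inv [DecidableEq Γ.E] (hG : Γ.IsGraded pos) (v : Γ.V) :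
    Γ.inEdges (Γ.invV v) = (Γ.inEdges v).image Γ.invE := by
  ext e
  simp only [mem_inEdges, Finset.mem_image]
  constructor
  · intro h
    exact ⟨Γ.invE e, by rw [hG.tgt_inv, h, Option.map_some, hG.invV_invV], hG.invE_invE e⟩
  · rintro ⟨e, h, rfl⟩
    rw [hG.tgt_inv, h]; rfl

theorem IsGraded.invE_injective (hG : Γ.IsGraded pos) : Function.Injective Γ.invE :=
  fun e e' he => by rw [← hG.invE_invE e, he, hG.invE_invE]

theorem prod_inEdges_inv (hT : Γ.IsTwistedMonodromy g μ ν) (hG : Γ.IsGraded pos) (v : Γ.V) :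
    ∏ e ∈ Γ.inEdges (Γ.invV v), Γ.weight e = ∏ e ∈ Γ.inEdges v, Γ.weight e := by
  classical
  rw [inEdges_inv hG, Finset.prod_image hG.invE_injective.injOn]
  exact Finset.prod_congr rfl fun e _ => hT.weight_inv e

/-- There are four ways to label the two points before and after the step. -/
theorem card_orderedSteps (hT : Γ.IsTwistedMonodromy g μ ν) (hG : Γ.IsGraded pos)
    (hs : Γ.IsState pos k σ f) (hk : (pos v : ℕ) = k) :
    (Γ.orderedSteps pos k σ f).card = 4 * Γ.localCount v := by
  classical
  have hcard : ∀ S : Finset Γ.E, S.card = 1 ∨ S.card = 2 → (labelPairs S).card = S.card := by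
    rintro S (h | h)
    · obtain ⟨p, rfl⟩ := Finset.card_eq_one.1 h
      rw [card_labelPairs_singleton, h]
    · obtain ⟨p, q, hpq, rfl⟩ := Finset.card_eq_two.1 h
      rw [card_labelPairs_pair hpq, h]
  have hval : ∀ v, ((Γ.inEdges v).card = 1 ∨ (Γ.inEdges v).card = 2) ∧
      ((Γ.outEdges v).card = 1 ∨ (Γ.outEdges v).card = 2) ∧
      (Γ.inEdges v).card * (Γ.outEdges v).card = if Γ.invV v = v then 4 else 2 := by
    intro v
    rcases hT.vertex_cases v with ⟨hv, p', q', r', hpq, hin', hout'⟩ |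
      ⟨hv, p', r', s', hrs, hin', hout'⟩ | ⟨hv, p', r', hin', hout'⟩
    · rw [inEdges_eq_pair hin', outEdges_eq_pair (fun e => (hout' e).trans (or_self_iff).symm),
        Finset.pair_eq_singleton, Finset.card_pair hpq, if_neg hv]
      simp
    · rw [inEdges_eq_pair (fun e => (hin' e).trans (or_self_iff).symm), outEdges_eq_pair hout',
        Finset.pair_eq_singleton, Finset.card_pair hrs, if_neg hv]
      simp
    · rw [inEdges_eq_pair hin', outEdges_eq_pair hout', Finset.card_pair (hT.invE_ne _).symm,
        Finset.card_pair (hT.invE_ne _).symm, if_pos hv]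
      simp
  rw [card_orderedSteps_eq_sum hT hG hs, level_eq hG hk]
  by_cases hv : Γ.invV v = v
  · have := (hval v).2.2
    rw [if_pos hv] at this
    rw [hv, Finset.pair_eq_singleton, Finset.sum_singleton, hcard _ (hval v).1,
      hcard _ (hval v).2.1, this]
  · have hv' : Γ.invV (Γ.invV v) ≠ Γ.invV v := by rw [hG.invV_invV]; exact fun h => hv h.symm
    have h1 := (hval v).2.2
    have h2 := (hval (Γ.invV v)).2.2
    rw [if_neg hv] at h1
    rw [if_neg hv'] at h2
    rw [Finset.sum_pair (fun h => hv h.symm), hcard _ (hval v).1,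
      hcard _ (hval v).2.1, hcard _ (hval _).1, hcard _ (hval _).2.1, h1, h2]
    unfold localCount
    rw [if_neg hv, if_neg hv', prod_inEdges_inv hT hG]
    ring

/-- Each transposition can be written in two ways as `(a b)`. -/
theorem card_isStep (hT : Γ.IsTwistedMonodromy g μ ν) (hG : Γ.IsGraded pos)
    (hs : Γ.IsState pos k σ f) (hk : (pos v : ℕ) = k) :
    Nat.card {x : Perm (Letters n) × (Perm (Letters n) × (Letters n → Γ.E)) //
      Γ.IsStep pos k (σ, f) x.1 x.2} = 2 * Γ.localCount v := by
  classical
  rw [Nat.card_eq_fintype_card, Fintype.card_subtype]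
  set P := Finset.univ.filter fun x : Perm (Letters n) × (Perm (Letters n) × (Letters n → Γ.E)) =>
    Γ.IsStep pos k (σ, f) x.1 x.2 with hP
  let π : (Letters n × Letters n) × (Letters n → Γ.E) →
      Perm (Letters n) × (Perm (Letters n) × (Letters n → Γ.E)) := fun x =>
    (swap x.1.1 x.1.2, (twist x.1.1 x.1.2 σ, x.2))
  have hmaps : ∀ x ∈ Γ.orderedSteps pos k σ f, π x ∈ P := by
    rintro ⟨⟨a, b⟩, f'⟩ hx
    obtain ⟨-, hs', hv⟩ := Finset.mem_filter.1 hx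
    exact Finset.mem_filter.2 ⟨Finset.mem_univ _, hs', a, b, rfl, rfl, hv⟩
  have hfib : ∀ y ∈ P, ((Γ.orderedSteps pos k σ f).filter fun x => π x = y).card = 2 := by
    rintro ⟨η, σ', f'⟩ hy
    obtain ⟨-, hs', a, b, h1, h2, u, hu⟩ := Finset.mem_filter.1 hy
    dsimp only at hs' h1 h2 hu
    subst h1 h2
    rw [Finset.card_eq_two]
    refine ⟨((a, b), f'), ((b, a), f'), fun h => hu.ne ?_, ?_⟩
    · simp only [Prod.mk.injEq] at h
      exact h.1.1
    · ext ⟨⟨c, d⟩, f''⟩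
      simp only [Finset.mem_filter, Finset.mem_insert, Finset.mem_singleton, π, Prod.mk.injEq]
      constructor
      · rintro ⟨-, h3, -, rfl⟩
        rcases eq_or_eq_of_swap_eq hu.ne h3.symm with ⟨rfl, rfl⟩ | ⟨rfl, rfl⟩
        · exact Or.inl ⟨⟨rfl, rfl⟩, rfl⟩
        · exact Or.inr ⟨⟨rfl, rfl⟩, rfl⟩
      · rintro (⟨⟨rfl, rfl⟩, rfl⟩ | ⟨⟨rfl, rfl⟩, rfl⟩)
        · exact ⟨Finset.mem_filter.2 ⟨Finset.mem_univ _, hs', u, hu⟩, rfl, rfl, rfl⟩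
        · exact ⟨Finset.mem_filter.2 ⟨Finset.mem_univ _, by rwa [twist_comm], u, hu.symm hG⟩,
            swap_comm _ _, twist_comm _ _ _, rfl⟩
  have h1 := Finset.card_eq_sum_card_fiberwise hmaps
  rw [Finset.sum_congr rfl hfib, Finset.sum_const, card_orderedSteps hT hG hs hk, smul_eq_mul]
    at h1
  omega

/-- The local count in a form that treats all vertices numbered `k` alike: a pair of 3-valent
vertices contributes twice, and so does a 4-valent vertex, which has two incoming edges of
weight `ω_V`. -/
theorem sq_localCount (hT : Γ.IsTwistedMonodromy g μ ν) (hG : Γ.IsGraded pos)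
    (hk : (pos v : ℕ) = k) : (Γ.localCount v) ^ 2 =
      ∏ u ∈ Γ.level pos k, (((if Γ.valence u = 4 then Γ.vertexWeight u - 1 else 1) ^ 2) *
        ∏ e ∈ Γ.inEdges u, Γ.weight e) := by
  classical
  rw [level_eq hG hk]
  unfold localCount
  simp only [← hT.invV_eq_iff]
  by_cases hv : Γ.invV v = v
  · rw [hv, Finset.pair_eq_singleton, Finset.prod_singleton,
      if_pos (rfl : v = v), if_pos hv]
    rcases hT.vertex_cases v with ⟨hv', -⟩ | ⟨hv', -⟩ | ⟨-, p, r, hin, hout⟩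
    · exact absurd hv hv'
    · exact absurd hv hv'
    · rw [inEdges_eq_pair hin, Finset.prod_pair (hT.invE_ne _).symm, hT.weight_inv,
        hT.vertexWeight_eq hv (Or.inr ((hin p).2 (Or.inl rfl)))]
      ring
  · have hv' : Γ.invV (Γ.invV v) ≠ Γ.invV v := by rw [hG.invV_invV]; exact fun h => hv h.symm
    rw [Finset.prod_pair (fun h => hv h.symm), if_neg hv, if_neg hv, if_neg hv',
      prod_inEdges_inv hT hG]
    ring

end WGraph

end

/-! ### Counting the labelled factorisations of a graph -/

section

/-- Sequences of states and steps, where the number of steps possible from a state depends only on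
its level. -/
theorem card_paths {S T : Type*} [Finite S] [Finite T] (R : ℕ → S → T → S → Prop)
    (G : ℕ → S → Prop) (c : ℕ → ℕ) (m : ℕ)
    (hR : ∀ k < m, ∀ s t s', G k s → R k s t s' → G (k + 1) s')
    (hc : ∀ k < m, ∀ s, G k s → Nat.card {y : T × S // R k s y.1 y.2} = c k) :
    Nat.card {p : (Fin (m + 1) → S) × (Fin m → T) //
      G 0 (p.1 0) ∧ ∀ i : Fin m, R i (p.1 i.castSucc) (p.2 i) (p.1 i.succ)} =
      Nat.card {s // G 0 s} * ∏ i ∈ Finset.range m, c i := by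
  induction m with
  | zero =>
    rw [Finset.range_zero, Finset.prod_empty, mul_one]
    refine Nat.card_congr (Equiv.ofBijective (fun p => ⟨p.1.1 0, p.2.1⟩) ⟨?_, ?_⟩)
    · rintro ⟨⟨s, η⟩, hp⟩ ⟨⟨s', η'⟩, hp'⟩ h
      have h0 : s 0 = s' 0 := congrArg Subtype.val h
      refine Subtype.ext (Prod.ext (funext fun i => ?_) (funext fun i => i.elim0))
      obtain rfl : i = 0 := Fin.fin_one_eq_zero i
      exact h0
    · rintro ⟨s, hs⟩
      exact ⟨⟨(fun _ => s, Fin.elim0), hs, fun i => i.elim0⟩, rfl⟩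
  | succ m ih =>
    have ih' := ih (fun k hk => hR k (hk.trans m.lt_succ_self))
      (fun k hk => hc k (hk.trans m.lt_succ_self))
    rw [Finset.prod_range_succ, ← mul_assoc, ← ih']
    let C := {p : (Fin (m + 1) → S) × (Fin m → T) //
      G 0 (p.1 0) ∧ ∀ i : Fin m, R i (p.1 i.castSucc) (p.2 i) (p.1 i.succ)}
    have hlast : ∀ p : C, G m (p.1.1 (Fin.last m)) := by
      rintro ⟨⟨s, η⟩, h0, hp⟩
      have : ∀ i : Fin (m + 1), G i (s i) := by
        intro i
        induction i using Fin.induction with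
        | zero => exact h0
        | succ i hi => exact hR i (i.2.trans m.lt_succ_self) _ _ _ hi (hp i)
      exact this (Fin.last m)
    let F : (Σ p : C, {y : T × S // R m (p.1.1 (Fin.last m)) y.1 y.2}) →
        {p : (Fin (m + 1 + 1) → S) × (Fin (m + 1) → T) //
          G 0 (p.1 0) ∧ ∀ i : Fin (m + 1), R i (p.1 i.castSucc) (p.2 i) (p.1 i.succ)} := fun x =>
      ⟨(Fin.snoc x.1.1.1 x.2.1.2, Fin.snoc x.1.1.2 x.2.1.1), by
        obtain ⟨⟨⟨s, η⟩, h0, hp⟩, ⟨y, s'⟩, hy⟩ := x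
        dsimp only at hy ⊢
        refine ⟨?_, fun i => ?_⟩
        · have : (0 : Fin (m + 1 + 1)) = Fin.castSucc 0 := rfl
          rw [this, Fin.snoc_castSucc]
          exact h0
        · rw [Fin.snoc_castSucc]
          induction i using Fin.lastCases with
          | last => simpa using hy
          | cast i =>
            rw [Fin.snoc_castSucc, ← Fin.castSucc_succ, Fin.snoc_castSucc]
            exact hp i⟩
    have hF : Function.Bijective F := by
      constructor
      · rintro ⟨⟨⟨s, η⟩, hp⟩, ⟨y, t⟩, hy⟩ ⟨⟨⟨s', η'⟩, hp'⟩, ⟨y', t'⟩, hy'⟩ h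
        have h1 := congrArg Subtype.val h
        rw [Prod.mk.injEq] at h1
        obtain ⟨rfl, rfl⟩ := Fin.snoc_injective2 h1.1
        obtain ⟨rfl, rfl⟩ := Fin.snoc_injective2 h1.2
        rfl
      · rintro ⟨⟨s, η⟩, h0, hp⟩
        refine ⟨⟨⟨(Fin.init s, Fin.init η), h0, fun i => ?_⟩,
          ⟨(η (Fin.last m), s (Fin.last (m + 1))), ?_⟩⟩, ?_⟩
        · exact hp i.castSucc
        · exact hp (Fin.last m)
        · exact Subtype.ext (Prod.ext (Fin.snoc_init_self s) (Fin.snoc_init_self η))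
    have := Fintype.ofFinite C
    rw [← Nat.card_congr (Equiv.ofBijective F hF), Nat.card_sigma,
      Finset.sum_congr rfl fun p _ => hc m m.lt_succ_self _ (hlast p), Finset.sum_const,
      smul_eq_mul, Finset.card_univ, Nat.card_eq_fintype_card]

section Transversal

variable {E : Type*} {ι : E → E} {S H : Finset E}

/-- One element of each orbit of an involution without fixed points. -/
theorem exists_transversal [Finite E] (hι : ∀ e, ι (ι e) = e) (hne : ∀ e, ι e ≠ e)
    (hS : ∀ e ∈ S, ι e ∈ S) :
    ∃ H : Finset E, (∀ e ∈ H, ι e ∉ H) ∧ ∀ e, e ∈ S ↔ e ∈ H ∨ ι e ∈ H := by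
  classical
  obtain ⟨N, ⟨c⟩⟩ := Finite.exists_equiv_fin E
  refine ⟨S.filter fun e => c e < c (ι e), fun e he he' => ?_, fun e => ⟨fun he => ?_, ?_⟩⟩
  · rw [Finset.mem_filter, hι] at *
    exact lt_asymm he.2 he'.2
  · simp only [Finset.mem_filter, hι]
    rcases lt_trichotomy (c e) (c (ι e)) with h | h | h
    · exact Or.inl ⟨he, h⟩
    · exact absurd (c.injective h).symm (hne e)
    · exact Or.inr ⟨hS e he, h⟩
  · rintro (h | h)
    · exact (Finset.mem_filter.1 h).1
    · rw [← hι e]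
      exact hS _ (Finset.mem_filter.1 h).1

theorem prod_transversal [DecidableEq E] {M : Type*} [CommMonoid M] (hι : ∀ e, ι (ι e) = e)
    (hH : ∀ e ∈ H, ι e ∉ H) (hS : ∀ e, e ∈ S ↔ e ∈ H ∨ ι e ∈ H) (w : E → M)
    (hw : ∀ e, w (ι e) = w e) : ∏ e ∈ S, w e = (∏ e ∈ H, w e) ^ 2 := by
  have hinj : Function.Injective ι := fun e e' he => by rw [← hι e, he, hι]
  have h1 : S = H ∪ H.image ι := by
    ext e
    rw [hS, Finset.mem_union, Finset.mem_image]
    refine or_congr_right ⟨fun h => ⟨_, h, hι e⟩, ?_⟩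
    rintro ⟨e', h, rfl⟩
    rwa [hι]
  rw [h1, Finset.prod_union, Finset.prod_image hinj.injOn, Finset.prod_congr rfl fun e _ => hw e,
    sq]
  rw [Finset.disjoint_left]
  intro e he he'
  obtain ⟨e', h, rfl⟩ := Finset.mem_image.1 he'
  exact hH e' h he

end Transversal

variable {n m g : ℕ} {μ ν : n.Partition}

namespace WGraph

variable {Γ : WGraph} {pos : Γ.V → Fin m}

theorem aliveEdges_zero : Γ.aliveEdges pos 0 = Γ.inwardEnds := by
  classical
  ext e
  simp only [aliveEdges, inwardEnds, Finset.mem_filter, Finset.mem_univ, true_and, Alive,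
    Nat.not_lt_zero, Nat.zero_le, imp_true_iff, and_true]
  cases Γ.src e <;> simp

theorem IsTwistedMonodromy.sum_inward (hT : Γ.IsTwistedMonodromy g μ ν) :
    ∑ e ∈ Γ.inwardEnds, Γ.weight e = 2 * n := by
  change (Γ.inwardEnds.val.map Γ.weight).sum = _
  rw [hT.inward, Multiset.sum_add, μ.parts_sum, two_mul]

/-- The number of labelled initial permutations. -/
theorem sq_card_initial (hT : Γ.IsTwistedMonodromy g μ ν) (pos : Γ.V → Fin m) :
    Nat.card {s : Perm (Letters n) × (Letters n → Γ.E) // Γ.IsState pos 0 s.1 s.2} ^ 2 *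
      ∏ e ∈ Γ.inwardEnds, Γ.weight e = (2 * n).doubleFactorial ^ 2 := by
  classical
  have hstab : ∀ e ∈ Γ.inwardEnds, Γ.invE e ∈ Γ.inwardEnds := by
    intro e he
    simp only [inwardEnds, Finset.mem_filter, Finset.mem_univ, true_and] at he ⊢
    rw [hT.src_inv, he]; rfl
  obtain ⟨H, hH, hS⟩ := exists_transversal hT.invE_invE hT.invE_ne hstab
  have hsum : ∑ e ∈ H, Γ.weight e = n := by
    have h1 := prod_transversal (M := Multiplicative ℕ) hT.invE_invE hH hS
      (fun e => Multiplicative.ofAdd (Γ.weight e)) fun e => by rw [hT.weight_inv]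
    rw [← ofAdd_sum, ← ofAdd_sum, ← ofAdd_nsmul] at h1
    have h2 := Multiplicative.ofAdd.injective h1
    rw [hT.sum_inward, smul_eq_mul] at h2
    omega
  have h1 := card_isCycleLabelling hT.invE_invE hH hS hT.weight_inv hT.weight_pos hsum
  have h2 : Nat.card {s : Perm (Letters n) × (Letters n → Γ.E) // Γ.IsState pos 0 s.1 s.2} =
      Nat.card {s : Perm (Letters n) × (Letters n → Γ.E) //
        IsCycleLabelling Γ.inwardEnds Γ.invE Γ.weight s.1 s.2} := by
    simp only [isState_iff_isCycleLabelling, aliveEdges_zero]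
  rw [prod_transversal hT.invE_invE hH hS _ hT.weight_inv, ← mul_pow,
    Nat.doubleFactorial_two_mul, ← h1, h2]

/-- Every edge enters exactly one inner vertex, except the outward ends. -/
theorem prod_inEdges (hT : Γ.IsTwistedMonodromy g μ ν) :
    ∏ u, ∏ e ∈ Γ.inEdges u, Γ.weight e =
      (∏ e ∈ Γ.internalEdges, Γ.weight e) * ∏ e ∈ Γ.inwardEnds, Γ.weight e := by
  classical
  rw [← Finset.prod_biUnion, ← Finset.prod_union]
  · congr 1
    ext e
    have := hT.attached e
    simp only [Finset.mem_biUnion, Finset.mem_univ, true_and, mem_inEdges, Finset.mem_union,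
      internalEdges, inwardEnds, Finset.mem_filter, IsInternal]
    cases h1 : Γ.src e <;> cases h2 : Γ.tgt e <;> simp_all
  · rw [Finset.disjoint_left]
    intro e he he'
    simp only [internalEdges, inwardEnds, Finset.mem_filter, IsInternal] at he he'
    exact he.2.1 he'.2
  · intro u _ v _ huv
    rw [Function.onFun, Finset.disjoint_left]
    intro e he he'
    rw [mem_inEdges] at he he'
    exact huv (Option.some_injective _ (he.symm.trans he'))

theorem sq_prod_internalPairs (hT : Γ.IsTwistedMonodromy g μ ν) :
    (∏ P ∈ Γ.internalPairs, P.sup Γ.weight) ^ 2 = ∏ e ∈ Γ.internalEdges, Γ.weight e := by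
  classical
  have hmaps : ∀ e ∈ Γ.internalEdges, ({e, Γ.invE e} : Finset Γ.E) ∈ Γ.internalPairs :=
    fun e he => Finset.mem_image.2 ⟨e, he, rfl⟩
  rw [← Finset.prod_fiberwise_of_maps_to hmaps, ← Finset.prod_pow]
  refine Finset.prod_congr rfl fun P hP => ?_
  obtain ⟨e, he, rfl⟩ := Finset.mem_image.1 hP
  have hint : Γ.invE e ∈ Γ.internalEdges := by
    simp only [internalEdges, Finset.mem_filter, Finset.mem_univ, true_and, IsInternal] at he ⊢
    rw [hT.src_inv, hT.tgt_inv]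
    simpa using he
  have h1 : (Γ.internalEdges.filter fun e' => ({e', Γ.invE e'} : Finset Γ.E) = {e, Γ.invE e}) =
      {e, Γ.invE e} := by
    ext e'
    simp only [Finset.mem_filter, Finset.mem_insert, Finset.mem_singleton]
    constructor
    · rintro ⟨-, h⟩
      have : e' ∈ ({e', Γ.invE e'} : Finset Γ.E) := by simp
      rw [h] at this
      simpa using this
    · rintro (rfl | rfl)
      · exact ⟨he, rfl⟩
      · exact ⟨hint, by rw [hT.invE_invE, Finset.pair_comm]⟩
  rw [h1, Finset.prod_pair (hT.invE_ne e).symm, Finset.sup_insert, Finset.sup_singleton,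
    hT.weight_inv, sup_idem, sq]

end WGraph

namespace MonodromyGraph

variable (M : MonodromyGraph g μ ν)

/-- The labelled factorisations of a graph. -/
abbrev Chain : Type :=
  {p : (Fin (numBranch g μ ν + 1) → Perm (Letters n) × (Letters n → M.graph.E)) ×
    (Fin (numBranch g μ ν) → Perm (Letters n)) // M.graph.IsChain M.pos p.1 p.2}

/-- The number of continuations of a state depends only on the vertex that comes next. -/
theorem card_chain_eq_prod {v : Fin (numBranch g μ ν) → M.graph.V} (hv : ∀ i, M.pos (v i) = i) :
    Nat.card M.Chain =
    Nat.card {s : Perm (Letters n) × (Letters n → M.graph.E) //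
      M.graph.IsState M.pos 0 s.1 s.2} *
    ∏ i : Fin (numBranch g μ ν), 2 * M.graph.localCount (v i) := by
  classical
  let c : ℕ → ℕ := fun k => if h : k < numBranch g μ ν then
    2 * M.graph.localCount (v ⟨k, h⟩) else 0
  have h1 := card_paths (fun k s η s' => M.graph.IsStep M.pos k s η s')
    (fun k s => M.graph.IsState M.pos k s.1 s.2) c (numBranch g μ ν)
    (fun k _ s t s' _ h => h.1) (fun k hk s hs => by
      rw [WGraph.card_isStep M.isTwisted M.isGraded hs (v := v ⟨k, hk⟩) (by rw [hv])]
      simp [c, hk])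
  rw [Finset.prod_range] at h1
  have h2 : ∀ i : Fin (numBranch g μ ν), c i = 2 * M.graph.localCount (v i) := fun i => by
    simp [c]
  rw [← Finset.prod_congr rfl fun i _ => h2 i, ← h1]
  exact Nat.card_congr (Equiv.subtypeEquivRight fun p => ⟨fun h => ⟨h.init, h.step⟩,
    fun h => ⟨h.1, h.2⟩⟩)

/-- The number of labelled factorisations of a graph is its weight, times `(2n)!!`. -/
theorem card_chain : (Nat.card M.Chain : ℚ) =
    (2 * n).doubleFactorial * M.graph.weightProd (numBranch g μ ν) := by
  classical
  set b := numBranch g μ ν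
  let W : ℕ := 2 ^ b * (∏ v ∈ M.graph.fourValent, (M.graph.vertexWeight v - 1)) *
    ∏ P ∈ M.graph.internalPairs, P.sup M.graph.weight
  have hT := M.isTwisted
  have hW : M.graph.weightProd b = W := by
    unfold WGraph.weightProd
    simp only [W, Nat.cast_mul, Nat.cast_pow, Nat.cast_prod, Nat.cast_ofNat]
    congr 2
    refine Finset.prod_congr rfl fun v hv => ?_
    have h4 : M.graph.valence v = 4 := (Finset.mem_filter.1 hv).2
    obtain ⟨e, he⟩ := hT.no_source v
    have h1 : 1 ≤ M.graph.vertexWeight v := by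
      rw [hT.vertexWeight_eq ((hT.invV_eq_iff v).2 h4) (Or.inr (WGraph.mem_inEdges.1 he))]
      exact hT.weight_pos e
    rw [Nat.cast_sub h1, Nat.cast_one]
  rw [hW, ← Nat.cast_mul, Nat.cast_inj]
  -- All orbits of the involution on edges are counted twice in products over all edges, so that
  -- squares are compared. The inward ends are cancelled: they enter through the local counts and
  -- through the number of initial states.
  refine Nat.pow_left_injective (n := 2) two_ne_zero ?_
  have hpos : 0 < ∏ e ∈ M.graph.inwardEnds, M.graph.weight e :=
    Finset.prod_pos fun e _ => hT.weight_pos e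
  refine Nat.eq_of_mul_eq_mul_right hpos ?_
  choose v hv using M.isOrder.surjective
  have hloc : ∏ i : Fin b, (M.graph.localCount (v i)) ^ 2 =
      (∏ v ∈ M.graph.fourValent, (M.graph.vertexWeight v - 1)) ^ 2 *
      ((∏ e ∈ M.graph.internalEdges, M.graph.weight e) *
        ∏ e ∈ M.graph.inwardEnds, M.graph.weight e) := by
    have h0 : ∀ i : Fin b, _ := fun i => WGraph.sq_localCount hT M.isGraded
      (v := v i) (k := (i : ℕ)) (by rw [hv])
    rw [Finset.prod_congr rfl fun i _ => h0 i, ← Finset.prod_range fun k => ∏ u ∈ M.graph.level M.pos k,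
        (((if M.graph.valence u = 4 then M.graph.vertexWeight u - 1 else 1) ^ 2) *
          ∏ e ∈ M.graph.inEdges u, M.graph.weight e)]
    have h1 : ∀ u ∈ (Finset.univ : Finset M.graph.V), (M.pos u : ℕ) ∈ Finset.range b :=
      fun u _ => Finset.mem_range.2 (M.pos u).2
    have h2 := Finset.prod_fiberwise_of_maps_to h1 fun u =>
      ((if M.graph.valence u = 4 then M.graph.vertexWeight u - 1 else 1) ^ 2) *
        ∏ e ∈ M.graph.inEdges u, M.graph.weight e
    rw [Finset.prod_mul_distrib, WGraph.prod_inEdges hT, Finset.prod_pow,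
      ← Finset.prod_filter] at h2
    convert h2 using 2
    · simp [WGraph.level]
    · congr 2
  rw [M.card_chain_eq_prod hv]
  simp only [W, mul_pow]
  rw [WGraph.sq_prod_internalPairs hT, ← WGraph.sq_card_initial hT M.pos, ← Finset.prod_pow]
  simp only [mul_pow]
  rw [Finset.prod_mul_distrib, hloc, Finset.prod_const, Finset.card_univ, Fintype.card_fin,
    ← pow_mul, ← pow_mul, mul_comm 2 b]
  ring

end MonodromyGraph

end

/-! ### Finiteness of the set of isomorphism classes -/

section

variable {n g : ℕ} {μ ν : n.Partition}

instance finite_iso (Γ Δ : WGraph) : Finite (WGraph.Iso Γ Δ) :=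
  Finite.of_injective (fun φ => (φ.onV, φ.onE)) fun φ ψ h => by
    rw [Prod.mk.injEq] at h
    exact WGraph.Iso.ext h.1 h.2

instance MonodromyGraph.finite_iso (M N : MonodromyGraph g μ ν) : Finite (M.Iso N) :=
  inferInstanceAs (Finite {φ : WGraph.Iso M.graph N.graph // ∀ v, N.pos (φ.onV v) = M.pos v})

theorem MonodromyGraph.card_iso_pos (M : MonodromyGraph g μ ν) : 0 < Nat.card (M.Iso M) := by
  have : Nonempty (M.Iso M) := ⟨⟨WGraph.Iso.refl M.graph, fun _ => rfl⟩⟩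
  exact Nat.card_pos

namespace MonodromyGraph

/-- The factorisations that can be labelled by the graph `M`. -/
abbrev Factorization (M : MonodromyGraph g μ ν) : Type :=
  {t : Perm (Letters n) × (Fin (numBranch g μ ν) → Perm (Letters n)) × Perm (Letters n) //
    (M.labellings t).Nonempty}

theorem card_factorization_mul [Nonempty (Letters n)] (M : MonodromyGraph g μ ν) :
    Nat.card M.Factorization * Nat.card (M.Iso M) = Nat.card M.Chain := by
  have h1 : Nat.card (Σ t : M.Factorization, M.labellings t.1) =
      Nat.card M.Factorization * Nat.card (M.Iso M) := by
    have := Fintype.ofFinite M.Factorization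
    rw [Nat.card_sigma, Finset.sum_congr rfl fun t _ => M.card_labellings t.2, Finset.sum_const,
      smul_eq_mul, Finset.card_univ, ← Nat.card_eq_fintype_card]
  rw [← h1]
  refine Nat.card_congr
    { toFun := fun x => ⟨(x.2.1, x.1.1.2.1), x.2.2.1⟩
      invFun := fun p => ⟨⟨((p.1.1 0).1, p.1.2, (p.1.1 (Fin.last _)).1), p.1.1, p.2, rfl, rfl⟩,
        p.1.1, p.2, rfl, rfl⟩
      left_inv := ?_
      right_inv := fun p => rfl }
  rintro ⟨⟨⟨σ₁, η, σ₂⟩, hne⟩, s, hs, h0, h1⟩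
  dsimp only at h0 h1
  subst h0 h1
  rfl

/-- The number of factorisations that a graph contributes. -/
theorem card_factorization [Nonempty (Letters n)] (M : MonodromyGraph g μ ν) :
    (Nat.card M.Factorization : ℚ) = (2 * n).doubleFactorial * M.mult := by
  have h1 : (Nat.card M.Factorization : ℚ) * Nat.card (M.Iso M) = Nat.card M.Chain := by
    rw [← M.card_factorization_mul, Nat.cast_mul]
  have h2 : (Nat.card (M.Iso M) : ℚ) ≠ 0 := Nat.cast_ne_zero.2 M.card_iso_pos.ne'
  rw [M.card_chain] at h1
  rw [mult, ← mul_assoc, ← h1]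
  field_simp

end MonodromyGraph

/-- The partition of `2n` with all parts doubled. -/
def doublePartition (lam : n.Partition) : (2 * n).Partition where
  parts := lam.parts.map (2 * ·)
  parts_pos := by
    intro i hi
    obtain ⟨j, hj, rfl⟩ := Multiset.mem_map.1 hi
    exact Nat.mul_pos two_pos (lam.parts_pos hj)
  parts_sum := by rw [Multiset.sum_map_mul_left, Multiset.map_id', lam.parts_sum]

theorem numBranch_doublePartition :
    numBranch g (doublePartition μ) (doublePartition ν) = numBranch g μ ν := by
  simp [numBranch, doublePartition]

/-- The graph with all weights doubled. -/
def WGraph.double (Γ : WGraph) : WGraph := { Γ with weight := fun e => 2 * Γ.weight e }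

theorem WGraph.IsTwistedMonodromy.double {Γ : WGraph} (h : Γ.IsTwistedMonodromy g μ ν) :
    Γ.double.IsTwistedMonodromy g (doublePartition μ) (doublePartition ν) where
  nonempty := h.nonempty
  connected := h.connected
  attached := h.attached
  genus := h.genus
  valence_eq := h.valence_eq
  invV_invV := h.invV_invV
  invE_invE := h.invE_invE
  src_inv := h.src_inv
  tgt_inv := h.tgt_inv
  weight_inv e := congrArg (2 * ·) (h.weight_inv e)
  invV_eq_iff := h.invV_eq_iff
  invE_ne := h.invE_ne
  inward := by
    have := congrArg (Multiset.map (2 * ·)) h.inward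
    rwa [Multiset.map_map, Multiset.map_add] at this
  outward := by
    have := congrArg (Multiset.map (2 * ·)) h.outward
    rwa [Multiset.map_map, Multiset.map_add] at this
  no_source := h.no_source
  no_sink := h.no_sink
  acyclic := h.acyclic
  weight_pos e := Nat.mul_pos two_pos (h.weight_pos e)
  balanced v := by
    have := congrArg (2 * ·) (h.balanced v)
    simp only [Finset.mul_sum] at this
    exact this
  weight_four v hv e e' he he' := congrArg (2 * ·) (h.weight_four v hv e e' he he')

/-- The monodromy graph with all weights doubled. -/
def MonodromyGraph.double (M : MonodromyGraph g μ ν) :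
    MonodromyGraph g (doublePartition μ) (doublePartition ν) where
  graph := M.graph.double
  isTwisted := M.isTwisted.double
  pos v := (M.pos v).cast numBranch_doublePartition.symm
  isOrder :=
    { surjective := (finCongr numBranch_doublePartition.symm).surjective.comp M.isOrder.surjective
      eq_iff := fun u v => by rw [Fin.cast_inj]; exact M.isOrder.eq_iff u v
      lt_of_arrow := fun u v h => M.isOrder.lt_of_arrow u v h }

theorem MonodromyGraph.nonempty_iso_of_double {M N : MonodromyGraph g μ ν}
    (φ : M.double.Iso N.double) : Nonempty (M.Iso N) :=
  ⟨⟨φ.1.onV, φ.1.onE, φ.1.src_map, φ.1.tgt_map,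
    fun e => Nat.eq_of_mul_eq_mul_left two_pos (φ.1.weight_map e), φ.1.invV_map, φ.1.invE_map⟩,
    fun v => Fin.cast_injective numBranch_doublePartition.symm (φ.2 v)⟩

/-- After doubling, all weights are at least two, so no factor `ω_V - 1` vanishes, and the graph
labels some factorisation. -/
theorem MonodromyGraph.nonempty_factorization_double (hn : 0 < n) (M : MonodromyGraph g μ ν) :
    Nonempty M.double.Factorization := by
  classical
  have : Nonempty (Letters (2 * n)) := ⟨Sum.inl ⟨0, by omega⟩⟩
  have hT := M.double.isTwisted
  have h1 : 0 < (Nat.card M.double.Factorization : ℚ) * Nat.card (M.double.Iso M.double) := by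
    rw [← Nat.cast_mul, M.double.card_factorization_mul, M.double.card_chain]
    refine mul_pos (Nat.cast_pos.2 (Nat.doubleFactorial_pos _)) ?_
    refine mul_pos (mul_pos (by positivity) (Finset.prod_pos fun v hv => ?_))
      (Finset.prod_pos fun P hP => ?_)
    · obtain ⟨e, he⟩ := hT.no_source v
      rw [hT.vertexWeight_eq ((hT.invV_eq_iff v).2 (Finset.mem_filter.1 hv).2)
        (Or.inr (WGraph.mem_inEdges.1 he)), sub_pos, Nat.one_lt_cast]
      have := M.isTwisted.weight_pos e
      change 1 < 2 * M.graph.weight e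
      omega
    · obtain ⟨e, -, rfl⟩ := Finset.mem_image.1 hP
      refine Nat.cast_pos.2 ((hT.weight_pos e).trans_le ?_)
      exact Finset.le_sup (f := M.double.graph.weight) (by simp)
  have h2 : Nat.card M.double.Factorization ≠ 0 := fun h => by
    rw [h, Nat.cast_zero, zero_mul] at h1
    exact lt_irrefl _ h1
  exact (Nat.card_ne_zero.1 h2).1

/-- The graphs with doubled weights label disjoint nonempty sets of factorisations, and there are
only finitely many factorisations. The weights are doubled because a 4-valent vertex of
weight one makes the set of factorisations empty. -/
theorem finite_monodromyClass (hn : 0 < n) : Finite (MonodromyClass g μ ν) := by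
  have : Nonempty (Letters (2 * n)) := ⟨Sum.inl ⟨0, by omega⟩⟩
  let t := fun c : MonodromyClass g μ ν => (c.out.nonempty_factorization_double hn).some
  refine Finite.of_injective (fun c => (t c).1) fun c d h => ?_
  have h1 := (t c).2
  have h2 := (t d).2
  rw [show (t c).1 = (t d).1 from h] at h1
  obtain ⟨φ⟩ := MonodromyGraph.nonempty_iso_of_labellings h1 h2
  rw [← Quotient.out_equiv_out]
  exact MonodromyGraph.nonempty_iso_of_double φ

/-! ### The sum over graphs with a vertex ordering -/

theorem MonodromyClass.mult_eq_out (c : MonodromyClass g μ ν) :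
    MonodromyClass.mult c = c.out.mult := by
  conv_lhs => rw [← Quotient.out_eq c]
  rfl

/-- Every factorisation is labelled by a graph that is unique up to isomorphism. -/
theorem card_factorizations_eq_sum [Nonempty (Letters n)] [Fintype (MonodromyClass g μ ν)] :
    (factorizations g μ ν).ncard =
      ∑ c : MonodromyClass g μ ν, Nat.card c.out.Factorization := by
  rw [← Nat.card_sigma, ← Nat.card_coe_set_eq]
  refine (Nat.card_congr (Equiv.ofBijective
    (fun x : Σ c : MonodromyClass g μ ν, c.out.Factorization =>
      (⟨x.2.1, ?_⟩ : factorizations g μ ν)) ⟨?_, ?_⟩)).symm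
  · obtain ⟨s, hs, h0, h1⟩ := x.2.2
    have := x.1.out.mem_factorizations_of_isChain hs
    rwa [h0, h1] at this
  · rintro ⟨c, t, ht⟩ ⟨d, t', ht'⟩ h
    obtain rfl : t = t' := congrArg Subtype.val h
    obtain rfl : c = d :=
      Quotient.out_equiv_out.1 (MonodromyGraph.nonempty_iso_of_labellings ht ht')
    rfl
  · rintro ⟨t, ht⟩
    obtain ⟨M, hM⟩ := exists_labelling_of_mem_factorizations ht
    obtain ⟨φ⟩ : Nonempty (M.Iso (Quotient.mk _ M : MonodromyClass g μ ν).out) :=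
      Setoid.symm (Quotient.mk_out M)
    exact ⟨⟨Quotient.mk _ M, t, MonodromyGraph.labellings_nonempty_of_iso φ hM⟩, rfl⟩

theorem twistedHurwitz_eq_sum (hn : 0 < n) [Fintype (MonodromyClass g μ ν)] :
    twistedHurwitz g μ ν = ∑ c : MonodromyClass g μ ν, MonodromyClass.mult c := by
  have : Nonempty (Letters n) := ⟨Sum.inl ⟨0, hn⟩⟩
  unfold twistedHurwitz
  rw [div_eq_iff (Nat.cast_ne_zero.2 (Nat.doubleFactorial_pos _).ne'),
    card_factorizations_eq_sum, Nat.cast_sum, Finset.sum_mul]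
  refine Finset.sum_congr rfl fun c _ => ?_
  rw [c.out.card_factorization, MonodromyClass.mult_eq_out, mul_comm]

end

/-! ### Existence of vertex orderings -/

section

variable {n g : ℕ} {μ ν : n.Partition}

namespace WGraph

variable {Γ : WGraph}

theorem IsTwistedMonodromy.arrow_inv (hT : Γ.IsTwistedMonodromy g μ ν) {u v : Γ.V}
    (h : Γ.Arrow u v) : Γ.Arrow (Γ.invV u) (Γ.invV v) := by
  obtain ⟨e, h1, h2⟩ := h
  exact ⟨Γ.invE e, by rw [hT.src_inv, h1]; rfl, by rw [hT.tgt_inv, h2]; rfl⟩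

theorem IsTwistedMonodromy.transGen_inv (hT : Γ.IsTwistedMonodromy g μ ν) {u v : Γ.V}
    (h : Relation.TransGen Γ.Arrow u v) :
    Relation.TransGen Γ.Arrow (Γ.invV u) (Γ.invV v) :=
  h.lift Γ.invV fun _ _ => hT.arrow_inv

/-- Vertices are identified with their mirror images. -/
def orbitSetoid (hT : Γ.IsTwistedMonodromy g μ ν) : Setoid Γ.V where
  r u v := v = u ∨ v = Γ.invV u
  iseqv :=
    { refl := fun _ => Or.inl rfl
      symm := by
        rintro u v (rfl | rfl)
        exacts [Or.inl rfl, Or.inr (hT.invV_invV _).symm]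
      trans := by
        rintro u v w (rfl | rfl) (rfl | rfl)
        exacts [Or.inl rfl, Or.inr rfl, Or.inr rfl, Or.inl (hT.invV_invV _)] }

/-- The orbits of the involution on the vertices. -/
abbrev Orbit (hT : Γ.IsTwistedMonodromy g μ ν) : Type := Quotient (orbitSetoid hT)

theorem orbit_eq_iff (hT : Γ.IsTwistedMonodromy g μ ν) {u v : Γ.V} :
    (Quotient.mk _ u : Orbit hT) = Quotient.mk _ v ↔ v = u ∨ v = Γ.invV u := Quotient.eq

/-- A path from a vertex to its mirror image would close up to a directed cycle. -/
theorem IsTwistedMonodromy.not_transGen (hT : Γ.IsTwistedMonodromy g μ ν) {u v : Γ.V}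
    (h : (Quotient.mk _ u : Orbit hT) = Quotient.mk _ v) :
    ¬ Relation.TransGen Γ.Arrow u v := by
  intro hp
  rcases (orbit_eq_iff hT).1 h with rfl | rfl
  · exact hT.acyclic _ hp
  · have := hT.transGen_inv hp
    rw [hT.invV_invV] at this
    exact hT.acyclic _ (hp.trans this)

theorem IsTwistedMonodromy.exists_transGen (hT : Γ.IsTwistedMonodromy g μ ν) {u u' v : Γ.V}
    (h : (Quotient.mk _ u : Orbit hT) = Quotient.mk _ u') (hp : Relation.TransGen Γ.Arrow u v) :
    ∃ v', (Quotient.mk _ v' : Orbit hT) = Quotient.mk _ v ∧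
      Relation.TransGen Γ.Arrow u' v' := by
  rcases (orbit_eq_iff hT).1 h with rfl | rfl
  · exact ⟨v, rfl, hp⟩
  · exact ⟨Γ.invV v, ((orbit_eq_iff hT).2 (Or.inr rfl)).symm, hT.transGen_inv hp⟩

/-- The partial order on the orbits that the directions of the edges induce. -/
abbrev orbitOrder (hT : Γ.IsTwistedMonodromy g μ ν) : PartialOrder (Orbit hT) where
  le p q := p = q ∨ ∃ u v, Quotient.mk _ u = p ∧ Quotient.mk _ v = q ∧
    Relation.TransGen Γ.Arrow u v
  le_refl _ := Or.inl rfl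
  le_trans := by
    rintro p q r (rfl | ⟨u, v, rfl, rfl, h⟩) (rfl | ⟨u', v', h1, rfl, h'⟩)
    · exact Or.inl rfl
    · exact Or.inr ⟨u', v', h1, rfl, h'⟩
    · exact Or.inr ⟨u, v, rfl, rfl, h⟩
    · obtain ⟨w, hw, hp⟩ := hT.exists_transGen h1 h'
      exact Or.inr ⟨u, w, rfl, hw, h.trans hp⟩
  le_antisymm := by
    rintro p q (rfl | ⟨u, v, rfl, rfl, h⟩) (h0 | ⟨u', v', h1, h2, h'⟩)
    · rfl
    · rfl
    · exact h0.symm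
    · obtain ⟨w, hw, hp⟩ := hT.exists_transGen h1 h'
      exact absurd (h.trans hp) (hT.not_transGen (hw.trans h2).symm)

theorem card_orbit (hT : Γ.IsTwistedMonodromy g μ ν) [Fintype (Orbit hT)] :
    Fintype.card (Orbit hT) = numBranch g μ ν := by
  have h1 := sum_valence hT.attached
  have h2 := sum_valence_eq_of_orbits (Quotient.mk (orbitSetoid hT)) Quotient.mk_surjective
    hT.invV_invV (fun u v => orbit_eq_iff hT)
    (fun v hv => (hT.valence_eq v).resolve_right (mt (hT.invV_eq_iff v).2 hv))
    fun v hv => (hT.invV_eq_iff v).1 hv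
  have h3 := congrArg Multiset.card hT.inward
  have h4 := congrArg Multiset.card hT.outward
  rw [Multiset.card_map, Multiset.card_add] at h3 h4
  have h5 := hT.genus
  have h6 : Γ.inwardEnds.card = Γ.inwardEnds.val.card := rfl
  have h7 : Γ.outwardEnds.card = Γ.outwardEnds.val.card := rfl
  unfold numBranch
  change _ = _ + 2 * Fintype.card (Orbit hT) at h2
  omega

theorem IsTwistedMonodromy.exists_isVertexOrder (hT : Γ.IsTwistedMonodromy g μ ν) :
    ∃ pos : Γ.V → Fin (numBranch g μ ν), Γ.IsVertexOrder pos := by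
  classical
  let := orbitOrder hT
  let : Fintype (Orbit hT) := Fintype.ofFinite _
  let : Fintype (LinearExtension (Orbit hT)) := inferInstanceAs (Fintype (Orbit hT))
  have hcard : Fintype.card (LinearExtension (Orbit hT)) = numBranch g μ ν := card_orbit hT
  let o := Fintype.orderIsoFinOfCardEq _ hcard
  have hlin : ∀ p q : Orbit hT, p ≤ q → toLinearExtension p ≤ toLinearExtension q :=
    fun p q h => toLinearExtension.monotone h
  have hinj : Function.Injective (toLinearExtension : Orbit hT → LinearExtension (Orbit hT)) :=
    fun p q h => h
  have heq : ∀ u v, o.symm (toLinearExtension (Quotient.mk _ u : Orbit hT)) =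
      o.symm (toLinearExtension (Quotient.mk _ v)) ↔ v = u ∨ v = Γ.invV u := by
    intro u v
    rw [o.symm.injective.eq_iff, hinj.eq_iff, orbit_eq_iff]
  refine ⟨fun v => o.symm (toLinearExtension (Quotient.mk _ v)), ?_, heq, fun u v huv => ?_⟩
  · intro i
    obtain ⟨v, hv⟩ := Quotient.mk_surjective (s := orbitSetoid hT) (o i : Orbit hT)
    refine ⟨v, ?_⟩
    change o.symm (toLinearExtension (Quotient.mk (orbitSetoid hT) v)) = i
    rw [hv]
    exact o.symm_apply_apply i
  · refine lt_of_le_of_ne (o.symm.monotone (hlin _ _ (Or.inr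
      ⟨u, v, rfl, rfl, Relation.TransGen.single huv⟩))) fun h => ?_
    exact hT.not_transGen ((orbit_eq_iff hT).2 ((heq u v).1 h)) (Relation.TransGen.single huv)

end WGraph

/-! ### The sum over graphs without a vertex ordering -/

/-- The vertex ordering is forgotten. -/
def MonodromyClass.forget : MonodromyClass g μ ν → UnorderedClass g μ ν :=
  Quotient.map' (fun M => ⟨M.graph, M.isTwisted⟩) fun _ _ ⟨φ⟩ => ⟨φ.1⟩

theorem MonodromyClass.forget_surjective :
    Function.Surjective (MonodromyClass.forget (g := g) (μ := μ) (ν := ν)) := by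
  intro d
  induction d using Quotient.inductionOn with
  | h Γ =>
    obtain ⟨pos, hpos⟩ := Γ.2.exists_isVertexOrder
    exact ⟨Quotient.mk _ ⟨Γ.1, Γ.2, pos, hpos⟩, rfl⟩

theorem finite_unorderedClass (hn : 0 < n) : Finite (UnorderedClass g μ ν) :=
  have := finite_monodromyClass (g := g) (μ := μ) (ν := ν) hn
  Finite.of_surjective _ MonodromyClass.forget_surjective

/-- The compatible vertex orderings of a graph. -/
abbrev UnorderedGraph.Order (Γ : UnorderedGraph g μ ν) : Type :=
  {pos : Γ.1.V → Fin (numBranch g μ ν) // Γ.1.IsVertexOrder pos}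

/-- A graph together with one of its vertex orderings. -/
def UnorderedGraph.order (Γ : UnorderedGraph g μ ν) (p : Γ.Order) : MonodromyGraph g μ ν :=
  ⟨Γ.1, Γ.2, p.1, p.2⟩

/-- The automorphisms of a graph act on its vertex orderings. The orbits are the isomorphism
classes of ordered graphs, and the stabilisers are the automorphisms of ordered graphs. -/
theorem UnorderedGraph.card_order_mul (Γ : UnorderedGraph g μ ν) (p : Γ.Order) :
    Nat.card {q : Γ.Order // Nonempty ((Γ.order q).Iso (Γ.order p))} *
      Nat.card ((Γ.order p).Iso (Γ.order p)) = Nat.card (WGraph.Iso Γ.1 Γ.1) := by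
  classical
  have h1 : Nat.card (Σ q : {q : Γ.Order // Nonempty ((Γ.order q).Iso (Γ.order p))},
      (Γ.order q.1).Iso (Γ.order p)) =
      Nat.card {q : Γ.Order // Nonempty ((Γ.order q).Iso (Γ.order p))} *
      Nat.card ((Γ.order p).Iso (Γ.order p)) := by
    have := Fintype.ofFinite {q : Γ.Order // Nonempty ((Γ.order q).Iso (Γ.order p))}
    have h2 : ∀ q : {q : Γ.Order // Nonempty ((Γ.order q).Iso (Γ.order p))},
        Nat.card ((Γ.order q.1).Iso (Γ.order p)) = Nat.card ((Γ.order p).Iso (Γ.order p)) := by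
      rintro ⟨q, ⟨φ⟩⟩
      refine Nat.card_congr
        { toFun := fun ψ => φ.symm.trans ψ
          invFun := fun ψ => φ.trans ψ
          left_inv := fun ψ => Subtype.ext (WGraph.Iso.ext
            (Equiv.ext fun x => congrArg ψ.1.onV (φ.1.onV.symm_apply_apply x))
            (Equiv.ext fun x => congrArg ψ.1.onE (φ.1.onE.symm_apply_apply x)))
          right_inv := fun ψ => Subtype.ext (WGraph.Iso.ext
            (Equiv.ext fun x => congrArg ψ.1.onV (φ.1.onV.apply_symm_apply x))
            (Equiv.ext fun x => congrArg ψ.1.onE (φ.1.onE.apply_symm_apply x))) }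
    rw [Nat.card_sigma, Finset.sum_congr rfl fun q _ => h2 q, Finset.sum_const, smul_eq_mul,
      Finset.card_univ, ← Nat.card_eq_fintype_card]
  rw [← h1]
  refine Nat.card_congr
    { toFun := fun x => x.2.1
      invFun := fun φ => ⟨⟨⟨p.1 ∘ φ.onV, φ.isVertexOrder_comp p.2⟩, ⟨⟨φ, fun _ => rfl⟩⟩⟩,
        ⟨φ, fun _ => rfl⟩⟩
      left_inv := ?_
      right_inv := fun _ => rfl }
  rintro ⟨⟨⟨q, hq⟩, hne⟩, φ, hφ⟩
  change WGraph.Iso Γ.1 Γ.1 at φ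
  obtain rfl : p.1 ∘ φ.onV = q := funext hφ
  rfl

theorem numOrders_eq_card (Γ : UnorderedGraph g μ ν) :
    Γ.1.numOrders (numBranch g μ ν) = Nat.card Γ.Order := (Nat.card_coe_set_eq _).symm

/-- The multiplicities of the orderings of one graph add up. -/
theorem sum_mult_fiber [Fintype (MonodromyClass g μ ν)] [DecidableEq (UnorderedClass g μ ν)]
    (d : UnorderedClass g μ ν) :
    ∑ c : MonodromyClass g μ ν with c.forget = d, MonodromyClass.mult c =
      UnorderedClass.mult d := by
  classical
  induction d using Quotient.inductionOn with
  | h Γ =>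
    have : Fintype Γ.Order := Fintype.ofFinite _
    let π : Γ.Order → MonodromyClass g μ ν := fun p => Quotient.mk _ (Γ.order p)
    have hA : (Nat.card (WGraph.Iso Γ.1 Γ.1) : ℚ) ≠ 0 := by
      have : Nonempty (WGraph.Iso Γ.1 Γ.1) := ⟨WGraph.Iso.refl _⟩
      exact Nat.cast_ne_zero.2 Nat.card_pos.ne'
    have hmaps : ∀ p ∈ (Finset.univ : Finset Γ.Order), π p ∈ Finset.univ.filter
        fun c : MonodromyClass g μ ν => c.forget = Quotient.mk _ Γ :=
      fun p _ => Finset.mem_filter.2 ⟨Finset.mem_univ _, rfl⟩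
    have hfib : ∀ c ∈ Finset.univ.filter
        fun c : MonodromyClass g μ ν => c.forget = Quotient.mk _ Γ, MonodromyClass.mult c =
          ((Finset.univ.filter fun p => π p = c).card : ℚ) *
            (Γ.1.weightProd (numBranch g μ ν) * (1 / Nat.card (WGraph.Iso Γ.1 Γ.1))) := by
      intro c hc
      have hc' := (Finset.mem_filter.1 hc).2
      obtain ⟨p, rfl⟩ : ∃ p, π p = c := by
        induction c using Quotient.inductionOn with
        | h M =>
          obtain ⟨φ⟩ : Nonempty (WGraph.Iso M.graph Γ.1) := Quotient.exact hc'
          exact ⟨⟨M.pos ∘ φ.symm.onV, φ.symm.isVertexOrder_comp M.isOrder⟩,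
            Quotient.sound ⟨⟨φ.symm, fun _ => rfl⟩⟩⟩
      have h1 := Γ.card_order_mul p
      have h2 : Nat.card {q : Γ.Order // Nonempty ((Γ.order q).Iso (Γ.order p))} =
          (Finset.univ.filter fun q => π q = π p).card := by
        rw [Nat.card_eq_fintype_card, Fintype.card_subtype]
        congr 1
        ext q
        simp only [Finset.mem_filter, Finset.mem_univ, true_and]
        exact (Quotient.eq (r := monodromySetoid g μ ν)).symm
      have h3 : (Nat.card ((Γ.order p).Iso (Γ.order p)) : ℚ) ≠ 0 :=
        Nat.cast_ne_zero.2 (Γ.order p).card_iso_pos.ne'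
      rw [h2] at h1
      rw [← h1] at hA ⊢
      rw [Nat.cast_mul] at hA ⊢
      have h4 := left_ne_zero_of_mul hA
      change Γ.1.weightProd _ * (1 / _) = _
      field_simp
    rw [Finset.sum_congr rfl hfib, ← Finset.sum_mul, ← Nat.cast_sum,
      ← Finset.card_eq_sum_card_fiberwise hmaps, Finset.card_univ, ← Nat.card_eq_fintype_card,
      ← numOrders_eq_card, ← mul_assoc]
    rfl

theorem twistedHurwitz_eq_sum_unordered (hn : 0 < n) [Fintype (UnorderedClass g μ ν)] :
    twistedHurwitz g μ ν = ∑ d : UnorderedClass g μ ν, UnorderedClass.mult d := by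
  classical
  have := finite_monodromyClass (g := g) (μ := μ) (ν := ν) hn
  have := Fintype.ofFinite (MonodromyClass g μ ν)
  rw [twistedHurwitz_eq_sum hn, ← Finset.sum_fiberwise (g := MonodromyClass.forget)]
  exact Finset.sum_congr rfl fun d _ => sum_mult_fiber d

end

end TwistedHurwitz

end

theorem corollary5 (g n : ℕ) (hn : 0 < n) (μ ν : n.Partition) :
    (Finite (TwistedHurwitz.MonodromyClass g μ ν) ∧
      TwistedHurwitz.twistedHurwitz g μ ν =
        ∑ᶠ Γ : TwistedHurwitz.MonodromyClass g μ ν, TwistedHurwitz.MonodromyClass.mult Γ) ∧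
    (Finite (TwistedHurwitz.UnorderedClass g μ ν) ∧
      TwistedHurwitz.twistedHurwitz g μ ν =
        ∑ᶠ Γ : TwistedHurwitz.UnorderedClass g μ ν, TwistedHurwitz.UnorderedClass.mult Γ) := by
  have hM := TwistedHurwitz.finite_monodromyClass (g := g) (μ := μ) (ν := ν) hn
  have hU := TwistedHurwitz.finite_unorderedClass (g := g) (μ := μ) (ν := ν) hn
  have := Fintype.ofFinite (TwistedHurwitz.MonodromyClass g μ ν)
  have := Fintype.ofFinite (TwistedHurwitz.UnorderedClass g μ ν)
  refine ⟨⟨hM, ?_⟩, hU, ?_⟩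
  · rw [finsum_eq_sum_of_fintype, TwistedHurwitz.twistedHurwitz_eq_sum hn]
  · rw [finsum_eq_sum_of_fintype, TwistedHurwitz.twistedHurwitz_eq_sum_unordered hn]
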